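/- Let $\alpha=\tfrac45$, $\beta=\tfrac12$ and, for $k\in[0,1]$, $\varepsilon\in\mathbb R$, consider Welander's field in the coordinates $x=T$, $y=S-\alpha T-\varepsilon$, \[ F_{k,\varepsilon}(x,y)=\bigl(1-x-kx,\ \beta-\beta\varepsilon-k\varepsilon-\alpha-(\beta+k)y-(\alpha\beta-\alpha)x\bigr). \] The nonsmooth (Filippov) system is $F_{1,\varepsilon}$ for $y>0$ and $F_{0,\varepsilon}$ for $y<0$. The smooth system with $k=\frac1\pi\arctan(y/a)+\frac12$, $a>0$, written in the coordinates $(x,k)$, $0<k<1$, in which $y=-a\cot(\pi k)$, is the blow-up system \[ \dot x=1-x-kx,\qquad \dot k=\frac{1}{a\pi}\sin^2(\pi k)\bigl(\beta-\beta\varepsilon-k\varepsilon-\alpha+a(\beta+k)\cot(\pi k)-(\alpha\beta-\alpha)x\bigr). \] (1) *Nonsmooth system.* At $\varepsilon=0$ the point $(x,y)=(\frac34,0)$ is a fused focus: both fields $F_{1,0}$, $F_{0,0}$ are tangent to $y=0$ there, both tangencies are invisible ($\ddot y<0$ along $F_{1,0}$, $\ddot y>0$ along $F_{0,0}$), and the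 two fields point in opposite directions; moreover $F_{1/3,0}(\frac34,0)=0$. For every $\varepsilon$ the sliding region on $y=0$ (the set of $x$ for which the second component of $F_{k,\varepsilon}(x,0)$ vanishes for some $k\in[0,1]$) is the closed interval with end points $\frac34+\frac54\varepsilon$ and $\frac34+\frac{15}4\varepsilon$; sliding is stable for $\varepsilon>0$ and unstable for $\varepsilon<0$ (the $k$-derivative of the second component of $F_{k,\varepsilon}(x,0)$ is negative, respectively positive). (2) *Smooth system.* There are $a_0,\varepsilon_0>0$ such that for $0<a<a_0$ and $|\varepsilon|<\varepsilon_0$ the blow-up system has exactly one equilibrium $E(\varepsilon,a)$ in the strip $0<k<1$, with $E(\varepsilon,a)\to(x,k)=(\frac34,\frac13)$ as $(\varepsilon,a)\to(0,0)$, $a>0$, and there is a continuous curve $\varepsilon=h(a)$, $0<a<a_0$, $|h(a)|<\varepsilon_0$, with the following properties. - $(h(a),a)\to(0,0)$ as $a\to0^+$; more precisely $h(a)/a\to\frac{\sqrt3}{3}-\frac{26\pi}{9}$. - For every fixed $a\in(0,a_0)$ the system has a supercritical Hopf bifurcation at $E(h(a),a)$ as $\varepsilon$ decreases through $h(a)$.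 That is: the equilibria near this point are those of the branch $\varepsilon\mapsto E(\varepsilon,a)$, which is continuous at $h(a)$; for $\varepsilon$ near $h(a)$ the eigenvalues of the Jacobian at $E(\varepsilon,a)$ are $\sigma(\varepsilon)\pm i\omega(\varepsilon)$ with $\omega(\varepsilon)>0$, $\sigma(h(a))=0$, $\sigma'(h(a))<0$; the first Lyapunov coefficient at $\varepsilon=h(a)$ is negative; for $\varepsilon>h(a)$ close to $h(a)$ the equilibrium is asymptotically stable; for $\varepsilon<h(a)$ close to $h(a)$ the equilibrium is unstable and there is an asymptotically (orbitally) stable periodic orbit, which shrinks to the point $E(h(a),a)$ as $\varepsilon\to h(a)^-$. - For all $0<a<a_0$, $|\varepsilon|<\varepsilon_0$ the equilibrium $E(\varepsilon,a)$ is asymptotically stable if $\varepsilon>h(a)$ and unstable if $\varepsilon<h(a)$. - As $a\to0^+$ the Hopf point $E(h(a),a)$ converges to $(x,k)=(\frac34,\frac13)$; in the coordinates $(x,y)$, $y=-a\cot(\pi k)$, it converges to the fused focus $(\frac34,0)$. -/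

import Mathlib

noncomputable section

namespace Welander

/-! ### Stability, periodic orbits and Hopf bifurcation for planar autonomous systems -/

/-- Lyapunov stability of a set `A` for `p' = f p` : every solution (on any interval `[0, T]`) that
starts close enough to `A` stays, as long as it is defined, in a prescribed neighbourhood of `A`. -/
def LyapunovStable (f : ℝ × ℝ → ℝ × ℝ) (A : Set (ℝ × ℝ)) : Prop :=
  ∀ U : Set (ℝ × ℝ), IsOpen U → A ⊆ U → ∃ V : Set (ℝ × ℝ), IsOpen V ∧ A ⊆ V ∧
    ∀ (γ : ℝ → ℝ × ℝ) (T : ℝ), 0 ≤ T → IsIntegralCurveOn γ (fun _ => f) (Set.Icc 0 T) →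
      γ 0 ∈ V → ∀ t ∈ Set.Icc 0 T, γ t ∈ U

/-- Asymptotic stability of a set `A` for `p' = f p` : Lyapunov stability, and every initial value
close to `A` has a solution for all `t ≥ 0`, which converges to `A`. (The fields considered are
smooth, so that this solution is unique.) For `A` a closed orbit this is asymptotic orbital
stability. -/
def AsymptoticallyStable (f : ℝ × ℝ → ℝ × ℝ) (A : Set (ℝ × ℝ)) : Prop :=
  LyapunovStable f A ∧ ∃ V : Set (ℝ × ℝ), IsOpen V ∧ A ⊆ V ∧ ∀ p ∈ V, ∃ γ : ℝ → ℝ × ℝ,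
    IsIntegralCurveOn γ (fun _ => f) (Set.Ici 0) ∧ γ 0 = p ∧
      Filter.Tendsto (fun t => Metric.infDist (γ t) A) Filter.atTop (nhds 0)

/-- `Γ` is the orbit of a nonconstant periodic solution of `p' = f p`. -/
def IsPeriodicOrbit (f : ℝ × ℝ → ℝ × ℝ) (Γ : Set (ℝ × ℝ)) : Prop :=
  ∃ (γ : ℝ → ℝ × ℝ) (T : ℝ), 0 < T ∧ IsIntegralCurve γ (fun _ => f) ∧ Function.Periodic γ T ∧
    (∃ t, γ t ≠ γ 0) ∧ Γ = Set.range γ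

/-- Second partial derivative at `0` of a planar field, in the directions `u, v`. -/
def d2 (G : ℝ × ℝ → ℝ × ℝ) (u v : ℝ × ℝ) : ℝ × ℝ := iteratedFDeriv ℝ 2 G 0 ![u, v]

/-- Third partial derivative at `0` of a planar field, in the directions `u, v, w`. -/
def d3 (G : ℝ × ℝ → ℝ × ℝ) (u v w : ℝ × ℝ) : ℝ × ℝ := iteratedFDeriv ℝ 3 G 0 ![u, v, w]

/-- The first Lyapunov coefficient of a planar field `G = (g₁, g₂)` with an equilibrium at `0` and
linear part `(u, v) ↦ (-ω v, ω u)`, by the classical formula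
`16 ℓ = g₁ᵤᵤᵤ + g₁ᵤᵥᵥ + g₂ᵤᵤᵥ + g₂ᵥᵥᵥ
  + (g₁ᵤᵥ (g₁ᵤᵤ + g₁ᵥᵥ) - g₂ᵤᵥ (g₂ᵤᵤ + g₂ᵥᵥ) - g₁ᵤᵤ g₂ᵤᵤ + g₁ᵥᵥ g₂ᵥᵥ) / ω`. -/
def lyapunovCoeff (ω : ℝ) (G : ℝ × ℝ → ℝ × ℝ) : ℝ :=
  let i : ℝ × ℝ := (1, 0)
  let j : ℝ × ℝ := (0, 1)
  (1 / 16) * ((d3 G i i i).1 + (d3 G i j j).1 + (d3 G i i j).2 + (d3 G j j j).2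
    + ((d2 G i j).1 * ((d2 G i i).1 + (d2 G j j).1)
      - (d2 G i j).2 * ((d2 G i i).2 + (d2 G j j).2)
      - (d2 G i i).1 * (d2 G i i).2 + (d2 G j j).1 * (d2 G j j).2) / ω)

/-- The family `p' = f μ p`, with branch of equilibria `e μ`, has a supercritical Hopf bifurcation
at `μ = μ₀` as `μ` decreases through `μ₀`. -/
structure IsSupercriticalHopf (f : ℝ → ℝ × ℝ → ℝ × ℝ) (e : ℝ → ℝ × ℝ) (μ₀ : ℝ) : Prop where
  /-- The branch of equilibria is continuous at the bifurcation value, -/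
  continuousAt_branch : ContinuousAt e μ₀
  /-- and consists of all the equilibria close to the bifurcation point. -/
  equilibria : ∀ᶠ q : ℝ × (ℝ × ℝ) in nhds (μ₀, e μ₀), f q.1 q.2 = 0 ↔ q.2 = e q.1
  /-- The linearization at the equilibrium has a pair `σ ± i ω` of eigenvalues, with `ω > 0`, which
  crosses the imaginary axis with nonzero speed. -/
  crossing : ∃ σ ω : ℝ → ℝ,
    (∀ᶠ μ in nhds μ₀, 0 < ω μ ∧
      (LinearMap.charpoly ((fderiv ℝ (f μ) (e μ) : ℝ × ℝ →L[ℝ] ℝ × ℝ) :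
          ℝ × ℝ →ₗ[ℝ] ℝ × ℝ)).aroots ℂ
        = {(⟨σ μ, ω μ⟩ : ℂ), (⟨σ μ, -ω μ⟩ : ℂ)}) ∧
    σ μ₀ = 0 ∧ ∃ s : ℝ, s < 0 ∧ HasDerivAt σ s μ₀
  /-- Genericity, with the supercritical sign: in linear coordinates that bring the linear part at
  the bifurcation point to a rotation, the first Lyapunov coefficient is negative. -/
  lyapunov_neg : ∃ (ω : ℝ) (L : (ℝ × ℝ) ≃L[ℝ] (ℝ × ℝ)), 0 < ω ∧
    (∀ v : ℝ × ℝ, fderiv ℝ (fun u => L (f μ₀ (e μ₀ + L.symm u))) 0 v = (-ω * v.2, ω * v.1)) ∧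
    lyapunovCoeff ω (fun u => L (f μ₀ (e μ₀ + L.symm u))) < 0
  /-- The equilibrium is asymptotically stable for `μ > μ₀`, -/
  stable_right : ∀ᶠ μ in nhdsWithin μ₀ (Set.Ioi μ₀), AsymptoticallyStable (f μ) {e μ}
  /-- and unstable for `μ < μ₀`. -/
  unstable_left : ∀ᶠ μ in nhdsWithin μ₀ (Set.Iio μ₀), ¬ LyapunovStable (f μ) {e μ}
  /-- For `μ < μ₀` there is an asymptotically stable periodic orbit, which shrinks to the bifurcation
  point as `μ → μ₀`. -/
  cycle : ∃ Γ : ℝ → Set (ℝ × ℝ),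
    (∀ᶠ μ in nhdsWithin μ₀ (Set.Iio μ₀),
      IsPeriodicOrbit (f μ) (Γ μ) ∧ AsymptoticallyStable (f μ) (Γ μ)) ∧
    ∀ U ∈ nhds (e μ₀), ∀ᶠ μ in nhdsWithin μ₀ (Set.Iio μ₀), Γ μ ⊆ U

/-! ### Welander's model -/

/-- The parameter `α = 4/5`. -/
def α : ℝ := 4 / 5

/-- The parameter `β = 1/2`. -/
def β : ℝ := 1 / 2

/-- Welander's field in the coordinates `x = T`, `y = S - α T - ε`, as a function of the mixing rate
`k`. The nonsmooth (Filippov) system has `k = 1` for `y > 0` and `k = 0` for `y < 0`. -/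
def field (k ε : ℝ) (p : ℝ × ℝ) : ℝ × ℝ :=
  (1 - p.1 - k * p.1, β - β * ε - k * ε - α - (β + k) * p.2 - (α * β - α) * p.1)

/-- The smooth system with mixing rate `k = arctan (y / a) / π + 1 / 2`, blown up, that is, written
in the coordinates `p = (x, k)`, `0 < k < 1`, in which `y = -a cot (π k)`. -/
def blowUp (ε a : ℝ) (p : ℝ × ℝ) : ℝ × ℝ :=
  (1 - p.1 - p.2 * p.1,
    1 / (a * Real.pi) * Real.sin (Real.pi * p.2) ^ 2 *
      (β - β * ε - p.2 * ε - α + a * (β + p.2) * Real.cot (Real.pi * p.2) - (α * β - α) * p.1))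

/-- The sliding region, on the splitting manifold `y = 0`, of the nonsmooth system. -/
def slidingRegion (ε : ℝ) : Set ℝ := {x | ∃ k ∈ Set.Icc (0 : ℝ) 1, (field k ε (x, 0)).2 = 0}

/-- The `k`-derivative of the normal velocity at a point `(x, 0)` of the splitting manifold. Sliding
is stable where it is negative, unstable where it is positive. -/
def slidingRate (ε x k : ℝ) : ℝ := deriv (fun l => (field l ε (x, 0)).2) k

/-- The point `p` of the splitting manifold `y = 0` is a fused focus of the piecewise smooth field
that is `X` for `y > 0` and `Y` for `y < 0` : both fields are tangent to the manifold at `p`, both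
tangencies are invisible (`y'' < 0` along `X`, `y'' > 0` along `Y`), and the two fields point in
opposite directions, so that orbits turn around `p`. -/
def IsFusedFocus (X Y : ℝ × ℝ → ℝ × ℝ) (p : ℝ × ℝ) : Prop :=
  p.2 = 0 ∧ (X p).2 = 0 ∧ (Y p).2 = 0 ∧
    fderiv ℝ (fun q => (X q).2) p (X p) < 0 ∧ 0 < fderiv ℝ (fun q => (Y q).2) p (Y p) ∧
    (X p).1 * (Y p).1 < 0

end Welander

end

/-! At an equilibrium with mixing rate `k` the first equation gives `x = 1 / (1 + k)`, and the
second can then be solved for `ε`: `ε = g(k) + a cot(πk)`, with `g = pseudoEpsilon`. On `(0, 1)`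
this decreases strictly and takes every real value, so there is exactly one equilibrium and `k` is a
coordinate along the branch (`mixingRate` inverts it). Questions about `ε` become explicit questions
about `k`.

The Jacobian always has positive determinant, and by `halfTrace_eq` its trace has the sign of `A(k)
- a`, where `A = hopfParam`. Since `A(1/3) = 0 < A'(1/3)`, the equation `A(k) = a` has a solution `k
= K(a)` near `1/3` for small `a > 0`, and `h(a) = g(K(a)) + a cot(πK(a))`. On this curve `g(K) =
-aπ(3/2 + 2K) / sin²(πK)`, whence the limit of `h(a) / a`. As `k` decreases when `ε` grows, the
trace crosses zero with negative speed in `ε`. Off the curve, stability is decided by a quadratic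
form that solves the Lyapunov equation of the Jacobian.

The blow-up field is affine in `x`. Hence linear coordinates `(u, v)` that put the Jacobian in the
form `σ ± iω`, with `u` the deviation of `k`, turn it into a field whose nonlinear part is affine in
`v` (`conjField_blowUp`). Its first Lyapunov coefficient `ℓ` is explicit, and it is negative on the
Hopf curve because `ω² ≥ 4` there.

The stable cycle comes from averaging. Write `σ = δ²` and `x = δ / r` in polar coordinates. After
two periodic corrections, `w ≈ x² / 2` satisfies `dw/dθ = -δ²(2w + ℓ) / ω` up to `O(δ³)`: in the
variable `1 / r²` the amplitude equation `r' = σr + ℓr³` is linear. For `ℓ < 0` it attracts towards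
`w = -ℓ / 2`, so the true equation contracts `w`-distances on an annulus of radius `O(√σ)`. There
the return map has a fixed point, contraction makes the closed orbit asymptotically stable, and the
orbit shrinks with `σ`. The constants are uniform in the data of the field, so one annulus
construction serves all `ε` near `h(a)`. -/

namespace Welander

open Set Filter Topology
open scoped NNReal

/-! ### Global existence, exit times and periodic extension of solutions -/

section ODE

variable {E : Type*} [NormedAddCommGroup E] [NormedSpace ℝ E]

/-- A bounded field that is globally Lipschitz in space has global solutions. -/
theorem exists_global_solution [CompleteSpace E] {f : ℝ → E → E} {K : ℝ≥0} {M : ℝ}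
    (hf : ∀ t, LipschitzWith K (f t)) (hc : ∀ x, Continuous fun t => f t x)
    (hM : ∀ t x, ‖f t x‖ ≤ M) (x₀ : E) :
    ∃ γ : ℝ → E, γ 0 = x₀ ∧ ∀ t, HasDerivAt γ (f t (γ t)) t := by
  have hM0 : 0 ≤ M := (norm_nonneg _).trans (hM 0 x₀)
  have key : ∀ n : ℕ, ∃ α : ℝ → E, α 0 = x₀ ∧
      ∀ t ∈ Ioo (-(n + 1 : ℝ)) (n + 1), HasDerivAt α (f t (α t)) t := by
    intro n
    have hn : (0 : ℝ) ≤ n := Nat.cast_nonneg n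
    have hmem : (0 : ℝ) ∈ Icc (-(n + 1 : ℝ)) (n + 1) := ⟨by linarith, by linarith⟩
    -- A solution of speed at most `M` moves by at most `M * (n + 1)` in time `n + 1`, so a ball of
    -- this radius lets Picard–Lindelöf reach the whole interval.
    have hpl : IsPicardLindelof f (⟨0, hmem⟩ : Icc (-(n + 1 : ℝ)) (n + 1)) x₀
        (⟨M * (n + 1), by positivity⟩ : ℝ≥0) 0 (⟨M, hM0⟩ : ℝ≥0) K :=
      { lipschitzOnWith := fun t _ => (hf t).lipschitzOnWith
        continuousOn := fun x _ => (hc x).continuousOn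
        norm_le := fun t _ x _ => hM t x
        mul_max_le := by
          simp only [sub_zero, zero_sub, neg_neg, max_self, NNReal.coe_zero]
          exact le_rfl }
    obtain ⟨α, h0, hα⟩ := hpl.exists_eq_forall_mem_Icc_hasDerivWithinAt₀
    exact ⟨α, h0, fun t ht => (hα t (Ioo_subset_Icc_self ht)).hasDerivAt (Icc_mem_nhds ht.1 ht.2)⟩
  choose α hα0 hα using key
  have hagree : ∀ m n : ℕ, m ≤ n → EqOn (α m) (α n) (Ioo (-(m + 1 : ℝ)) (m + 1)) := by
    intro m n hmn
    have hmn' : (m : ℝ) ≤ n := Nat.cast_le.2 hmn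
    have hm : (0 : ℝ) ≤ m := Nat.cast_nonneg m
    refine ODE_solution_unique_of_mem_Ioo (v := f) (s := fun _ => univ) (K := K) (t₀ := 0)
      (fun t _ => (hf t).lipschitzOnWith) ⟨by linarith, by linarith⟩
      (fun t ht => ⟨hα m t ht, trivial⟩) (fun t ht => ⟨hα n t ⟨?_, ?_⟩, trivial⟩)
      (by rw [hα0, hα0])
    · linarith [ht.1]
    · linarith [ht.2]
  have hval : ∀ (n : ℕ) (s : ℝ), |s| < n + 1 → α ⌈|s|⌉₊ s = α n s := by
    intro n s hs
    have h1 : |s| ≤ ⌈|s|⌉₊ := Nat.le_ceil _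
    rcases le_total ⌈|s|⌉₊ n with h | h
    · exact hagree _ _ h (abs_lt.1 (by linarith))
    · exact (hagree _ _ h (abs_lt.1 hs)).symm
  -- The local solutions are glued by taking at time `t` one whose interval contains `t`; by `hval`
  -- the choice does not matter near `t`.
  refine ⟨fun t => α ⌈|t|⌉₊ t, hα0 _, fun t => ?_⟩
  have ht : |t| < (⌈|t|⌉₊ : ℝ) + 1 := (Nat.le_ceil _).trans_lt (lt_add_one _)
  refine (hα _ t (abs_lt.1 ht)).congr_of_eventuallyEq ?_
  filter_upwards [(continuous_abs.tendsto t).eventually (gt_mem_nhds ht)] with s hs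
  exact hval _ s hs

/-- First exit time from an open set. -/
theorem exists_first_exit {X : Type*} [TopologicalSpace X] {γ : ℝ → X} {T t₁ : ℝ} {U : Set X}
    (hγ : ContinuousOn γ (Icc 0 T)) (hU : IsOpen U) (h0 : γ 0 ∈ U) (ht₁ : t₁ ∈ Icc 0 T)
    (h1 : γ t₁ ∉ U) :
    ∃ τ ∈ Ioc 0 T, γ τ ∉ U ∧ ∀ t ∈ Ico 0 τ, γ t ∈ U := by
  set S : Set ℝ := Icc 0 T ∩ γ ⁻¹' Uᶜ with hS
  have hSc : IsClosed S := hγ.preimage_isClosed_of_isClosed isClosed_Icc hU.isClosed_compl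
  have hSb : BddBelow S := ⟨0, fun t ht => ht.1.1⟩
  have hmem : sInf S ∈ S := hSc.csInf_mem ⟨t₁, ht₁, h1⟩ hSb
  refine ⟨sInf S, ⟨lt_of_le_of_ne hmem.1.1 fun h => ?_, hmem.1.2⟩, hmem.2, fun t ht => ?_⟩
  · exact hmem.2 (h ▸ h0)
  · by_contra h
    exact absurd (csInf_le hSb ⟨⟨ht.1, ht.2.le.trans hmem.1.2⟩, h⟩) (not_le.2 ht.2)

/-- A `C¹` field agrees on a given ball with a bounded and globally Lipschitz one. -/
theorem exists_lipschitz_modification {f : ℝ × ℝ → ℝ × ℝ} (hf : ContDiff ℝ 1 f) (R : ℝ) :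
    ∃ (F : ℝ × ℝ → ℝ × ℝ) (K : ℝ≥0) (M : ℝ), LipschitzWith K F ∧ (∀ p, ‖F p‖ ≤ M) ∧
      EqOn F f (Metric.closedBall 0 R) := by
  rcases lt_or_ge R 0 with hR | hR
  · refine ⟨0, 0, 0, LipschitzWith.const _, by simp, ?_⟩
    rw [Metric.closedBall_eq_empty.2 hR]
    exact eqOn_empty _ _
  have hle : -R ≤ R := by linarith
  -- A ball of the sup norm is a square, so clamping each coordinate is a 1-Lipschitz retraction
  -- onto it; `f` is composed with this retraction.
  let c : ℝ → ℝ := fun x => projIcc (-R) R hle x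
  have hc : LipschitzWith 1 c := LipschitzWith.subtype_val _ |>.comp (LipschitzWith.projIcc hle)
    |>.weaken (by simp)
  let χ : ℝ × ℝ → ℝ × ℝ := fun p => (c p.1, c p.2)
  have hχ : LipschitzWith 1 χ := by
    have h1 := (hc.comp LipschitzWith.prod_fst).prodMk (hc.comp LipschitzWith.prod_snd)
    simpa using! h1
  have hmem : ∀ p, χ p ∈ Metric.closedBall (0 : ℝ × ℝ) R := by
    intro p
    rw [mem_closedBall_zero_iff, Prod.norm_def]
    exact max_le (abs_le.2 (projIcc (-R) R hle p.1).2) (abs_le.2 (projIcc (-R) R hle p.2).2)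
  have hcomp : IsCompact (Metric.closedBall (0 : ℝ × ℝ) R) := isCompact_closedBall _ _
  obtain ⟨K, hK⟩ : ∃ K, LipschitzOnWith K f (Metric.closedBall 0 R) := by
    refine LocallyLipschitzOn.exists_lipschitzOnWith_of_compact hcomp ?_
    exact (hf.locallyLipschitz).locallyLipschitzOn
  obtain ⟨M, hM⟩ := hcomp.exists_bound_of_continuousOn hf.continuous.continuousOn
  refine ⟨f ∘ χ, K, M, ?_, fun p => hM _ (hmem p), fun p hp => ?_⟩
  · rw [← lipschitzOnWith_univ]
    have := hK.comp (hχ.lipschitzOnWith (s := univ)) (fun p _ => hmem p)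
    simpa using! this
  · rw [mem_closedBall_zero_iff, Prod.norm_def, max_le_iff] at hp
    have h1 : c p.1 = p.1 := by
      have := projIcc_of_mem hle (x := p.1) (abs_le.1 hp.1)
      exact congrArg Subtype.val this
    have h2 : c p.2 = p.2 := by
      have := projIcc_of_mem hle (x := p.2) (abs_le.1 hp.2)
      exact congrArg Subtype.val this
    simp [χ, h1, h2]

/-- If all solutions from `p` stay in a ball, there is a solution for all positive times. -/
theorem exists_solution_Ici {f : ℝ × ℝ → ℝ × ℝ} (hf : ContDiff ℝ 1 f) {R : ℝ} {p : ℝ × ℝ}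
    (hp : ‖p‖ ≤ R)
    (h : ∀ (γ : ℝ → ℝ × ℝ) (T : ℝ), 0 ≤ T → IsIntegralCurveOn γ (fun _ => f) (Icc 0 T) →
      γ 0 = p → ∀ t ∈ Icc 0 T, ‖γ t‖ ≤ R) :
    ∃ γ : ℝ → ℝ × ℝ, IsIntegralCurveOn γ (fun _ => f) (Ici 0) ∧ γ 0 = p := by
  -- The margin 1 makes the exit argument work: up to the first exit from the ball of radius `R + 1`
  -- the curve also solves the original equation, so the hypothesis still bounds it by `R`.
  obtain ⟨F, K, M, hFK, hFM, hFf⟩ := exists_lipschitz_modification hf (R + 1)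
  obtain ⟨γ, h0, hγ⟩ := exists_global_solution (f := fun _ => F) (fun _ => hFK)
    (fun _ => continuous_const) (fun _ => hFM) p
  have hγc : Continuous γ := continuous_iff_continuousAt.2 fun t => (hγ t).continuousAt
  have hsol : ∀ T, (∀ t ∈ Icc 0 T, ‖γ t‖ ≤ R + 1) → IsIntegralCurveOn γ (fun _ => f) (Icc 0 T) := by
    intro T hT t ht
    have := hγ t
    rw [hFf (mem_closedBall_zero_iff.2 (hT t ht))] at this
    exact this.hasDerivWithinAt
  have hbound : ∀ t, 0 ≤ t → ‖γ t‖ < R + 1 := by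
    intro T hT
    by_contra hcon
    obtain ⟨τ, hτ, hτU, hlt⟩ := exists_first_exit (U := Metric.ball (0 : ℝ × ℝ) (R + 1))
      hγc.continuousOn Metric.isOpen_ball (by rw [h0, mem_ball_zero_iff]; linarith)
      (right_mem_Icc.2 hT) (by rwa [mem_ball_zero_iff])
    have hle : ∀ t ∈ Icc 0 τ, ‖γ t‖ ≤ R + 1 := by
      have hcl : IsClosed {t | ‖γ t‖ ≤ R + 1} := isClosed_le hγc.norm continuous_const
      have hsub : closure (Ico 0 τ) ⊆ {t | ‖γ t‖ ≤ R + 1} :=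
        hcl.closure_subset_iff.2 fun t ht => (mem_ball_zero_iff.1 (hlt t ht)).le
      rw [closure_Ico hτ.1.ne] at hsub
      exact fun t ht => hsub ht
    have := h γ τ hτ.1.le (hsol τ hle) h0 τ (right_mem_Icc.2 hτ.1.le)
    exact hτU (mem_ball_zero_iff.2 (by linarith))
  refine ⟨γ, fun t ht => ?_, h0⟩
  have := hγ t
  rw [hFf (mem_closedBall_zero_iff.2 (hbound t ht).le)] at this
  exact this.hasDerivWithinAt

/-- A bounded forward solution that returns to its initial point extends to a periodic solution. -/
theorem exists_periodic_extension {f : ℝ × ℝ → ℝ × ℝ} (hf : ContDiff ℝ 1 f) {R T : ℝ} (hT : 0 < T)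
    {γ : ℝ → ℝ × ℝ} (hγ : IsIntegralCurveOn γ (fun _ => f) (Icc 0 T)) (hR : ∀ t ∈ Icc 0 T, ‖γ t‖ ≤ R)
    (hret : γ T = γ 0) :
    ∃ δ : ℝ → ℝ × ℝ, IsIntegralCurve δ (fun _ => f) ∧ Function.Periodic δ T ∧
      EqOn δ γ (Icc 0 T) := by
  obtain ⟨F, K, M, hFK, hFM, hFf⟩ := exists_lipschitz_modification hf R
  obtain ⟨δ, h0, hδ⟩ := exists_global_solution (f := fun _ => F) (fun _ => hFK)
    (fun _ => continuous_const) (fun _ => hFM) (γ 0)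
  have heq : EqOn δ γ (Icc 0 T) := by
    refine ODE_solution_unique (v := fun _ => F) (fun _ => hFK)
      (fun t _ => (hδ t).continuousAt.continuousWithinAt) (fun t _ => (hδ t).hasDerivWithinAt)
      hγ.continuousOn (fun t ht => ?_) h0
    have h1 := hγ t (Ico_subset_Icc_self ht)
    rw [hFf (mem_closedBall_zero_iff.2 (hR t (Ico_subset_Icc_self ht)))]
    exact (h1.mono_of_mem_nhdsWithin (Icc_mem_nhdsGE_of_mem ht))
  -- The modified field is autonomous, so the translate by `T` is again a solution, with the same
  -- value at 0.
  have hper : Function.Periodic δ T := by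
    have : (fun t => δ (t + T)) = δ := by
      refine ODE_solution_unique_univ (v := fun _ => F) (s := fun _ => univ) (K := K) (t₀ := 0)
        (fun _ => hFK.lipschitzOnWith)
        (fun t => ⟨(hδ (t + T)).comp_add_const t T, trivial⟩) (fun t => ⟨hδ t, trivial⟩) ?_
      simp only [zero_add]
      rw [heq (right_mem_Icc.2 hT.le), hret, h0]
    exact fun t => congrFun this t
  refine ⟨δ, fun t => ?_, hper, heq⟩
  obtain ⟨s, hs, hst⟩ := hper.exists_mem_Ico₀ hT t
  have := hδ t
  rwa [hFf (mem_closedBall_zero_iff.2 ?_)] at this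
  rw [hst, heq (Ico_subset_Icc_self hs)]
  exact hR s (Ico_subset_Icc_self hs)

end ODE

/-! ### Lyapunov functions: stability and instability -/

section Lyapunov

/-- Exponential decay of a function that is decreasing at a rate proportional to its value as long
as it is below a threshold. -/
theorem le_mul_exp_of_deriv_le {g g' : ℝ → ℝ} {T η c : ℝ} (hc : 0 ≤ c)
    (hg : ∀ t ∈ Icc 0 T, HasDerivWithinAt g (g' t) (Icc 0 T) t) (hpos : ∀ t ∈ Icc 0 T, 0 ≤ g t)
    (hg' : ∀ t ∈ Icc 0 T, g t < η → g' t ≤ -c * g t) (h0 : g 0 < η) :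
    ∀ t ∈ Icc 0 T, g t < η ∧ g t ≤ g 0 * Real.exp (-c * t) := by
  have hgc : ContinuousOn g (Icc 0 T) := fun t ht => (hg t ht).continuousWithinAt
  have hdecay : ∀ τ ∈ Icc 0 T, (∀ t ∈ Ico 0 τ, g t < η) → g τ ≤ g 0 * Real.exp (-c * τ) := by
    intro τ hτ hlt
    have hsub : Icc 0 τ ⊆ Icc 0 T := Icc_subset_Icc_right hτ.2
    have hanti : AntitoneOn (fun t => g t * Real.exp (c * t)) (Icc 0 τ) := by
      refine antitoneOn_of_hasDerivWithinAt_nonpos (convex_Icc 0 τ) 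
        (f' := fun t => g' t * Real.exp (c * t) + g t * (Real.exp (c * t) * c))
        ((hgc.mono hsub).mul (by fun_prop)) (fun t ht => ?_) fun t ht => ?_
      · have h1 := (hg t (hsub (interior_subset ht))).mono (interior_subset.trans hsub)
        have h2 : HasDerivWithinAt (fun t => Real.exp (c * t)) (Real.exp (c * t) * c)
            (interior (Icc 0 τ)) t := by
          simpa using ((hasDerivAt_id t).const_mul c).exp.hasDerivWithinAt
        exact h1.mul h2
      · rw [interior_Icc] at ht
        have h1 := hg' t (hsub (Ioo_subset_Icc_self ht)) (hlt t (Ioo_subset_Ico_self ht))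
        have h2 : 0 ≤ Real.exp (c * t) * (-c * g t - g' t) :=
          mul_nonneg (Real.exp_pos _).le (by linarith)
        linarith
    have h1 := hanti (left_mem_Icc.2 hτ.1) (right_mem_Icc.2 hτ.1) hτ.1
    simp only [mul_zero, Real.exp_zero, mul_one] at h1
    have h2 : g τ = g τ * Real.exp (c * τ) * Real.exp (-c * τ) := by
      rw [mul_assoc, ← Real.exp_add]; simp
    rw [h2]
    exact mul_le_mul_of_nonneg_right h1 (Real.exp_pos _).le
  have hbelow : ∀ t ∈ Icc 0 T, g t < η := by
    intro t ht
    by_contra hcon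
    obtain ⟨τ, hτ, hτη, hlt⟩ := exists_first_exit hgc isOpen_Iio h0 ht hcon
    have h1 := hdecay τ ⟨hτ.1.le, hτ.2⟩ hlt
    have h2 : Real.exp (-c * τ) ≤ 1 := Real.exp_le_one_iff.2 (by nlinarith [hτ.1])
    have h3 := hpos 0 ⟨le_rfl, hτ.1.le.trans hτ.2⟩
    exact hτη (lt_of_le_of_lt (h1.trans (mul_le_of_le_one_right h3 h2)) h0)
  exact fun t ht => ⟨hbelow t ht, hdecay t ht fun s hs =>
    hbelow s ⟨hs.1, hs.2.le.trans ht.2⟩⟩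

variable {f : ℝ × ℝ → ℝ × ℝ} {V : ℝ × ℝ → ℝ} {e : ℝ × ℝ} {c c₁ c₂ r : ℝ}

theorem hasDerivWithinAt_along {γ : ℝ → ℝ × ℝ} {T : ℝ} (hV : Differentiable ℝ V)
    (hγ : IsIntegralCurveOn γ (fun _ => f) (Icc 0 T)) :
    ∀ t ∈ Icc 0 T, HasDerivWithinAt (fun t => V (γ t)) (fderiv ℝ V (γ t) (f (γ t))) (Icc 0 T) t :=
  fun t ht => (hV (γ t)).hasFDerivAt.comp_hasDerivWithinAt t (hγ t ht)

/-- Along solutions that start in a small sublevel set, a strict quadratic Lyapunov function decays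
exponentially. -/
theorem lyapunov_decay (hV : Differentiable ℝ V) (hc₁ : 0 < c₁) (hc₂ : 0 < c₂)
    (hlow : ∀ p, c₁ * ‖p - e‖ ^ 2 ≤ V p) (hup : ∀ p, V p ≤ c₂ * ‖p - e‖ ^ 2) (hc : 0 < c)
    (hr : 0 < r) (hdec : ∀ p, ‖p - e‖ < r → fderiv ℝ V p (f p) ≤ -c * ‖p - e‖ ^ 2)
    {γ : ℝ → ℝ × ℝ} {T : ℝ} (hγ : IsIntegralCurveOn γ (fun _ => f) (Icc 0 T))
    (h0 : V (γ 0) < c₁ * r ^ 2) :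
    ∀ t ∈ Icc 0 T, V (γ t) ≤ V (γ 0) * Real.exp (-(c / c₂) * t) := by
  intro t ht
  refine (le_mul_exp_of_deriv_le (g := fun t => V (γ t)) (div_pos hc hc₂).le
    (hasDerivWithinAt_along hV hγ)
    (fun s _ => (by positivity : (0 : ℝ) ≤ c₁ * ‖γ s - e‖ ^ 2).trans (hlow _)) ?_ h0 t ht).2
  intro s _ hlt
  have h1 : ‖γ s - e‖ < r := by
    have h2 := lt_of_mul_lt_mul_left ((hlow (γ s)).trans_lt hlt) hc₁.le
    exact lt_of_pow_lt_pow_left₀ 2 hr.le h2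
  refine (hdec _ h1).trans ?_
  have h3 : c / c₂ * V (γ s) ≤ c / c₂ * (c₂ * ‖γ s - e‖ ^ 2) :=
    mul_le_mul_of_nonneg_left (hup _) (div_pos hc hc₂).le
  have h4 : c / c₂ * (c₂ * ‖γ s - e‖ ^ 2) = c * ‖γ s - e‖ ^ 2 := by field_simp
  linarith

/-- Sublevel sets of `V` below `c₁ r²` lie in the ball where `V` decreases, so they trap solutions.
Being bounded, these exist for all positive times, and the exponential decay of `V` becomes
convergence to `e`. -/
theorem asymptoticallyStable_of_lyapunov (hf : ContDiff ℝ 1 f) (hV : Differentiable ℝ V)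
    (hc₁ : 0 < c₁) (hc₂ : 0 < c₂)
    (hlow : ∀ p, c₁ * ‖p - e‖ ^ 2 ≤ V p) (hup : ∀ p, V p ≤ c₂ * ‖p - e‖ ^ 2) (hc : 0 < c)
    (hr : 0 < r) (hdec : ∀ p, ‖p - e‖ < r → fderiv ℝ V p (f p) ≤ -c * ‖p - e‖ ^ 2) :
    AsymptoticallyStable f {e} := by
  have hVe : V e = 0 := le_antisymm (by simpa using hup e) (by simpa using hlow e)
  have hopen : ∀ η, IsOpen {p | V p < η} := fun η => isOpen_lt hV.continuous continuous_const
  have hle : ∀ {γ : ℝ → ℝ × ℝ} {T : ℝ}, IsIntegralCurveOn γ (fun _ => f) (Icc 0 T) →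
      V (γ 0) < c₁ * r ^ 2 → ∀ t ∈ Icc 0 T, V (γ t) ≤ V (γ 0) := by
    intro γ T hγ h0 t ht
    refine (lyapunov_decay hV hc₁ hc₂ hlow hup hc hr hdec hγ h0 t ht).trans ?_
    refine mul_le_of_le_one_right ((by positivity : (0 : ℝ) ≤ c₁ * ‖γ 0 - e‖ ^ 2).trans (hlow _)) ?_
    refine Real.exp_le_one_iff.2 ?_
    have := mul_nonneg (div_pos hc hc₂).le ht.1
    linarith
  have hsub : ∀ p s, 0 < s → V p < c₁ * s ^ 2 → ‖p - e‖ < s := by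
    intro p s hs hp
    exact lt_of_pow_lt_pow_left₀ 2 hs.le (lt_of_mul_lt_mul_left ((hlow p).trans_lt hp) hc₁.le)
  refine ⟨fun U hU heU => ?_, {p | V p < c₁ * r ^ 2}, hopen _, ?_, fun p hp => ?_⟩
  · obtain ⟨s, hs, hsU⟩ := Metric.isOpen_iff.1 hU e (heU rfl)
    have hm : 0 < min r s := lt_min hr hs
    refine ⟨{p | V p < c₁ * (min r s) ^ 2}, hopen _, ?_, fun γ T _ hγ h0 t ht => hsU ?_⟩
    · rintro _ rfl
      simp only [mem_ofPred_eq, hVe]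
      positivity
    · have h0' : V (γ 0) < c₁ * (min r s) ^ 2 := h0
      have h1 : V (γ 0) < c₁ * r ^ 2 := h0'.trans_le (by gcongr; exact min_le_left _ _)
      rw [mem_ball_iff_norm]
      exact (hsub _ _ hm ((hle hγ h1 t ht).trans_lt h0')).trans_le (min_le_right _ _)
  · rintro _ rfl
    simp only [mem_ofPred_eq, hVe]
    positivity
  · have hp' : V p < c₁ * r ^ 2 := hp
    have hnorm : ∀ q, ‖q - e‖ < r → ‖q‖ ≤ ‖e‖ + r := fun q hq => by
      have := norm_add_le (q - e) e
      rw [sub_add_cancel] at this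
      linarith
    obtain ⟨γ, hγ, h0⟩ := exists_solution_Ici hf (p := p) (R := ‖e‖ + r)
      (hnorm p (hsub p r hr hp'))
      (fun γ T _ hγ h0 t ht => hnorm _ (hsub _ r hr
        ((hle hγ (h0 ▸ hp') t ht).trans_lt (h0 ▸ hp'))))
    refine ⟨γ, hγ, h0, ?_⟩
    have hdecay : ∀ t, 0 ≤ t → ‖γ t - e‖ ^ 2 ≤ V p / c₁ * Real.exp (-(c / c₂) * t) := by
      intro t ht
      have h1 := lyapunov_decay hV hc₁ hc₂ hlow hup hc hr hdec
        (hγ.mono (Icc_subset_Ici_self)) (h0 ▸ hp') t (right_mem_Icc.2 ht)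
      rw [h0] at h1
      have h2 := (hlow (γ t)).trans h1
      rw [div_mul_eq_mul_div, le_div_iff₀ hc₁]
      linarith
    have hexp : Tendsto (fun t : ℝ => V p / c₁ * Real.exp (-(c / c₂) * t)) atTop (𝓝 0) := by
      have h1 : Tendsto (fun t : ℝ => -(c / c₂) * t) atTop atBot :=
        tendsto_id.const_mul_atTop_of_neg (by have := div_pos hc hc₂; linarith)
      simpa using (Real.tendsto_exp_atBot.comp h1).const_mul (V p / c₁)
    have hsq : Tendsto (fun t => ‖γ t - e‖ ^ 2) atTop (𝓝 0) := by
      refine squeeze_zero' (Eventually.of_forall fun _ => by positivity) ?_ hexp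
      filter_upwards [eventually_ge_atTop 0] with t ht using hdecay t ht
    have hsqrt := hsq.sqrt
    simp only [Real.sqrt_zero, Real.sqrt_sq (norm_nonneg _)] at hsqrt
    simpa [Metric.infDist_singleton, dist_eq_norm] using hsqrt

/-- If `e` were stable, a solution starting near `e` but off it would stay in the ball forever.
There `V` grows at least linearly in time, against its bound `c₂ r²`. -/
theorem not_lyapunovStable_of_repelling (hf : ContDiff ℝ 1 f) (hV : Differentiable ℝ V)
    (hc₁ : 0 < c₁) (hc₂ : 0 < c₂)
    (hlow : ∀ p, c₁ * ‖p - e‖ ^ 2 ≤ V p) (hup : ∀ p, V p ≤ c₂ * ‖p - e‖ ^ 2) (hc : 0 < c)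
    (hr : 0 < r) (hinc : ∀ p, ‖p - e‖ < r → c * ‖p - e‖ ^ 2 ≤ fderiv ℝ V p (f p)) :
    ¬ LyapunovStable f {e} := by
  intro hst
  obtain ⟨W, hW, heW, hstay⟩ := hst (Metric.ball e r) Metric.isOpen_ball
    (by simpa using hr)
  obtain ⟨s, hs, hsW⟩ := Metric.isOpen_iff.1 hW e (heW rfl)
  set p : ℝ × ℝ := e + (min r s / 2, 0) with hp
  have hm : 0 < min r s := lt_min hr hs
  have hpe : ‖p - e‖ = min r s / 2 := by
    rw [hp, add_sub_cancel_left, Prod.norm_def]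
    simp only [abs_of_pos hm, norm_zero, Real.norm_eq_abs, abs_div, abs_two]
    exact max_eq_left (by positivity)
  have hpW : p ∈ W := hsW (by rw [mem_ball_iff_norm, hpe]; linarith [min_le_right r s])
  have hnorm : ∀ q, ‖q - e‖ < r → ‖q‖ ≤ ‖e‖ + r := fun q hq => by
    have := norm_add_le (q - e) e
    rw [sub_add_cancel] at this
    linarith
  have hball : ∀ (γ : ℝ → ℝ × ℝ) (T : ℝ), 0 ≤ T → IsIntegralCurveOn γ (fun _ => f) (Icc 0 T) →
      γ 0 = p → ∀ t ∈ Icc 0 T, ‖γ t - e‖ < r := fun γ T hT hγ h0 t ht =>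
    mem_ball_iff_norm.1 (hstay γ T hT hγ (h0 ▸ hpW) t ht)
  obtain ⟨γ, hγ, h0⟩ := exists_solution_Ici hf (p := p) (R := ‖e‖ + r)
    (hnorm p (by rw [hpe]; linarith [min_le_left r s]))
    (fun γ T hT hγ h0 t ht => hnorm _ (hball γ T hT hγ h0 t ht))
  have hγT : ∀ T, IsIntegralCurveOn γ (fun _ => f) (Icc 0 T) := fun T =>
    hγ.mono Icc_subset_Ici_self
  have hVp : 0 < V p := lt_of_lt_of_le (by rw [hpe]; positivity) (hlow p)
  have hmono : ∀ T, MonotoneOn (fun t => V (γ t)) (Icc 0 T) := by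
    intro T
    refine monotoneOn_of_hasDerivWithinAt_nonneg (convex_Icc 0 T)
      (f' := fun t => fderiv ℝ V (γ t) (f (γ t)))
      (hV.continuous.comp_continuousOn (hγT T).continuousOn)
      (fun t ht => (hasDerivWithinAt_along hV (hγT T) t (interior_subset ht)).mono interior_subset)
      fun t ht => ?_
    have ht' := interior_subset ht
    exact le_trans (by positivity)
      (hinc _ (hball γ T (ht'.1.trans ht'.2) (hγT T) h0 t ht'))
  have hrate : ∀ t, 0 ≤ t → c / c₂ * V p ≤ fderiv ℝ V (γ t) (f (γ t)) := by
    intro t ht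
    refine le_trans ?_ (hinc _ (hball γ t ht (hγT t) h0 t (right_mem_Icc.2 ht)))
    have h1 := hmono t (left_mem_Icc.2 ht) (right_mem_Icc.2 ht) ht
    simp only [h0] at h1
    have h2 := h1.trans (hup _)
    rw [div_mul_eq_mul_div, div_le_iff₀ hc₂]
    nlinarith
  have hlin : ∀ T, 0 ≤ T → V p + c / c₂ * V p * T ≤ V (γ T) := by
    intro T hT
    have h1 : MonotoneOn (fun t => V (γ t) - c / c₂ * V p * t) (Icc 0 T) := by
      refine monotoneOn_of_hasDerivWithinAt_nonneg (convex_Icc 0 T)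
        (f' := fun t => fderiv ℝ V (γ t) (f (γ t)) - c / c₂ * V p)
        ((hV.continuous.comp_continuousOn (hγT T).continuousOn).sub (by fun_prop))
        (fun t ht => ?_) fun t ht => ?_
      · have h2 := (hasDerivWithinAt_along hV (hγT T) t (interior_subset ht)).mono
          (interior_subset (s := Icc 0 T))
        have h3 : HasDerivWithinAt (fun t => c / c₂ * V p * t) (c / c₂ * V p)
            (interior (Icc 0 T)) t := by
          simpa using ((hasDerivAt_id t).const_mul (c / c₂ * V p)).hasDerivWithinAt
        exact h2.sub h3
      · have := hrate t (interior_subset ht).1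
        linarith
    have h2 := h1 (left_mem_Icc.2 hT) (right_mem_Icc.2 hT) hT
    simp only [h0, mul_zero, sub_zero] at h2
    linarith
  have hb : ∀ T, 0 ≤ T → V (γ T) ≤ c₂ * r ^ 2 := fun T hT =>
    (hup _).trans (by gcongr; exact (hball γ T hT (hγT T) h0 T (right_mem_Icc.2 hT)).le)
  have hcV : 0 < c / c₂ * V p := by positivity
  -- At this time the linear growth alone has used up the whole bound `c₂ r²`.
  have h1 := hlin (c₂ * r ^ 2 / (c / c₂ * V p)) (by positivity)
  have h2 := hb (c₂ * r ^ 2 / (c / c₂ * V p)) (by positivity)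
  rw [mul_div_cancel₀ _ hcV.ne'] at h1
  linarith

end Lyapunov

/-! ### Stability from trace and determinant -/

section Linearization

variable {f : ℝ × ℝ → ℝ × ℝ} {e : ℝ × ℝ} {a b c d : ℝ}

/-- The quadratic form `δ |p|² + |K p|²`, where `δ` is the determinant and `K` the adjugate of the
matrix `!![a, b; c, d]`, centred at `e`. -/
def quadForm (a b c d : ℝ) (e p : ℝ × ℝ) : ℝ :=
  (a * d - b * c) * ((p.1 - e.1) ^ 2 + (p.2 - e.2) ^ 2)
    + (d * (p.1 - e.1) - b * (p.2 - e.2)) ^ 2 + (-c * (p.1 - e.1) + a * (p.2 - e.2)) ^ 2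

theorem hasFDerivAt_quadForm (p : ℝ × ℝ) :
    HasFDerivAt (quadForm a b c d e)
      ((2 * ((a * d - b * c) * (p.1 - e.1) + (d * (p.1 - e.1) - b * (p.2 - e.2)) * d
        - (-c * (p.1 - e.1) + a * (p.2 - e.2)) * c)) • ContinuousLinearMap.fst ℝ ℝ ℝ +
       (2 * ((a * d - b * c) * (p.2 - e.2) - (d * (p.1 - e.1) - b * (p.2 - e.2)) * b
        + (-c * (p.1 - e.1) + a * (p.2 - e.2)) * a)) • ContinuousLinearMap.snd ℝ ℝ ℝ) p := by
  have h1 : HasFDerivAt (fun p : ℝ × ℝ => p.1 - e.1) (ContinuousLinearMap.fst ℝ ℝ ℝ) p :=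
    hasFDerivAt_fst.sub_const _
  have h2 : HasFDerivAt (fun p : ℝ × ℝ => p.2 - e.2) (ContinuousLinearMap.snd ℝ ℝ ℝ) p :=
    hasFDerivAt_snd.sub_const _
  have h := ((((h1.pow 2).add (h2.pow 2)).const_mul (a * d - b * c)).add
    (((h1.const_mul d).sub (h2.const_mul b)).pow 2)).add
    (((h1.const_mul (-c)).add (h2.const_mul a)).pow 2)
  refine h.congr_fderiv ?_
  ext <;> simp <;> ring

theorem quadForm_bounds (hdet : 0 < a * d - b * c) :
    (∀ p, (a * d - b * c) * ‖p - e‖ ^ 2 ≤ quadForm a b c d e p) ∧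
    ∃ C > 0, ∀ p, quadForm a b c d e p ≤ C * ‖p - e‖ ^ 2 := by
  have hn : ∀ p : ℝ × ℝ, |p.1 - e.1| ≤ ‖p - e‖ ∧ |p.2 - e.2| ≤ ‖p - e‖ ∧
      ‖p - e‖ ^ 2 ≤ (p.1 - e.1) ^ 2 + (p.2 - e.2) ^ 2 := by
    intro p
    have h1 : |p.1 - e.1| ≤ ‖p - e‖ := norm_fst_le (p - e)
    have h2 : |p.2 - e.2| ≤ ‖p - e‖ := norm_snd_le (p - e)
    refine ⟨h1, h2, ?_⟩
    rw [Prod.norm_def]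
    rcases max_choice ‖(p - e).1‖ ‖(p - e).2‖ with h | h <;> rw [h] <;>
      simp only [Prod.fst_sub, Prod.snd_sub, Real.norm_eq_abs, sq_abs] <;>
      nlinarith [sq_nonneg (p.1 - e.1), sq_nonneg (p.2 - e.2)]
  constructor
  · intro p
    unfold quadForm
    nlinarith [mul_le_mul_of_nonneg_left (hn p).2.2 hdet.le,
      sq_nonneg (d * (p.1 - e.1) - b * (p.2 - e.2)), sq_nonneg (-c * (p.1 - e.1) + a * (p.2 - e.2))]
  · refine ⟨2 * (a * d - b * c) + (|d| + |b|) ^ 2 + (|c| + |a|) ^ 2, by positivity, fun p => ?_⟩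
    obtain ⟨h1, h2, -⟩ := hn p
    set n := ‖p - e‖
    have hn0 : 0 ≤ n := norm_nonneg _
    have key : ∀ s t : ℝ, (s * (p.1 - e.1) + t * (p.2 - e.2)) ^ 2 ≤ (|s| + |t|) ^ 2 * n ^ 2 := by
      intro s t
      rw [← mul_pow]
      refine sq_le_sq' ?_ ?_ <;> [refine neg_le_of_neg_le ?_; skip]
      all_goals
        refine le_trans (by first | exact neg_le_abs _ | exact le_abs_self _) ((abs_add_le _ _).trans ?_)
        rw [abs_mul, abs_mul, add_mul]
        gcongr
    have k1 := key d (-b)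
    have k2 := key (-c) a
    rw [abs_neg] at k1 k2
    have k3 : (p.1 - e.1) ^ 2 ≤ n ^ 2 := by rw [← sq_abs]; gcongr
    have k4 : (p.2 - e.2) ^ 2 ≤ n ^ 2 := by rw [← sq_abs]; gcongr
    have k5 : (d * (p.1 - e.1) - b * (p.2 - e.2)) ^ 2 ≤ (|d| + |b|) ^ 2 * n ^ 2 := by
      convert k1 using 2; ring
    have k6 := mul_le_mul_of_nonneg_left k3 hdet.le
    have k7 := mul_le_mul_of_nonneg_left k4 hdet.le
    unfold quadForm
    linarith

/-- The derivative of `quadForm` along a field with linear part `!![a, b; c, d]` is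
`2 * trace * det * |p|²`, up to a small error. -/
theorem quadForm_deriv_estimate (hfe : f e = 0)
    (hJ : HasFDerivAt f ((a • ContinuousLinearMap.fst ℝ ℝ ℝ + b • ContinuousLinearMap.snd ℝ ℝ ℝ).prod
      (c • ContinuousLinearMap.fst ℝ ℝ ℝ + d • ContinuousLinearMap.snd ℝ ℝ ℝ)) e)
    {κ : ℝ} (hκ : 0 < κ) :
    ∃ r > 0, ∀ p, ‖p - e‖ < r →
      |fderiv ℝ (quadForm a b c d e) p (f p)
        - 2 * (a + d) * (a * d - b * c) * ((p.1 - e.1) ^ 2 + (p.2 - e.2) ^ 2)| ≤ κ * ‖p - e‖ ^ 2 := by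
  -- Up to the final `+ 1`, which keeps it positive, `C` bounds the sum of the absolute values of
  -- the partial derivatives of the form, per unit of `‖p - e‖`.
  set C : ℝ := 2 * ((|a * d - b * c| + (|d| + |b|) * |d| + (|c| + |a|) * |c|) +
    (|a * d - b * c| + (|d| + |b|) * |b| + (|c| + |a|) * |a|)) + 1 with hC
  have hC0 : 0 < C := by positivity
  have ho := hJ.isLittleO.def (div_pos hκ hC0)
  obtain ⟨r, hr, hball⟩ := Metric.eventually_nhds_iff.1 ho
  refine ⟨r, hr, fun p hp => ?_⟩
  have h := hball (y := p) (by rwa [dist_eq_norm])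
  rw [hfe, sub_zero] at h
  rw [(hasFDerivAt_quadForm p).fderiv]
  set x := p.1 - e.1 with hx
  set y := p.2 - e.2 with hy
  set n := ‖p - e‖ with hn
  have hxn : |x| ≤ n := norm_fst_le (p - e)
  have hyn : |y| ≤ n := norm_snd_le (p - e)
  have h1 : |(f p).1 - (a * x + b * y)| ≤ κ / C * n := by
    refine le_trans ?_ h
    simpa using norm_fst_le (f p - ((a • ContinuousLinearMap.fst ℝ ℝ ℝ
      + b • ContinuousLinearMap.snd ℝ ℝ ℝ).prod
      (c • ContinuousLinearMap.fst ℝ ℝ ℝ + d • ContinuousLinearMap.snd ℝ ℝ ℝ)) (p - e))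
  have h2 : |(f p).2 - (c * x + d * y)| ≤ κ / C * n := by
    refine le_trans ?_ h
    simpa using norm_snd_le (f p - ((a • ContinuousLinearMap.fst ℝ ℝ ℝ
      + b • ContinuousLinearMap.snd ℝ ℝ ℝ).prod
      (c • ContinuousLinearMap.fst ℝ ℝ ℝ + d • ContinuousLinearMap.snd ℝ ℝ ℝ)) (p - e))
  set u := (f p).1 - (a * x + b * y) with hu
  set v := (f p).2 - (c * x + d * y) with hv
  have hf1 : (f p).1 = a * x + b * y + u := by rw [hu]; ring
  have hf2 : (f p).2 = c * x + d * y + v := by rw [hv]; ring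
  have hn0 : 0 ≤ n := norm_nonneg _
  have e1 : |d * x - b * y| ≤ (|d| + |b|) * n := by
    refine (abs_sub _ _).trans ?_
    rw [abs_mul, abs_mul, add_mul]; gcongr
  have e2 : |-c * x + a * y| ≤ (|c| + |a|) * n := by
    refine (abs_add_le _ _).trans ?_
    rw [abs_mul, abs_mul, add_mul, abs_neg]; gcongr
  have e3 : |(a * d - b * c) * x + (d * x - b * y) * d - (-c * x + a * y) * c| ≤
      (|a * d - b * c| + (|d| + |b|) * |d| + (|c| + |a|) * |c|) * n := by
    refine (abs_sub _ _).trans ((add_le_add_left (abs_add_le _ _) _).trans ?_)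
    rw [abs_mul, abs_mul (d * x - b * y), abs_mul (-c * x + a * y)]
    have := mul_le_mul_of_nonneg_right e1 (abs_nonneg d)
    have := mul_le_mul_of_nonneg_right e2 (abs_nonneg c)
    have := mul_le_mul_of_nonneg_left hxn (abs_nonneg (a * d - b * c))
    linarith
  have e4 : |(a * d - b * c) * y - (d * x - b * y) * b + (-c * x + a * y) * a| ≤
      (|a * d - b * c| + (|d| + |b|) * |b| + (|c| + |a|) * |a|) * n := by
    refine (abs_add_le _ _).trans ((add_le_add_left (abs_sub _ _) _).trans ?_)
    rw [abs_mul, abs_mul (d * x - b * y), abs_mul (-c * x + a * y)]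
    have := mul_le_mul_of_nonneg_right e1 (abs_nonneg b)
    have := mul_le_mul_of_nonneg_right e2 (abs_nonneg a)
    have := mul_le_mul_of_nonneg_left hyn (abs_nonneg (a * d - b * c))
    linarith
  -- For `A = !![a, b; c, d]` with adjugate `K` one has `K A = det · I` and `A + K = tr · I`. So the
  -- linear part contributes exactly `2 tr det |p|²`, and only the terms in the errors `u`, `v`
  -- survive.
  have hkey : (((2 * ((a * d - b * c) * x + (d * x - b * y) * d
        - (-c * x + a * y) * c)) • ContinuousLinearMap.fst ℝ ℝ ℝ +
       (2 * ((a * d - b * c) * y - (d * x - b * y) * b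
        + (-c * x + a * y) * a)) • ContinuousLinearMap.snd ℝ ℝ ℝ) (f p))
        - 2 * (a + d) * (a * d - b * c) * (x ^ 2 + y ^ 2)
      = 2 * ((a * d - b * c) * x + (d * x - b * y) * d - (-c * x + a * y) * c) * u
        + 2 * ((a * d - b * c) * y - (d * x - b * y) * b + (-c * x + a * y) * a) * v := by
    simp only [add_apply, smul_apply,
      ContinuousLinearMap.coe_fst', ContinuousLinearMap.coe_snd', smul_eq_mul, hf1, hf2]
    ring
  rw [hkey]
  refine (abs_add_le _ _).trans ?_
  rw [abs_mul, abs_mul, abs_mul, abs_mul, abs_two]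
  have m1 := mul_le_mul e3 h1 (abs_nonneg _) (by positivity)
  have m2 := mul_le_mul e4 h2 (abs_nonneg _) (by positivity)
  have m3 : κ * n ^ 2 = C * (κ / C) * n ^ 2 := by field_simp
  have m4 : 0 ≤ κ / C * n ^ 2 := by positivity
  have m5 : (C - 1) * (κ / C * n ^ 2) = 2 * ((|a * d - b * c| + (|d| + |b|) * |d|
      + (|c| + |a|) * |c|) * n * (κ / C * n)) + 2 * ((|a * d - b * c| + (|d| + |b|) * |b|
      + (|c| + |a|) * |a|) * n * (κ / C * n)) := by
    rw [show C - 1 = 2 * ((|a * d - b * c| + (|d| + |b|) * |d| + (|c| + |a|) * |c|) +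
      (|a * d - b * c| + (|d| + |b|) * |b| + (|c| + |a|) * |a|)) by rw [hC]; ring]
    ring
  rw [m3]
  linarith

/-- With `κ = |tr · det|` the main term `2 tr det |p|²` is twice the admissible error, so `quadForm`
is a strict Lyapunov function. No distinction between real and complex eigenvalues is needed. -/
theorem asymptoticallyStable_of_linearization (hf : ContDiff ℝ 1 f) (hfe : f e = 0)
    (hJ : HasFDerivAt f ((a • ContinuousLinearMap.fst ℝ ℝ ℝ + b • ContinuousLinearMap.snd ℝ ℝ ℝ).prod
      (c • ContinuousLinearMap.fst ℝ ℝ ℝ + d • ContinuousLinearMap.snd ℝ ℝ ℝ)) e)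
    (htr : a + d < 0) (hdet : 0 < a * d - b * c) : AsymptoticallyStable f {e} := by
  obtain ⟨hlow, C, hC, hup⟩ := quadForm_bounds (e := e) hdet
  have hκ : 0 < -((a + d) * (a * d - b * c)) := by nlinarith
  obtain ⟨r, hr, hest⟩ := quadForm_deriv_estimate hfe hJ hκ
  refine asymptoticallyStable_of_lyapunov hf
    (fun p => (hasFDerivAt_quadForm p).differentiableAt) hdet hC hlow hup hκ hr fun p hp => ?_
  have h1 := (abs_le.1 (hest p hp)).2
  have h2 : ‖p - e‖ ^ 2 ≤ (p.1 - e.1) ^ 2 + (p.2 - e.2) ^ 2 := by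
    rw [Prod.norm_def]
    rcases max_choice ‖(p - e).1‖ ‖(p - e).2‖ with h | h <;> rw [h] <;>
      simp only [Prod.fst_sub, Prod.snd_sub, Real.norm_eq_abs, sq_abs] <;>
      nlinarith [sq_nonneg (p.1 - e.1), sq_nonneg (p.2 - e.2)]
  nlinarith [mul_le_mul_of_nonneg_left h2 hκ.le]

/-- For positive trace the same form increases along solutions, again at least at half the rate of
the main term. -/
theorem not_lyapunovStable_of_linearization (hf : ContDiff ℝ 1 f) (hfe : f e = 0)
    (hJ : HasFDerivAt f ((a • ContinuousLinearMap.fst ℝ ℝ ℝ + b • ContinuousLinearMap.snd ℝ ℝ ℝ).prod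
      (c • ContinuousLinearMap.fst ℝ ℝ ℝ + d • ContinuousLinearMap.snd ℝ ℝ ℝ)) e)
    (htr : 0 < a + d) (hdet : 0 < a * d - b * c) : ¬ LyapunovStable f {e} := by
  obtain ⟨hlow, C, hC, hup⟩ := quadForm_bounds (e := e) hdet
  have hκ : 0 < (a + d) * (a * d - b * c) := mul_pos htr hdet
  obtain ⟨r, hr, hest⟩ := quadForm_deriv_estimate hfe hJ hκ
  refine not_lyapunovStable_of_repelling hf
    (fun p => (hasFDerivAt_quadForm p).differentiableAt) hdet hC hlow hup hκ hr fun p hp => ?_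
  have h1 := (abs_le.1 (hest p hp)).1
  have h2 : ‖p - e‖ ^ 2 ≤ (p.1 - e.1) ^ 2 + (p.2 - e.2) ^ 2 := by
    rw [Prod.norm_def]
    rcases max_choice ‖(p - e).1‖ ‖(p - e).2‖ with h | h <;> rw [h] <;>
      simp only [Prod.fst_sub, Prod.snd_sub, Real.norm_eq_abs, sq_abs] <;>
      nlinarith [sq_nonneg (p.1 - e.1), sq_nonneg (p.2 - e.2)]
  nlinarith [mul_le_mul_of_nonneg_left h2 hκ.le]

end Linearization

/-! ### Polar coordinates and lifting of solutions -/

section Polar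

/-- The point with polar coordinates `r, θ`. -/
noncomputable def pol (r θ : ℝ) : ℝ × ℝ := (r * Real.cos θ, r * Real.sin θ)

/-- The radial component of a planar field, in polar coordinates. -/
noncomputable def radialPart (f : ℝ × ℝ → ℝ × ℝ) (r θ : ℝ) : ℝ :=
  Real.cos θ * (f (pol r θ)).1 + Real.sin θ * (f (pol r θ)).2

/-- The angular velocity of a planar field, in polar coordinates. -/
noncomputable def angularPart (f : ℝ × ℝ → ℝ × ℝ) (r θ : ℝ) : ℝ :=
  (Real.cos θ * (f (pol r θ)).2 - Real.sin θ * (f (pol r θ)).1) / r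

theorem pol_add_two_pi (r θ : ℝ) : pol r (θ + 2 * Real.pi) = pol r θ := by
  simp [pol]

theorem norm_pol_le {r θ : ℝ} (hr : 0 ≤ r) : ‖pol r θ‖ ≤ r := by
  rw [pol, Prod.norm_def]
  simp only [norm_mul, Real.norm_eq_abs, abs_of_nonneg hr]
  exact max_le (mul_le_of_le_one_right hr (Real.abs_cos_le_one θ))
    (mul_le_of_le_one_right hr (Real.abs_sin_le_one θ))

theorem dist_pol_le (r s θ : ℝ) : dist (pol r θ) (pol s θ) ≤ |r - s| := by
  have : pol r θ - pol s θ = (r - s) • ((Real.cos θ, Real.sin θ) : ℝ × ℝ) := by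
    ext <;> simp [pol] <;> ring
  rw [dist_eq_norm, this, norm_smul, Real.norm_eq_abs]
  refine mul_le_of_le_one_right (abs_nonneg _) ?_
  rw [Prod.norm_def]
  exact max_le (Real.abs_cos_le_one θ) (Real.abs_sin_le_one θ)

theorem sq_add_sq_pol (r θ : ℝ) : (pol r θ).1 ^ 2 + (pol r θ).2 ^ 2 = r ^ 2 := by
  simp only [pol]
  linear_combination r ^ 2 * Real.sin_sq_add_cos_sq θ

theorem contDiff_pol {n : WithTop ℕ∞} : ContDiff ℝ n (fun q : ℝ × ℝ => pol q.2 q.1) := by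
  unfold pol
  exact (contDiff_snd.mul (Real.contDiff_cos.comp contDiff_fst)).prodMk
    (contDiff_snd.mul (Real.contDiff_sin.comp contDiff_fst))

/-- Polar coordinates are open away from the origin. -/
theorem pol_image_mem_nhds {r θ : ℝ} (hr : 0 < r) {s : Set (ℝ × ℝ)} (hs : s ∈ 𝓝 (r, θ)) :
    (fun q : ℝ × ℝ => pol q.1 q.2) '' s ∈ 𝓝 (pol r θ) := by
  have hc : ContDiff ℝ 1 (fun q : ℝ × ℝ => pol q.1 q.2) :=
    contDiff_pol.comp (contDiff_snd.prodMk contDiff_fst)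
  have h1 : HasStrictFDerivAt (fun q : ℝ × ℝ => pol q.1 q.2)
      (fderiv ℝ (fun q : ℝ × ℝ => pol q.1 q.2) (r, θ)) (r, θ) :=
    hc.contDiffAt.hasStrictFDerivAt one_ne_zero
  have h2 : HasFDerivAt (fun q : ℝ × ℝ => pol q.1 q.2)
      ((Real.cos θ • ContinuousLinearMap.fst ℝ ℝ ℝ
        - (r * Real.sin θ) • ContinuousLinearMap.snd ℝ ℝ ℝ).prod
       (Real.sin θ • ContinuousLinearMap.fst ℝ ℝ ℝ
        + (r * Real.cos θ) • ContinuousLinearMap.snd ℝ ℝ ℝ)) (r, θ) := by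
    have hf : HasFDerivAt (fun q : ℝ × ℝ => q.1) (ContinuousLinearMap.fst ℝ ℝ ℝ) (r, θ) :=
      hasFDerivAt_fst
    have hsn : HasFDerivAt (fun q : ℝ × ℝ => q.2) (ContinuousLinearMap.snd ℝ ℝ ℝ) (r, θ) :=
      hasFDerivAt_snd
    refine ((hf.mul hsn.cos).prodMk (hf.mul hsn.sin)).congr_fderiv ?_
    ext <;> simp
  rw [h2.fderiv] at h1
  have h3 := h1.map_nhds_eq_of_surj (by
    rw [LinearMap.range_eq_top]
    rintro ⟨x, y⟩
    have hcs := Real.sin_sq_add_cos_sq θ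
    refine ⟨(Real.cos θ * x + Real.sin θ * y, (Real.cos θ * y - Real.sin θ * x) / r), ?_⟩
    ext
    · simp
      field_simp
      linear_combination x * hcs
    · simp
      field_simp
      linear_combination y * hcs)
  rw [← h3]
  exact image_mem_map hs

/-- A solution that avoids the origin lifts to polar coordinates. -/
theorem exists_polar_lift {f : ℝ × ℝ → ℝ × ℝ} (hf : Continuous f) {γ : ℝ → ℝ × ℝ} {T : ℝ}
    (hT : 0 ≤ T) (hγ : IsIntegralCurveOn γ (fun _ => f) (Icc 0 T)) (hne : ∀ t ∈ Icc 0 T, γ t ≠ 0)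
    {r₀ θ₀ : ℝ} (hr₀ : 0 < r₀) (h0 : γ 0 = pol r₀ θ₀) :
    ∃ r θ : ℝ → ℝ, r 0 = r₀ ∧ θ 0 = θ₀ ∧ ∀ t ∈ Icc 0 T, 0 < r t ∧ γ t = pol (r t) (θ t) ∧
      HasDerivWithinAt r (radialPart f (r t) (θ t)) (Icc 0 T) t ∧
      HasDerivWithinAt θ (angularPart f (r t) (θ t)) (Icc 0 T) t := by
  let J : ℝ × ℝ →L[ℝ] ℂ := Complex.equivRealProdCLM.symm
  have hJre : ∀ p, (J p).re = p.1 := fun p => rfl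
  have hJim : ∀ p, (J p).im = p.2 := fun p => rfl
  have hz : ∀ t ∈ Icc 0 T, HasDerivWithinAt (fun t => J (γ t)) (J (f (γ t))) (Icc 0 T) t :=
    fun t ht => J.hasFDerivAt.comp_hasDerivWithinAt t (hγ t ht)
  have hz0 : ∀ t ∈ Icc 0 T, J (γ t) ≠ 0 := fun t ht h =>
    hne t ht (Complex.equivRealProdCLM.symm.map_eq_zero_iff.1 h)
  have hcont : ContinuousOn (fun t => J (f (γ t)) / J (γ t)) (Icc 0 T) :=
    (J.continuous.comp_continuousOn (hf.comp_continuousOn hγ.continuousOn)).div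
      (J.continuous.comp_continuousOn hγ.continuousOn) hz0
  let q : ℝ → ℂ := IccExtend hT ((Icc 0 T).domRestrict fun t => J (f (γ t)) / J (γ t))
  have hq : Continuous q := (continuousOn_iff_continuous_domRestrict.1 hcont).Icc_extend'
  have hqt : ∀ t ∈ Icc 0 T, q t = J (f (γ t)) / J (γ t) := fun t ht =>
    IccExtend_of_mem hT _ ht
  -- `W` is a continuous logarithm of the curve, seen in `ℂ`: it integrates `z' / z`. Its real part
  -- is `log r` and its imaginary part is the lifted angle.
  let W : ℝ → ℂ := fun t => (Real.log r₀ + θ₀ * Complex.I) + ∫ s in (0 : ℝ)..t, q s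
  have hW : ∀ t, HasDerivAt W (q t) t := fun t =>
    (intervalIntegral.integral_hasDerivAt_right (hq.intervalIntegrable _ _)
      (hq.stronglyMeasurableAtFilter _ _) hq.continuousAt).const_add _
  have hW0 : W 0 = Real.log r₀ + θ₀ * Complex.I := by simp [W]
  have hre : ∀ t, HasDerivAt (fun t => (W t).re) (q t).re t := fun t =>
    Complex.reCLM.hasFDerivAt.comp_hasDerivAt t (hW t)
  have him : ∀ t, HasDerivAt (fun t => (W t).im) (q t).im t := fun t =>
    Complex.imCLM.hasFDerivAt.comp_hasDerivAt t (hW t)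
  have hderiv : ∀ t ∈ Icc 0 T,
      HasDerivWithinAt (fun t => J (γ t) * Complex.exp (-W t)) 0 (Icc 0 T) t := by
    intro t ht
    have h1 := (hz t ht).mul (hW t).neg.cexp.hasDerivWithinAt
    refine h1.congr_deriv ?_
    rw [hqt t ht]
    have := hz0 t ht
    simp only [Pi.neg_apply]
    field_simp
    ring
  have hconst : ∀ t ∈ Icc 0 T, J (γ t) * Complex.exp (-W t) = J (γ 0) * Complex.exp (-W 0) := by
    refine constant_of_has_deriv_right_zero (fun t ht => (hderiv t ht).continuousWithinAt)
      fun t ht => ?_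
    exact (hderiv t (Ico_subset_Icc_self ht)).mono_of_mem_nhdsWithin (Icc_mem_nhdsGE_of_mem ht)
  have hexp0 : J (γ 0) = Complex.exp (W 0) := by
    rw [hW0, Complex.exp_add_mul_I, ← Complex.ofReal_exp, Real.exp_log hr₀, h0]
    apply Complex.ext <;> simp [hJre, hJim, pol, Complex.cos_ofReal_re, Complex.sin_ofReal_re]
  have hexp : ∀ t ∈ Icc 0 T, J (γ t) = Complex.exp (W t) := by
    intro t ht
    have h1 := hconst t ht
    rw [hexp0, ← Complex.exp_add, add_neg_cancel, Complex.exp_zero, Complex.exp_neg] at h1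
    field_simp at h1
    exact h1
  refine ⟨fun t => Real.exp (W t).re, fun t => (W t).im, ?_, ?_, fun t ht => ?_⟩
  · simp [hW0, Real.exp_log hr₀]
  · simp [hW0]
  · have hpol : γ t = pol (Real.exp (W t).re) (W t).im := by
      have h1 := hexp t ht
      have e1 := congrArg Complex.re h1
      have e2 := congrArg Complex.im h1
      rw [hJre, Complex.exp_re] at e1
      rw [hJim, Complex.exp_im] at e2
      exact Prod.ext e1 e2
    have hquot : q t = ⟨radialPart f (Real.exp (W t).re) (W t).im / Real.exp (W t).re,
        angularPart f (Real.exp (W t).re) (W t).im⟩ := by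
      rw [hqt t ht, div_eq_iff (hz0 t ht)]
      have hE := (Real.exp_pos (W t).re).ne'
      have hcs := Real.sin_sq_add_cos_sq (W t).im
      apply Complex.ext
      · rw [Complex.mul_re, hJre, hJre, hJim]
        simp only [radialPart, angularPart, ← hpol]
        rw [congrArg Prod.fst hpol, congrArg Prod.snd hpol]
        simp only [pol]
        field_simp
        linear_combination (-(f (γ t)).1) * hcs
      · rw [Complex.mul_im, hJre, hJim, hJim]
        simp only [radialPart, angularPart, ← hpol]
        rw [congrArg Prod.fst hpol, congrArg Prod.snd hpol]
        simp only [pol]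
        field_simp
        linear_combination (-(f (γ t)).2) * hcs
    refine ⟨Real.exp_pos _, hpol, ?_, ?_⟩
    · have h1 := (hre t).exp
      rw [hquot] at h1
      refine (h1.congr_deriv ?_).hasDerivWithinAt
      have hE := (Real.exp_pos (W t).re).ne'
      field_simp
    · have h1 := him t
      rw [hquot] at h1
      exact h1.hasDerivWithinAt

end Polar

/-! ### Contracting annuli: trapping, contraction and the closed orbit -/

section Annulus

/-- The slope `dr/dθ` of the orbits of a planar field, in polar coordinates. -/
noncomputable def polarSlope (f : ℝ × ℝ → ℝ × ℝ) (r θ : ℝ) : ℝ :=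
  radialPart f r θ / angularPart f r θ

/-- An annulus in which the orbits of `f` turn around the origin and approach each other, as
measured by a function `w` of the polar coordinates `(θ, r)`, with `H = dw/dθ` along orbits. -/
structure IsContractingAnnulus (f : ℝ × ℝ → ℝ × ℝ) (w H : ℝ × ℝ → ℝ)
    (r₁ r₂ M₁ m₁ m₂ M₂ κ c : ℝ) : Prop where
  r₁_pos : 0 < r₁
  r₁_lt : r₁ < r₂
  M₁_lt : M₁ < m₁
  m₁_lt : m₁ < m₂
  m₂_lt : m₂ < M₂
  κ_pos : 0 < κ
  c_pos : 0 < c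
  angular_pos : ∀ θ, ∀ r ∈ Icc r₁ r₂, 0 < angularPart f r θ
  periodic : ∀ θ r, w (θ + 2 * Real.pi, r) = w (θ, r)
  differentiableAt : ∀ θ r, 0 < r → DifferentiableAt ℝ w (θ, r)
  along : ∀ θ, ∀ r ∈ Icc r₁ r₂, fderiv ℝ w (θ, r) (1, polarSlope f r θ) = H (θ, r)
  mono : ∀ θ, ∀ a ∈ Icc r₁ r₂, ∀ b ∈ Icc r₁ r₂, a ≤ b → c * (b - a) ≤ w (θ, a) - w (θ, b)
  contr : ∀ θ, ∀ a ∈ Icc r₁ r₂, ∀ b ∈ Icc r₁ r₂, a ≤ b →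
    H (θ, a) - H (θ, b) ≤ -κ * (w (θ, a) - w (θ, b))
  top : ∀ θ, ∀ r ∈ Icc r₁ r₂, m₂ ≤ w (θ, r) → H (θ, r) < 0
  bot : ∀ θ, ∀ r ∈ Icc r₁ r₂, w (θ, r) ≤ m₁ → 0 < H (θ, r)
  inner : ∀ θ, M₂ < w (θ, r₁)
  outer : ∀ θ, w (θ, r₂) < M₁

/-- A curve `(θ, r)`, with angular velocity `τ`, that follows the orbits of `f` while
`r ∈ [r₁, r₂]`. -/
def IsAngularCurve (f : ℝ × ℝ → ℝ × ℝ) (r₁ r₂ : ℝ) (θ r τ : ℝ → ℝ) (T : ℝ) : Prop :=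
  ∀ t ∈ Icc 0 T, HasDerivWithinAt θ (τ t) (Icc 0 T) t ∧ ContinuousWithinAt r (Icc 0 T) t ∧
    (r t ∈ Icc r₁ r₂ → 0 < τ t ∧ HasDerivWithinAt r (τ t * polarSlope f (r t) (θ t)) (Icc 0 T) t)

/-- Used at first exit times: closed constraints valid before the exit still hold at the exit. -/
theorem mem_of_forall_mem_Ico {X : Type*} [TopologicalSpace X] {φ : ℝ → X} {T τ : ℝ} {C : Set X}
    (hφ : ContinuousOn φ (Icc 0 T)) (hC : IsClosed C) (hτ : τ ∈ Ioc 0 T)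
    (h : ∀ t ∈ Ico 0 τ, φ t ∈ C) : φ τ ∈ C := by
  have h1 : ContinuousWithinAt φ (Ico 0 τ) τ :=
    (hφ τ ⟨hτ.1.le, hτ.2⟩).mono fun t ht => ⟨ht.1, ht.2.le.trans hτ.2⟩
  have h2 := h1.mem_closure (by rw [closure_Ico hτ.1.ne]; exact right_mem_Icc.2 hτ.1.le) h
  rwa [hC.closure_eq] at h2

/-- A function that reaches at `τ` its largest value so far cannot have negative slope there. This
rules out leaving through a level set which the flow crosses inwards. -/
theorem deriv_nonneg_of_forall_Ico_le {g : ℝ → ℝ} {d T τ : ℝ}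
    (hg : HasDerivWithinAt g d (Icc 0 T) τ) (hτ : τ ∈ Ioc 0 T) (h : ∀ t ∈ Ico 0 τ, g t ≤ g τ) :
    0 ≤ d := by
  have h1 : HasDerivWithinAt g d (Ico 0 τ) τ :=
    hg.mono fun t ht => ⟨ht.1, ht.2.le.trans hτ.2⟩
  rw [hasDerivWithinAt_iff_tendsto_slope' (by simp)] at h1
  have : (𝓝[Ico 0 τ] τ).NeBot := by
    rw [← mem_closure_iff_nhdsWithin_neBot, closure_Ico hτ.1.ne]
    exact right_mem_Icc.2 hτ.1.le
  refine ge_of_tendsto h1 ?_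
  filter_upwards [self_mem_nhdsWithin] with t ht
  rw [slope_def_field]
  exact div_nonneg_of_nonpos (by linarith [h t ht]) (by linarith [ht.2])

variable {f : ℝ × ℝ → ℝ × ℝ} {w H : ℝ × ℝ → ℝ} {r₁ r₂ M₁ m₁ m₂ M₂ κ c : ℝ}

theorem IsAngularCurve.continuousOn_angle {θ r τ : ℝ → ℝ} {T : ℝ}
    (h : IsAngularCurve f r₁ r₂ θ r τ T) : ContinuousOn θ (Icc 0 T) :=
  fun t ht => (h t ht).1.continuousWithinAt

theorem IsAngularCurve.continuousOn_radius {θ r τ : ℝ → ℝ} {T : ℝ}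
    (h : IsAngularCurve f r₁ r₂ θ r τ T) : ContinuousOn r (Icc 0 T) :=
  fun t ht => (h t ht).2.1

namespace IsContractingAnnulus

/-- `H` is the rate of `w` per unit of angle, so in time it is multiplied by the angular velocity
`τ`. This is the chain rule combined with the field `along`. -/
theorem hasDerivWithinAt_w (hA : IsContractingAnnulus f w H r₁ r₂ M₁ m₁ m₂ M₂ κ c)
    {θ r τ : ℝ → ℝ} {T : ℝ} (hcur : IsAngularCurve f r₁ r₂ θ r τ T) {t : ℝ} (ht : t ∈ Icc 0 T)
    (hr : r t ∈ Icc r₁ r₂) :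
    HasDerivWithinAt (fun t => w (θ t, r t)) (τ t * H (θ t, r t)) (Icc 0 T) t := by
  obtain ⟨h1, -, h2⟩ := hcur t ht
  have h3 := (hA.differentiableAt (θ t) (r t) (hA.r₁_pos.trans_le hr.1)).hasFDerivAt
  have h4 := h3.comp_hasDerivWithinAt t (h1.prodMk (h2 hr).2)
  refine h4.congr_deriv ?_
  rw [← hA.along _ _ hr, ← smul_eq_mul (τ t) (fderiv _ _ _ _), ← map_smul]
  simp

theorem continuousAt_w (hA : IsContractingAnnulus f w H r₁ r₂ M₁ m₁ m₂ M₂ κ c) {q : ℝ × ℝ}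
    (hq : 0 < q.2) : ContinuousAt w q :=
  (hA.differentiableAt q.1 q.2 hq).continuousAt

/-- Curves do not leave the region between suitable level sets of `w`. -/
theorem trap (hA : IsContractingAnnulus f w H r₁ r₂ M₁ m₁ m₂ M₂ κ c) {θ r τ : ℝ → ℝ} {T : ℝ}
    (hcur : IsAngularCurve f r₁ r₂ θ r τ T) {μ₁ μ₂ : ℝ} (hμ₁ : μ₁ ∈ Icc M₁ m₁)
    (hμ₂ : μ₂ ∈ Icc m₂ M₂) (hr0 : r 0 ∈ Ioo r₁ r₂) (hw0 : w (θ 0, r 0) ∈ Ioo μ₁ μ₂) :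
    ∀ t ∈ Icc 0 T, r t ∈ Ioo r₁ r₂ ∧ w (θ t, r t) ∈ Ioo μ₁ μ₂ := by
  set U : Set (ℝ × ℝ) := {q | q.2 ∈ Ioo r₁ r₂ ∧ w q ∈ Ioo μ₁ μ₂} with hU
  have hUo : IsOpen U := by
    rw [isOpen_iff_mem_nhds]
    rintro q ⟨hq, hwq⟩
    have h1 : ∀ᶠ p : ℝ × ℝ in 𝓝 q, p.2 ∈ Ioo r₁ r₂ :=
      continuous_snd.continuousAt.eventually (Ioo_mem_nhds hq.1 hq.2)
    have h2 : ∀ᶠ p in 𝓝 q, w p ∈ Ioo μ₁ μ₂ :=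
      (hA.continuousAt_w (hA.r₁_pos.trans hq.1)).eventually (Ioo_mem_nhds hwq.1 hwq.2)
    filter_upwards [h1, h2] with p hp1 hp2 using ⟨hp1, hp2⟩
  by_contra! hcon
  obtain ⟨t₁, ht₁, hbad⟩ := hcon
  have hcq : ContinuousOn (fun t => (θ t, r t)) (Icc 0 T) :=
    hcur.continuousOn_angle.prodMk hcur.continuousOn_radius
  obtain ⟨s, hs, hsU, hlt⟩ := exists_first_exit (γ := fun t => (θ t, r t)) hcq hUo ⟨hr0, hw0⟩ ht₁
    (fun h => hbad h.1 h.2)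
  have hsT : s ∈ Icc 0 T := ⟨hs.1.le, hs.2⟩
  have hrs : r s ∈ Icc r₁ r₂ := mem_of_forall_mem_Ico hcur.continuousOn_radius isClosed_Icc hs
    fun t ht => Ioo_subset_Icc_self (hlt t ht).1
  have hder := hA.hasDerivWithinAt_w hcur hsT hrs
  have hτ := ((hcur s hsT).2.2 hrs).1
  have hws : w (θ s, r s) ∈ Icc μ₁ μ₂ := by
    refine mem_of_forall_mem_Ico (φ := fun t => w (θ t, r t)) (T := s) (fun t ht => ?_)
      isClosed_Icc ⟨hs.1, le_rfl⟩ fun t ht => Ioo_subset_Icc_self (hlt t ht).2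
    have htT : t ∈ Icc 0 T := ⟨ht.1, ht.2.trans hs.2⟩
    have hrt : 0 < r t := by
      rcases ht.2.lt_or_eq with h | h
      · exact hA.r₁_pos.trans (hlt t ⟨ht.1, h⟩).1.1
      · rw [h]; exact hA.r₁_pos.trans_le hrs.1
    exact (hA.continuousAt_w (q := (θ t, r t)) hrt).comp_continuousWithinAt
      (f := fun t => (θ t, r t)) ((hcq t htT).mono (Icc_subset_Icc_right hs.2))
  -- At the exit time four boundary pieces are possible. The circles `r₁` and `r₂` are excluded
  -- because `w` lies beyond `M₂`, respectively `M₁`, on them; the levels `μ₂` and `μ₁` because of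
  -- the sign of `H` there.
  have hne1 : r s ≠ r₁ := fun h => by
    have := hA.inner (θ s)
    rw [← h] at this
    linarith [hws.2, hμ₂.2]
  have hne2 : r s ≠ r₂ := fun h => by
    have := hA.outer (θ s)
    rw [← h] at this
    linarith [hws.1, hμ₁.1]
  have hne3 : w (θ s, r s) ≠ μ₂ := fun h => by
    have h1 := deriv_nonneg_of_forall_Ico_le hder hs fun t ht => by
      rw [h]; exact (hlt t ht).2.2.le
    have h2 := hA.top (θ s) (r s) hrs (by rw [h]; exact hμ₂.1)
    nlinarith
  have hne4 : w (θ s, r s) ≠ μ₁ := fun h => by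
    have h1 := deriv_nonneg_of_forall_Ico_le hder.neg hs fun t ht => by
      simp only [Pi.neg_apply]
      rw [h]; linarith [(hlt t ht).2.1]
    have h2 := hA.bot (θ s) (r s) hrs (by rw [h]; exact hμ₁.2)
    nlinarith
  exact hsU ⟨⟨lt_of_le_of_ne hrs.1 hne1.symm, lt_of_le_of_ne hrs.2 hne2⟩,
    lt_of_le_of_ne hws.1 hne4.symm, lt_of_le_of_ne hws.2 hne3⟩

/-- Two curves over the same angle approach each other. -/
theorem contraction (hA : IsContractingAnnulus f w H r₁ r₂ M₁ m₁ m₂ M₂ κ c) {θ r ρ τ : ℝ → ℝ}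
    {T τ₀ : ℝ} (hτ₀ : 0 < τ₀) (hr : IsAngularCurve f r₁ r₂ θ r τ T)
    (hρ : IsAngularCurve f r₁ r₂ θ ρ τ T) (hrm : ∀ t ∈ Icc 0 T, r t ∈ Icc r₁ r₂)
    (hρm : ∀ t ∈ Icc 0 T, ρ t ∈ Icc r₁ r₂) (hτ : ∀ t ∈ Icc 0 T, τ₀ ≤ τ t) :
    ∀ t ∈ Icc 0 T, (w (θ t, r t) - w (θ t, ρ t)) ^ 2
      ≤ (w (θ 0, r 0) - w (θ 0, ρ 0)) ^ 2 * Real.exp (-(2 * κ * τ₀) * t) := by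
  intro t ht
  -- The rate holds at all times, so the threshold `η` plays no role: any number above the initial
  -- value will do.
  refine (le_mul_exp_of_deriv_le (η := (w (θ 0, r 0) - w (θ 0, ρ 0)) ^ 2 + 1)
    (c := 2 * κ * τ₀) (g := fun t => (w (θ t, r t) - w (θ t, ρ t)) ^ 2)
    (g' := fun t => 2 * (w (θ t, r t) - w (θ t, ρ t)) *
      (τ t * H (θ t, r t) - τ t * H (θ t, ρ t))) ?_ (fun s hs => ?_) (fun s _ => sq_nonneg _)
    (fun s hs _ => ?_) (lt_add_one _) t ht).2
  · have := hA.κ_pos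
    positivity
  · have := ((hA.hasDerivWithinAt_w hr hs (hrm s hs)).sub
      (hA.hasDerivWithinAt_w hρ hs (hρm s hs))).pow 2
    refine this.congr_deriv ?_
    simp
  · have hκ := hA.κ_pos
    set D := w (θ s, r s) - w (θ s, ρ s) with hD
    set G := H (θ s, r s) - H (θ s, ρ s) with hG
    -- `w` decreases in the radius, so the order of `r` and `ρ` fixes the sign of `D`, and `contr`
    -- applies after exchanging the two curves if necessary.
    have key : D * G ≤ -κ * D ^ 2 := by
      rcases le_total (r s) (ρ s) with h | h
      · have h1 := hA.contr (θ s) _ (hrm s hs) _ (hρm s hs) h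
        have h2 := hA.mono (θ s) _ (hrm s hs) _ (hρm s hs) h
        have h3 : 0 ≤ c * (ρ s - r s) := mul_nonneg hA.c_pos.le (by linarith)
        have h4 : 0 ≤ D := h3.trans h2
        nlinarith [mul_le_mul_of_nonneg_left h1 h4]
      · have h1 := hA.contr (θ s) _ (hρm s hs) _ (hrm s hs) h
        have h2 := hA.mono (θ s) _ (hρm s hs) _ (hrm s hs) h
        have h3 : 0 ≤ c * (r s - ρ s) := mul_nonneg hA.c_pos.le (by linarith)
        have h4 : 0 ≤ -D := by rw [hD]; linarith
        have h5 : -G ≤ -κ * (-D) := by rw [hD, hG]; linarith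
        nlinarith [mul_le_mul_of_nonneg_left h5 h4]
    have h1 : τ s * (D * G) ≤ τ s * (-κ * D ^ 2) :=
      mul_le_mul_of_nonneg_left key (hτ₀.le.trans (hτ s hs))
    have h2 : τ₀ * (κ * D ^ 2) ≤ τ s * (κ * D ^ 2) :=
      mul_le_mul_of_nonneg_right (hτ s hs) (by positivity)
    have h3 : 2 * D * (τ s * H (θ s, r s) - τ s * H (θ s, ρ s)) = 2 * (τ s * (D * G)) := by
      rw [hG]; ring
    rw [h3]
    linarith

/-- `mono` read as an inverse Lipschitz bound: contraction in `w` is contraction in the radius, up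
to the factor `c`. -/
theorem radius_dist_le (hA : IsContractingAnnulus f w H r₁ r₂ M₁ m₁ m₂ M₂ κ c) (θ : ℝ) {a b : ℝ}
    (ha : a ∈ Icc r₁ r₂) (hb : b ∈ Icc r₁ r₂) : c * |a - b| ≤ |w (θ, a) - w (θ, b)| := by
  rcases le_total a b with h | h
  · rw [abs_sub_comm a b, abs_of_nonneg (sub_nonneg.2 h)]
    exact (hA.mono θ a ha b hb h).trans (le_abs_self _)
  · rw [abs_of_nonneg (sub_nonneg.2 h), abs_sub_comm]
    exact (hA.mono θ b hb a ha h).trans (le_abs_self _)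

end IsContractingAnnulus

theorem polarSlope_add_two_pi (r θ : ℝ) :
    polarSlope f r (θ + 2 * Real.pi) = polarSlope f r θ := by
  simp [polarSlope, radialPart, angularPart, pol_add_two_pi]

theorem angularPart_add_two_pi (r θ : ℝ) :
    angularPart f r (θ + 2 * Real.pi) = angularPart f r θ := by
  simp [angularPart, pol_add_two_pi]

theorem contDiffAt_angularPart (hf : ContDiff ℝ 1 f) {θ r : ℝ} (hr : 0 < r) :
    ContDiffAt ℝ 1 (fun q : ℝ × ℝ => angularPart f q.2 q.1) (θ, r) := by
  have h1 : ContDiff ℝ 1 (fun q : ℝ × ℝ => f (pol q.2 q.1)) := hf.comp contDiff_pol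
  have h2 : ContDiff ℝ 1 (fun q : ℝ × ℝ => Real.cos q.1) := Real.contDiff_cos.comp contDiff_fst
  have h3 : ContDiff ℝ 1 (fun q : ℝ × ℝ => Real.sin q.1) := Real.contDiff_sin.comp contDiff_fst
  exact ((h2.mul h1.snd).sub (h3.mul h1.fst)).contDiffAt.div contDiff_snd.contDiffAt hr.ne'

theorem contDiffAt_polarSlope (hf : ContDiff ℝ 1 f) {θ r : ℝ} (hr : 0 < r)
    (hang : angularPart f r θ ≠ 0) :
    ContDiffAt ℝ 1 (fun q : ℝ × ℝ => polarSlope f q.2 q.1) (θ, r) := by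
  have h1 : ContDiff ℝ 1 (fun q : ℝ × ℝ => f (pol q.2 q.1)) := hf.comp contDiff_pol
  have h2 : ContDiff ℝ 1 (fun q : ℝ × ℝ => Real.cos q.1) := Real.contDiff_cos.comp contDiff_fst
  have h3 : ContDiff ℝ 1 (fun q : ℝ × ℝ => Real.sin q.1) := Real.contDiff_sin.comp contDiff_fst
  exact ((h2.mul h1.fst).add (h3.mul h1.snd)).contDiffAt.div (contDiffAt_angularPart hf hr) hang

/-- Angles can be reduced to `[0, 2π)` simultaneously for all radii. -/
theorem exists_angle_mem_Ico {g : ℝ × ℝ → ℝ} (hg : ∀ θ r, g (θ + 2 * Real.pi, r) = g (θ, r))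
    (θ : ℝ) : ∃ φ ∈ Ico 0 (2 * Real.pi), ∀ r, g (θ, r) = g (φ, r) := by
  have hper : Function.Periodic (fun θ r => g (θ, r)) (2 * Real.pi) := fun θ => funext (hg θ)
  obtain ⟨φ, hφ, h⟩ := hper.exists_mem_Ico₀ Real.two_pi_pos θ
  exact ⟨φ, hφ, fun r => congrFun h r⟩

namespace IsContractingAnnulus

/-- Periodicity in the angle reduces the claim to a compact rectangle, where the positive continuous
angular velocity attains its minimum. -/
theorem exists_angular_lower_bound (hA : IsContractingAnnulus f w H r₁ r₂ M₁ m₁ m₂ M₂ κ c)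
    (hf : ContDiff ℝ 1 f) : ∃ τ₀ > 0, ∀ θ, ∀ r ∈ Icc r₁ r₂, τ₀ ≤ angularPart f r θ := by
  have hcomp : IsCompact (Icc 0 (2 * Real.pi) ×ˢ Icc r₁ r₂) := isCompact_Icc.prod isCompact_Icc
  have hne : (Icc 0 (2 * Real.pi) ×ˢ Icc r₁ r₂).Nonempty :=
    ⟨(0, r₁), left_mem_Icc.2 Real.two_pi_pos.le, left_mem_Icc.2 hA.r₁_lt.le⟩
  obtain ⟨q, hq, hmin⟩ := hcomp.exists_isMinOn hne
    (f := fun q : ℝ × ℝ => angularPart f q.2 q.1) fun q hq =>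
      (contDiffAt_angularPart hf (hA.r₁_pos.trans_le hq.2.1)).continuousAt.continuousWithinAt
  refine ⟨angularPart f q.2 q.1, hA.angular_pos _ _ hq.2, fun θ r hr => ?_⟩
  obtain ⟨φ, hφ, h⟩ := exists_angle_mem_Ico (g := fun q => angularPart f q.2 q.1)
    (fun θ r => angularPart_add_two_pi r θ) θ
  rw [h r]
  exact hmin (a := (φ, r)) ⟨Ico_subset_Icc_self hφ, hr⟩

theorem exists_slope_bounds (hA : IsContractingAnnulus f w H r₁ r₂ M₁ m₁ m₂ M₂ κ c)
    (hf : ContDiff ℝ 1 f) : ∃ (K : ℝ≥0) (M : ℝ), ∀ θ,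
      LipschitzOnWith K (fun r => polarSlope f r θ) (Icc r₁ r₂) ∧
      ∀ r ∈ Icc r₁ r₂, ‖polarSlope f r θ‖ ≤ M := by
  have hcomp : IsCompact (Icc 0 (2 * Real.pi) ×ˢ Icc r₁ r₂) := isCompact_Icc.prod isCompact_Icc
  have hcd : ∀ q ∈ Icc 0 (2 * Real.pi) ×ˢ Icc r₁ r₂,
      ContDiffAt ℝ 1 (fun q : ℝ × ℝ => polarSlope f q.2 q.1) q := fun q hq =>
    contDiffAt_polarSlope hf (hA.r₁_pos.trans_le hq.2.1) (hA.angular_pos _ _ hq.2).ne'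
  obtain ⟨K, hK⟩ := LocallyLipschitzOn.exists_lipschitzOnWith_of_compact hcomp
    (f := fun q : ℝ × ℝ => polarSlope f q.2 q.1) fun q hq => by
      obtain ⟨K, t, ht, h⟩ := (hcd q hq).exists_lipschitzOnWith
      exact ⟨K, t, mem_nhdsWithin_of_mem_nhds ht, h⟩
  obtain ⟨M, hM⟩ := hcomp.exists_bound_of_continuousOn
    (f := fun q : ℝ × ℝ => polarSlope f q.2 q.1)
    fun q hq => (hcd q hq).continuousAt.continuousWithinAt
  refine ⟨K, M, fun θ => ?_⟩
  obtain ⟨φ, hφ, h⟩ := exists_angle_mem_Ico (g := fun q => polarSlope f q.2 q.1)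
    (fun θ r => polarSlope_add_two_pi r θ) θ
  have hφ' := Ico_subset_Icc_self hφ
  constructor
  · intro a ha b hb
    simp only [h]
    have := hK (x := (φ, a)) ⟨hφ', ha⟩ (y := (φ, b)) ⟨hφ', hb⟩
    simpa [Prod.edist_eq] using this
  · intro r hr
    rw [h]
    exact hM (φ, r) ⟨hφ', hr⟩

/-- In a contracting annulus there is a closed orbit, as the graph of a periodic function of the
angle. -/
theorem exists_periodic_radius (hA : IsContractingAnnulus f w H r₁ r₂ M₁ m₁ m₂ M₂ κ c)
    (hf : ContDiff ℝ 1 f) : ∃ ρ : ℝ → ℝ, Function.Periodic ρ (2 * Real.pi) ∧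
      ∀ θ, ρ θ ∈ Ioo r₁ r₂ ∧ w (θ, ρ θ) ∈ Icc m₁ m₂ ∧
        HasDerivAt ρ (polarSlope f (ρ θ) θ) θ := by
  obtain ⟨K, M, hKM⟩ := hA.exists_slope_bounds hf
  have hle := hA.r₁_lt.le
  -- Clamping the radius to `[r₁, r₂]` gives an equation in the angle that is globally Lipschitz and
  -- bounded; in the annulus its solutions follow the orbits of `f`.
  let F : ℝ → ℝ → ℝ := fun θ r => polarSlope f (projIcc r₁ r₂ hle r) θ
  have hproj : ∀ r ∈ Icc r₁ r₂, (projIcc r₁ r₂ hle r : ℝ) = r := fun r hr =>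
    congrArg Subtype.val (projIcc_of_mem hle hr)
  have hFK : ∀ θ, LipschitzWith K (F θ) := by
    intro θ a b
    refine ((hKM θ).1 (projIcc r₁ r₂ hle a).2 (projIcc r₁ r₂ hle b).2).trans ?_
    gcongr
    have := (LipschitzWith.projIcc hle) a b
    simpa using! this
  have hFc : ∀ r, Continuous fun θ => F θ r := by
    intro r
    refine continuous_iff_continuousAt.2 fun θ => ?_
    have h1 := (projIcc r₁ r₂ hle r).2
    have h2 := (contDiffAt_polarSlope hf (θ := θ) (hA.r₁_pos.trans_le h1.1)
      (hA.angular_pos θ _ h1).ne').continuousAt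
    exact h2.comp (f := fun θ : ℝ => (θ, (projIcc r₁ r₂ hle r : ℝ)))
      (continuous_id.prodMk continuous_const).continuousAt
  have hFM : ∀ θ r, ‖F θ r‖ ≤ M := fun θ r => (hKM θ).2 _ (projIcc r₁ r₂ hle r).2
  choose ρ hρ0 hρ using fun x₀ : ℝ => exists_global_solution hFK hFc hFM x₀
  have hcur : ∀ x₀ T, IsAngularCurve f r₁ r₂ id (ρ x₀) (fun _ => 1) T := by
    intro x₀ T t ht
    refine ⟨(hasDerivAt_id t).hasDerivWithinAt, (hρ x₀ t).continuousAt.continuousWithinAt,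
      fun hr => ⟨one_pos, ?_⟩⟩
    have h1 := (hρ x₀ t).hasDerivWithinAt (s := Icc 0 T)
    simp only [F, hproj _ hr] at h1
    simpa using h1
  have hM1 := hA.M₁_lt
  have hM2 := hA.m₂_lt
  have hm := hA.m₁_lt
  have hw0c : ContinuousOn (fun r => w (0, r)) (Icc r₁ r₂) := fun r hr =>
    ((hA.continuousAt_w (q := (0, r)) (hA.r₁_pos.trans_le hr.1)).comp
      (f := fun r : ℝ => ((0 : ℝ), r))
      (continuous_const.prodMk continuous_id).continuousAt).continuousWithinAt
  have hin := hA.inner 0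
  have hout := hA.outer 0
  obtain ⟨ra, hra, hwa⟩ : ∃ ra ∈ Icc r₁ r₂, w (0, ra) = m₂ :=
    intermediate_value_Icc' hle hw0c ⟨by linarith, by linarith⟩
  obtain ⟨rb, hrb, hwb⟩ : ∃ rb ∈ Icc r₁ r₂, w (0, rb) = m₁ :=
    intermediate_value_Icc' hle hw0c ⟨by linarith, by linarith⟩
  have hanti : ∀ a ∈ Icc r₁ r₂, ∀ b ∈ Icc r₁ r₂, a ≤ b → w (0, b) ≤ w (0, a) := by
    intro a ha b hb hab
    have h1 := hA.mono 0 a ha b hb hab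
    have h2 := mul_nonneg hA.c_pos.le (sub_nonneg.2 hab)
    linarith
  have hanti' : ∀ a ∈ Icc r₁ r₂, ∀ b ∈ Icc r₁ r₂, w (0, b) ≤ w (0, a) → a ≤ b := by
    intro a ha b hb hab
    by_contra hlt
    push Not at hlt
    have h1 := hA.mono 0 b hb a ha hlt.le
    have h2 := mul_pos hA.c_pos (sub_pos.2 hlt)
    linarith
  have hab : ra ≤ rb := hanti' ra hra rb hrb (by linarith)
  have hsub : Icc ra rb ⊆ Icc r₁ r₂ := Icc_subset_Icc hra.1 hrb.2
  have hwm : ∀ x ∈ Icc ra rb, w (0, x) ∈ Icc m₁ m₂ := fun x hx =>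
    ⟨hwb ▸ hanti x (hsub hx) rb hrb hx.2, hwa ▸ hanti ra hra x (hsub hx) hx.1⟩
  have hIoo : ∀ θ, ∀ r ∈ Icc r₁ r₂, w (θ, r) ∈ Icc m₁ m₂ → r ∈ Ioo r₁ r₂ := by
    intro θ r hr hw
    refine ⟨lt_of_le_of_ne hr.1 fun h => ?_, lt_of_le_of_ne hr.2 fun h => ?_⟩
    · have := hA.inner θ
      rw [h] at this
      linarith [hw.2]
    · have := hA.outer θ
      rw [← h] at this
      linarith [hw.1]
  have hstay : ∀ x ∈ Icc ra rb, ∀ t, 0 ≤ t → ρ x t ∈ Ioo r₁ r₂ ∧ w (t, ρ x t) ∈ Icc m₁ m₂ := by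
    intro x hx t ht
    have hx1 := hIoo 0 x (hsub hx) (hwm x hx)
    have hx2 := hwm x hx
    -- `trap` concerns open regions. Levels slightly outside `[m₁, m₂]` are used, and taking `ε` no
    -- larger than a hypothetical overshoot shows that the closed region is invariant too.
    have key : ∀ ε > 0, ε ≤ m₁ - M₁ → ε ≤ M₂ - m₂ →
        ρ x t ∈ Ioo r₁ r₂ ∧ w (t, ρ x t) ∈ Ioo (m₁ - ε) (m₂ + ε) := by
      intro ε hε h1 h2
      exact hA.trap (hcur x t) (μ₁ := m₁ - ε) (μ₂ := m₂ + ε) ⟨by linarith, by linarith⟩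
        ⟨by linarith, by linarith⟩ (by rw [hρ0]; exact hx1)
        (by rw [hρ0, id]; exact ⟨by linarith [hx2.1], by linarith [hx2.2]⟩) t
        (right_mem_Icc.2 ht)
    set ε₀ := min (m₁ - M₁) (M₂ - m₂)
    have hε₀ : 0 < ε₀ := lt_min (by linarith) (by linarith)
    have hl := min_le_left (m₁ - M₁) (M₂ - m₂)
    have hr := min_le_right (m₁ - M₁) (M₂ - m₂)
    refine ⟨(key ε₀ hε₀ hl hr).1, ?_, ?_⟩
    · by_contra hlt
      push Not at hlt
      have := (key (min ε₀ (m₁ - w (t, ρ x t))) (lt_min hε₀ (by linarith))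
        ((min_le_left _ _).trans hl) ((min_le_left _ _).trans hr)).2.1
      linarith [min_le_right ε₀ (m₁ - w (t, ρ x t))]
    · by_contra hlt
      push Not at hlt
      have := (key (min ε₀ (w (t, ρ x t) - m₂)) (lt_min hε₀ (by linarith))
        ((min_le_left _ _).trans hl) ((min_le_left _ _).trans hr)).2.2
      linarith [min_le_right ε₀ (w (t, ρ x t) - m₂)]
  have hpi := Real.two_pi_pos
  have hw2 : ∀ r, w (2 * Real.pi, r) = w (0, r) := fun r => by
    have := hA.periodic 0 r
    rwa [zero_add] at this
  -- The interval `[ra, rb]` is `m₁ ≤ w ≤ m₂` on the ray of angle 0, and `w` is `2π`-periodic, so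
  -- one turn maps the interval into itself. By contraction the return map is continuous, hence it
  -- has a fixed point.
  have hmaps : MapsTo (fun x => ρ x (2 * Real.pi)) (Icc ra rb) (Icc ra rb) := by
    intro x hx
    obtain ⟨h1, h2⟩ := hstay x hx _ hpi.le
    rw [hw2] at h2
    have h1' := Ioo_subset_Icc_self h1
    exact ⟨hanti' ra hra _ h1' (by rw [hwa]; exact h2.2),
      hanti' _ h1' rb hrb (by rw [hwb]; exact h2.1)⟩
  have hcont : ContinuousOn (fun x => ρ x (2 * Real.pi)) (Icc ra rb) := by
    have hest : ∀ x ∈ Icc ra rb, ∀ y ∈ Icc ra rb,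
        c * |ρ x (2 * Real.pi) - ρ y (2 * Real.pi)| ≤ |w (0, x) - w (0, y)| := by
      intro x hx y hy
      have h1 := hA.contraction one_pos (hcur x (2 * Real.pi)) (hcur y (2 * Real.pi))
        (fun t ht => Ioo_subset_Icc_self (hstay x hx t ht.1).1)
        (fun t ht => Ioo_subset_Icc_self (hstay y hy t ht.1).1) (fun _ _ => le_rfl) _
        (right_mem_Icc.2 hpi.le)
      simp only [id, hρ0] at h1
      have h2 : Real.exp (-(2 * κ * 1) * (2 * Real.pi)) ≤ 1 := by
        refine Real.exp_le_one_iff.2 ?_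
        have := mul_pos hA.κ_pos hpi
        linarith
      have h3 := sq_le_sq.1 (h1.trans (mul_le_of_le_one_right (sq_nonneg _) h2))
      exact (hA.radius_dist_le _ (Ioo_subset_Icc_self (hstay x hx _ hpi.le).1)
        (Ioo_subset_Icc_self (hstay y hy _ hpi.le).1)).trans h3
    intro y hy
    rw [ContinuousWithinAt, tendsto_iff_dist_tendsto_zero]
    have hlim : Tendsto (fun x => |w (0, x) - w (0, y)| / c) (𝓝[Icc ra rb] y) (𝓝 0) := by
      have h1 : Tendsto (fun x => w (0, x)) (𝓝[Icc ra rb] y) (𝓝 (w (0, y))) :=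
        (hw0c y (hsub hy)).mono hsub
      have h2 := ((h1.sub_const (w (0, y))).abs).div_const c
      simpa using h2
    refine squeeze_zero' (Eventually.of_forall fun _ => dist_nonneg) ?_ hlim
    filter_upwards [self_mem_nhdsWithin] with x hx
    rw [Real.dist_eq, le_div_iff₀ hA.c_pos, mul_comm]
    exact hest x hx y hy
  obtain ⟨x, hx, hfix⟩ := exists_mem_Icc_isFixedPt_of_mapsTo hcont hab hmaps
  have hper : Function.Periodic (ρ x) (2 * Real.pi) := by
    have : (fun t => ρ x (t + 2 * Real.pi)) = ρ x := by
      refine ODE_solution_unique_univ (v := F) (s := fun _ => univ) (K := K) (t₀ := 0)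
        (fun t => (hFK t).lipschitzOnWith) (fun t => ⟨?_, trivial⟩) (fun t => ⟨hρ x t, trivial⟩) ?_
      · have h1 := (hρ x (t + 2 * Real.pi)).comp_add_const t (2 * Real.pi)
        simpa only [F, polarSlope_add_two_pi] using h1
      · simp only [zero_add, hρ0]
        exact hfix
    exact fun t => congrFun this t
  refine ⟨ρ x, hper, fun θ => ?_⟩
  have hall : ρ x θ ∈ Ioo r₁ r₂ ∧ w (θ, ρ x θ) ∈ Icc m₁ m₂ := by
    have hp : Function.Periodic (fun θ => (ρ x θ, w (θ, ρ x θ))) (2 * Real.pi) := by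
      intro θ
      simp only [hper θ, hA.periodic]
    obtain ⟨φ, hφ, h⟩ := hp.exists_mem_Ico₀ hpi θ
    have h1 := congrArg Prod.fst h
    have h2 := congrArg Prod.snd h
    simp only at h1 h2
    rw [h2, h1]
    exact hstay x hx φ hφ.1
  refine ⟨hall.1, hall.2, ?_⟩
  have h1 := hρ x θ
  simpa only [F, hproj _ (Ioo_subset_Icc_self hall.1)] using h1

end IsContractingAnnulus

end Annulus

/-! ### The closed orbit of a contracting annulus and its asymptotic stability -/

section AnnulusOrbit

variable {f : ℝ × ℝ → ℝ × ℝ} {w H : ℝ × ℝ → ℝ} {r₁ r₂ M₁ m₁ m₂ M₂ κ c : ℝ}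

namespace IsContractingAnnulus

/-- Solutions that start in a contracting annulus stay there, turn around the origin and approach
the closed orbit. -/
theorem flow (hA : IsContractingAnnulus f w H r₁ r₂ M₁ m₁ m₂ M₂ κ c) (hf : ContDiff ℝ 1 f)
    {τ₀ : ℝ} (hτ₀ : 0 < τ₀) (hang : ∀ θ, ∀ r ∈ Icc r₁ r₂, τ₀ ≤ angularPart f r θ)
    {ρ : ℝ → ℝ} (hρ : ∀ θ, ρ θ ∈ Ioo r₁ r₂ ∧ HasDerivAt ρ (polarSlope f (ρ θ) θ) θ)
    {γ : ℝ → ℝ × ℝ} {T : ℝ} (hT : 0 ≤ T) (hγ : IsIntegralCurveOn γ (fun _ => f) (Icc 0 T))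
    {r₀ θ₀ : ℝ} (h0 : γ 0 = pol r₀ θ₀) (hr₀ : r₀ ∈ Ioo r₁ r₂) (hw₀ : w (θ₀, r₀) ∈ Ioo M₁ M₂) :
    ∃ r θ : ℝ → ℝ, θ 0 = θ₀ ∧ ∀ t ∈ Icc 0 T, r t ∈ Ioo r₁ r₂ ∧ w (θ t, r t) ∈ Ioo M₁ M₂ ∧
      γ t = pol (r t) (θ t) ∧ HasDerivWithinAt θ (angularPart f (r t) (θ t)) (Icc 0 T) t ∧
      (w (θ t, r t) - w (θ t, ρ (θ t))) ^ 2
        ≤ (w (θ₀, r₀) - w (θ₀, ρ θ₀)) ^ 2 * Real.exp (-(2 * κ * τ₀) * t) := by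
  have hr₀pos : 0 < r₀ := hA.r₁_pos.trans hr₀.1
  have hM₁ : M₁ ∈ Icc M₁ m₁ := left_mem_Icc.2 hA.M₁_lt.le
  have hM₂ : M₂ ∈ Icc m₂ M₂ := right_mem_Icc.2 hA.m₂_lt.le
  have hcurve : ∀ {T : ℝ} {r θ : ℝ → ℝ}, (∀ t ∈ Icc 0 T, 0 < r t ∧ γ t = pol (r t) (θ t) ∧
      HasDerivWithinAt r (radialPart f (r t) (θ t)) (Icc 0 T) t ∧
      HasDerivWithinAt θ (angularPart f (r t) (θ t)) (Icc 0 T) t) →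
      IsAngularCurve f r₁ r₂ θ r (fun t => angularPart f (r t) (θ t)) T := by
    intro T r θ h t ht
    obtain ⟨-, -, h3, h4⟩ := h t ht
    refine ⟨h4, h3.continuousWithinAt, fun hr => ?_⟩
    have hpos := hA.angular_pos (θ t) (r t) hr
    refine ⟨hpos, h3.congr_deriv ?_⟩
    rw [polarSlope]
    field_simp
  -- Polar coordinates need a curve that avoids the origin. Before a first visit to the origin the
  -- curve lifts and is trapped at radius greater than `r₁`; by continuity it could not arrive at 0.
  have hne : ∀ t ∈ Icc 0 T, γ t ≠ 0 := by
    by_contra! hcon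
    obtain ⟨t₁, ht₁, hz⟩ := hcon
    obtain ⟨s, hs, hsU, hlt⟩ := exists_first_exit (U := {p : ℝ × ℝ | p ≠ 0}) hγ.continuousOn
      isOpen_ne (by
        intro h
        have h1 := sq_add_sq_pol r₀ θ₀
        rw [← h0, h] at h1
        simp only [Prod.fst_zero, Prod.snd_zero] at h1
        nlinarith) ht₁ (by simpa using hz)
    have hsz : γ s = 0 := by simpa using hsU
    have hbig : ∀ t ∈ Ico 0 s, γ t ∈ {p : ℝ × ℝ | r₁ ^ 2 ≤ p.1 ^ 2 + p.2 ^ 2} := by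
      intro t ht
      have hγt : IsIntegralCurveOn γ (fun _ => f) (Icc 0 t) :=
        hγ.mono (Icc_subset_Icc_right (ht.2.le.trans hs.2))
      obtain ⟨r, θ, hr0, hθ0, h⟩ := exists_polar_lift hf.continuous ht.1 hγt
        (fun u hu => hlt u ⟨hu.1, hu.2.trans_lt ht.2⟩) hr₀pos h0
      have h1 := hA.trap (hcurve h) hM₁ hM₂ (by rwa [hr0]) (by rwa [hr0, hθ0]) t
        (right_mem_Icc.2 ht.1)
      rw [mem_ofPred_eq, (h t (right_mem_Icc.2 ht.1)).2.1, sq_add_sq_pol]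
      have := hA.r₁_pos
      have := h1.1.1
      gcongr
    have h1 := mem_of_forall_mem_Ico hγ.continuousOn
      (isClosed_le continuous_const (by fun_prop)) hs hbig
    rw [hsz, mem_ofPred_eq] at h1
    have := hA.r₁_pos
    simp only [Prod.fst_zero, Prod.snd_zero] at h1
    nlinarith
  obtain ⟨r, θ, hr0, hθ0, h⟩ := exists_polar_lift hf.continuous hT hγ hne hr₀pos h0
  have htrap := hA.trap (hcurve h) hM₁ hM₂ (by rwa [hr0]) (by rwa [hr0, hθ0])
  -- The closed orbit is followed at the angle of the given solution, not in its own time, so that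
  -- `contraction` can compare the two radii on the same ray.
  have hρcur : IsAngularCurve f r₁ r₂ θ (fun t => ρ (θ t))
      (fun t => angularPart f (r t) (θ t)) T := by
    intro t ht
    have h4 := (h t ht).2.2.2
    have h5 := (hρ (θ t)).2.comp_hasDerivWithinAt t h4
    refine ⟨h4, h5.continuousWithinAt, fun _ =>
      ⟨hA.angular_pos _ _ (Ioo_subset_Icc_self (htrap t ht).1), ?_⟩⟩
    refine h5.congr_deriv (mul_comm _ _)
  have hcontr := hA.contraction hτ₀ (hcurve h) hρcur
    (fun t ht => Ioo_subset_Icc_self (htrap t ht).1)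
    (fun t _ => Ioo_subset_Icc_self (hρ (θ t)).1)
    (fun t ht => hang _ _ (Ioo_subset_Icc_self (htrap t ht).1))
  simp only [hr0, hθ0] at hcontr
  exact ⟨r, θ, hθ0, fun t ht => ⟨(htrap t ht).1, (htrap t ht).2, (h t ht).2.1, (h t ht).2.2.2,
    hcontr t ht⟩⟩

/-- A solution that starts on the graph has `w`-distance 0 to it, and the contraction estimate keeps
this distance 0. Its angle advances at speed at least `τ₀`, so it completes a turn by time `2π / τ₀`
and closes up. -/
theorem isPeriodicOrbit_graph (hA : IsContractingAnnulus f w H r₁ r₂ M₁ m₁ m₂ M₂ κ c)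
    (hf : ContDiff ℝ 1 f) {ρ : ℝ → ℝ} (hper : Function.Periodic ρ (2 * Real.pi))
    (hρ : ∀ θ, ρ θ ∈ Ioo r₁ r₂ ∧ w (θ, ρ θ) ∈ Icc m₁ m₂ ∧
      HasDerivAt ρ (polarSlope f (ρ θ) θ) θ) :
    IsPeriodicOrbit f (range fun θ => pol (ρ θ) θ) := by
  obtain ⟨τ₀, hτ₀, hang⟩ := hA.exists_angular_lower_bound hf
  have hρ' : ∀ θ, ρ θ ∈ Ioo r₁ r₂ ∧ HasDerivAt ρ (polarSlope f (ρ θ) θ) θ :=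
    fun θ => ⟨(hρ θ).1, (hρ θ).2.2⟩
  have hwρ : ∀ θ, w (θ, ρ θ) ∈ Ioo M₁ M₂ := fun θ =>
    ⟨hA.M₁_lt.trans_le (hρ θ).2.1.1, (hρ θ).2.1.2.trans_lt hA.m₂_lt⟩
  have hpos : ∀ θ, 0 < ρ θ := fun θ => hA.r₁_pos.trans (hρ θ).1.1
  have hpi := Real.two_pi_pos
  have hflow : ∀ (γ : ℝ → ℝ × ℝ) (T : ℝ), 0 ≤ T → IsIntegralCurveOn γ (fun _ => f) (Icc 0 T) →
      γ 0 = pol (ρ 0) 0 → ∃ θ : ℝ → ℝ, θ 0 = 0 ∧ ∀ t ∈ Icc 0 T, γ t = pol (ρ (θ t)) (θ t) ∧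
        HasDerivWithinAt θ (angularPart f (ρ (θ t)) (θ t)) (Icc 0 T) t := by
    intro γ T hT hγ h0
    obtain ⟨r, θ, hθ0, h⟩ := hA.flow hf hτ₀ hang hρ' hT hγ h0 (hρ 0).1 (hwρ 0)
    refine ⟨θ, hθ0, fun t ht => ?_⟩
    obtain ⟨h1, -, h3, h4, h5⟩ := h t ht
    have h6 : r t = ρ (θ t) := by
      have h7 : (w (θ t, r t) - w (θ t, ρ (θ t))) ^ 2 ≤ 0 := by simpa using h5
      have h8 : w (θ t, r t) - w (θ t, ρ (θ t)) = 0 := by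
        have := le_antisymm h7 (sq_nonneg _)
        simpa using this
      have h9 := hA.radius_dist_le (θ t) (Ioo_subset_Icc_self h1)
        (Ioo_subset_Icc_self (hρ (θ t)).1)
      rw [h8, abs_zero] at h9
      have h10 : |r t - ρ (θ t)| ≤ 0 := nonpos_of_mul_nonpos_right h9 hA.c_pos
      exact sub_eq_zero.1 (abs_nonpos_iff.1 h10)
    rw [← h6]
    exact ⟨h3, h4⟩
  have hnorm : ∀ θ, ‖pol (ρ θ) θ‖ ≤ r₂ := fun θ => (norm_pol_le (hpos θ).le).trans (hρ θ).1.2.le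
  obtain ⟨γ, hγ, h0⟩ := exists_solution_Ici hf (p := pol (ρ 0) 0) (R := r₂) (hnorm 0)
    fun γ T hT hγ h0 t ht => by
      obtain ⟨θ, -, h⟩ := hflow γ T hT hγ h0
      rw [(h t ht).1]
      exact hnorm _
  have hT₀ : 0 ≤ 2 * Real.pi / τ₀ := (div_pos hpi hτ₀).le
  obtain ⟨θ, hθ0, hθ⟩ := hflow γ _ hT₀ (hγ.mono Icc_subset_Ici_self) h0
  have hθc : ContinuousOn θ (Icc 0 (2 * Real.pi / τ₀)) :=
    fun t ht => (hθ t ht).2.continuousWithinAt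
  have hend : 2 * Real.pi ≤ θ (2 * Real.pi / τ₀) := by
    have hmono : MonotoneOn (fun t => θ t - τ₀ * t) (Icc 0 (2 * Real.pi / τ₀)) := by
      refine monotoneOn_of_hasDerivWithinAt_nonneg (convex_Icc _ _)
        (f' := fun t => angularPart f (ρ (θ t)) (θ t) - τ₀)
        (hθc.sub (by fun_prop)) (fun t ht => ?_) fun t _ => ?_
      · have h3 : HasDerivWithinAt (fun t => τ₀ * t) τ₀ (interior (Icc 0 (2 * Real.pi / τ₀))) t := by
          simpa using ((hasDerivAt_id t).const_mul τ₀).hasDerivWithinAt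
        exact ((hθ t (interior_subset ht)).2.mono interior_subset).sub h3
      · exact sub_nonneg.2 (hang _ _ (Ioo_subset_Icc_self (hρ _).1))
    have h1 := hmono (left_mem_Icc.2 hT₀) (right_mem_Icc.2 hT₀) hT₀
    simp only [hθ0, mul_zero, sub_zero] at h1
    rw [mul_div_cancel₀ _ hτ₀.ne'] at h1
    linarith
  obtain ⟨T, hT, hθT⟩ : ∃ T ∈ Icc 0 (2 * Real.pi / τ₀), θ T = 2 * Real.pi :=
    intermediate_value_Icc hT₀ hθc ⟨by rw [hθ0]; exact hpi.le, hend⟩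
  have hTpos : 0 < T := lt_of_le_of_ne hT.1 fun h => by
    rw [← h, hθ0] at hθT
    linarith
  have hsub : Icc 0 T ⊆ Icc 0 (2 * Real.pi / τ₀) := Icc_subset_Icc_right hT.2
  have hgper : Function.Periodic (fun θ => pol (ρ θ) θ) (2 * Real.pi) := fun θ => by
    simp only [hper θ, pol_add_two_pi]
  have hret : γ T = γ 0 := by
    rw [(hθ T hT).1, hθT, h0]
    have := hgper 0
    simpa using this
  obtain ⟨δ, hδ, hδper, hδγ⟩ := exists_periodic_extension hf hTpos
    (hγ.mono Icc_subset_Ici_self) (fun t ht => by rw [(hθ t (hsub ht)).1]; exact hnorm _) hret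
  have hrange : (range fun θ => pol (ρ θ) θ) = range δ := by
    apply Subset.antisymm
    · rintro _ ⟨φ, rfl⟩
      obtain ⟨φ', hφ', h⟩ := hgper.exists_mem_Ico₀ hpi φ
      obtain ⟨t, ht, hθt⟩ : ∃ t ∈ Icc 0 T, θ t = φ' :=
        intermediate_value_Icc hT.1 (hθc.mono hsub) (by
          rw [hθ0, hθT]; exact Ico_subset_Icc_self hφ')
      refine ⟨t, ?_⟩
      rw [hδγ ht, (hθ t (hsub ht)).1, hθt]
      exact h.symm
    · rintro _ ⟨t, rfl⟩
      obtain ⟨s, hs, h⟩ := hδper.exists_mem_Ico₀ hTpos t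
      have hs' := Ico_subset_Icc_self hs
      exact ⟨θ s, by rw [h, hδγ hs', (hθ s (hsub hs')).1]⟩
  refine ⟨δ, T, hTpos, hδ, hδper, ?_, hrange⟩
  -- The orbit is not constant, because its points at angles `0` and `π` have abscissas of opposite
  -- sign.
  obtain ⟨t, ht⟩ : pol (ρ Real.pi) Real.pi ∈ range δ := hrange ▸ ⟨Real.pi, rfl⟩
  refine ⟨t, fun heq => ?_⟩
  rw [ht, hδγ (left_mem_Icc.2 hTpos.le), h0] at heq
  have h1 := congrArg Prod.fst heq
  simp only [pol, Real.cos_pi, Real.cos_zero] at h1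
  linarith [hpos 0, hpos Real.pi]

/-- The difference in `w` from the closed orbit at the same angle decays exponentially and dominates
the distance in the plane. The sets `V η` where this difference is below `η` thus serve as
neighbourhoods, both for stability and for attraction. -/
theorem asymptoticallyStable_graph (hA : IsContractingAnnulus f w H r₁ r₂ M₁ m₁ m₂ M₂ κ c)
    (hf : ContDiff ℝ 1 f) {ρ : ℝ → ℝ} (hper : Function.Periodic ρ (2 * Real.pi))
    (hρ : ∀ θ, ρ θ ∈ Ioo r₁ r₂ ∧ w (θ, ρ θ) ∈ Icc m₁ m₂ ∧
      HasDerivAt ρ (polarSlope f (ρ θ) θ) θ) :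
    AsymptoticallyStable f (range fun θ => pol (ρ θ) θ) := by
  obtain ⟨τ₀, hτ₀, hang⟩ := hA.exists_angular_lower_bound hf
  have hρ' : ∀ θ, ρ θ ∈ Ioo r₁ r₂ ∧ HasDerivAt ρ (polarSlope f (ρ θ) θ) θ :=
    fun θ => ⟨(hρ θ).1, (hρ θ).2.2⟩
  have hρc : Continuous ρ := continuous_iff_continuousAt.2 fun θ => (hρ θ).2.2.continuousAt
  have hwρ : ∀ θ, w (θ, ρ θ) ∈ Ioo M₁ M₂ := fun θ =>
    ⟨hA.M₁_lt.trans_le (hρ θ).2.1.1, (hρ θ).2.1.2.trans_lt hA.m₂_lt⟩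
  have hκ := hA.κ_pos
  have hc := hA.c_pos
  set Γ : Set (ℝ × ℝ) := range fun θ => pol (ρ θ) θ with hΓ
  let V : ℝ → Set (ℝ × ℝ) := fun η => (fun q : ℝ × ℝ => pol q.1 q.2) ''
    {q | q.1 ∈ Ioo r₁ r₂ ∧ w (q.2, q.1) ∈ Ioo M₁ M₂ ∧ |w (q.2, q.1) - w (q.2, ρ q.2)| < η}
  have hVo : ∀ η, IsOpen (V η) := by
    intro η
    rw [isOpen_iff_mem_nhds]
    rintro _ ⟨⟨r, θ⟩, ⟨hr, hw, hd⟩, rfl⟩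
    have hrpos : 0 < r := hA.r₁_pos.trans hr.1
    refine pol_image_mem_nhds hrpos ?_
    have c1 : ContinuousAt (fun q : ℝ × ℝ => w (q.2, q.1)) (r, θ) :=
      (hA.continuousAt_w (q := (θ, r)) hrpos).comp (f := fun q : ℝ × ℝ => (q.2, q.1))
        (by fun_prop)
    have c2 : ContinuousAt (fun q : ℝ × ℝ => w (q.2, ρ q.2)) (r, θ) :=
      (hA.continuousAt_w (q := (θ, ρ θ)) (hA.r₁_pos.trans (hρ θ).1.1)).comp
        (f := fun q : ℝ × ℝ => (q.2, ρ q.2))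
        (continuous_snd.prodMk (hρc.comp continuous_snd)).continuousAt
    have e1 := (continuous_fst.continuousAt (x := ((r, θ) : ℝ × ℝ))).eventually
      (Ioo_mem_nhds hr.1 hr.2)
    have e2 := c1.eventually (Ioo_mem_nhds hw.1 hw.2)
    have e3 := (c1.sub c2).abs.eventually (Iio_mem_nhds hd)
    filter_upwards [e1, e2, e3] with q h1 h2 h3 using ⟨h1, h2, h3⟩
  have hΓV : ∀ η > 0, Γ ⊆ V η := by
    rintro η hη _ ⟨θ, rfl⟩
    exact ⟨(ρ θ, θ), ⟨(hρ θ).1, hwρ θ, by simpa using hη⟩, rfl⟩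
  have hnorm : ∀ r ∈ Ioo r₁ r₂, ∀ θ, ‖pol r θ‖ ≤ r₂ := fun r hr θ =>
    (norm_pol_le (hA.r₁_pos.trans hr.1).le).trans hr.2.le
  refine ⟨fun U hU hΓU => ?_, V 1, hVo 1, hΓV 1 one_pos, ?_⟩
  · have hcomp : IsCompact Γ := by
      have hgper : Function.Periodic (fun θ => pol (ρ θ) θ) (2 * Real.pi) := fun θ => by
        simp only [hper θ, pol_add_two_pi]
      have hgc : Continuous fun θ => pol (ρ θ) θ :=
        (contDiff_pol (n := 0)).continuous.comp (continuous_id.prodMk hρc)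
      exact hgper.compact_of_continuous Real.two_pi_pos.ne' hgc
    obtain ⟨ε, hε, hthick⟩ := hcomp.exists_thickening_subset_open hU hΓU
    have hcε : 0 < c * ε := mul_pos hc hε
    refine ⟨V (c * ε), hVo _, hΓV _ hcε, ?_⟩
    rintro γ T hT hγ ⟨⟨r₀, θ₀⟩, ⟨hr₀, hw₀, hd₀⟩, h0⟩ t ht
    obtain ⟨r, θ, hθ0, h⟩ := hA.flow hf hτ₀ hang hρ' hT hγ h0.symm hr₀ hw₀
    obtain ⟨h1, -, h3, -, h5⟩ := h t ht
    refine hthick (Metric.mem_thickening_iff.2 ⟨pol (ρ (θ t)) (θ t), ⟨θ t, rfl⟩, ?_⟩)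
    rw [h3]
    refine (dist_pol_le _ _ _).trans_lt ?_
    have h6 : Real.exp (-(2 * κ * τ₀) * t) ≤ 1 := by
      refine Real.exp_le_one_iff.2 ?_
      have : 0 ≤ 2 * κ * τ₀ * t := mul_nonneg (by positivity) ht.1
      linarith
    have h7 := sq_le_sq.1 (h5.trans (mul_le_of_le_one_right (sq_nonneg _) h6))
    have h8 := hA.radius_dist_le (θ t) (Ioo_subset_Icc_self h1)
      (Ioo_subset_Icc_self (hρ (θ t)).1)
    exact lt_of_mul_lt_mul_left ((h8.trans h7).trans_lt hd₀) hc.le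
  · rintro _ ⟨⟨r₀, θ₀⟩, ⟨hr₀, hw₀, hd₀⟩, rfl⟩
    obtain ⟨γ, hγ, h0⟩ := exists_solution_Ici hf (p := pol r₀ θ₀) (R := r₂) (hnorm r₀ hr₀ θ₀)
      fun γ T hT hγ h0 t ht => by
        obtain ⟨r, θ, -, h⟩ := hA.flow hf hτ₀ hang hρ' hT hγ h0 hr₀ hw₀
        rw [(h t ht).2.2.1]
        exact hnorm _ (h t ht).1 _
    refine ⟨γ, hγ, h0, ?_⟩
    set D := (w (θ₀, r₀) - w (θ₀, ρ θ₀)) ^ 2 with hD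
    have hest : ∀ t, 0 ≤ t →
        Metric.infDist (γ t) Γ ≤ √(D * Real.exp (-(2 * κ * τ₀) * t)) / c := by
      intro t ht
      obtain ⟨r, θ, -, h⟩ := hA.flow hf hτ₀ hang hρ' ht (hγ.mono Icc_subset_Ici_self) h0 hr₀ hw₀
      obtain ⟨h1, -, h3, -, h5⟩ := h t (right_mem_Icc.2 ht)
      have h8 := hA.radius_dist_le (θ t) (Ioo_subset_Icc_self h1)
        (Ioo_subset_Icc_self (hρ (θ t)).1)
      refine (Metric.infDist_le_dist_of_mem (show pol (ρ (θ t)) (θ t) ∈ Γ from ⟨θ t, rfl⟩)).trans ?_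
      rw [h3]
      refine (dist_pol_le _ _ _).trans ?_
      rw [le_div_iff₀ hc, mul_comm]
      exact h8.trans (Real.abs_le_sqrt h5)
    have hlim : Tendsto (fun t => √(D * Real.exp (-(2 * κ * τ₀) * t)) / c) atTop (𝓝 0) := by
      have h1 : Tendsto (fun t : ℝ => -(2 * κ * τ₀) * t) atTop atBot :=
        tendsto_id.const_mul_atTop_of_neg (by
          have : 0 < 2 * κ * τ₀ := by positivity
          linarith)
      have h2 := ((Real.tendsto_exp_atBot.comp h1).const_mul D).sqrt.div_const c
      simpa using h2
    refine squeeze_zero' (Eventually.of_forall fun _ => Metric.infDist_nonneg) ?_ hlim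
    filter_upwards [eventually_ge_atTop 0] with t ht using hest t ht

/-- A contracting annulus contains an asymptotically stable periodic orbit. -/
theorem exists_stable_orbit (hA : IsContractingAnnulus f w H r₁ r₂ M₁ m₁ m₂ M₂ κ c)
    (hf : ContDiff ℝ 1 f) :
    ∃ Γ ⊆ Metric.closedBall (0 : ℝ × ℝ) r₂, IsPeriodicOrbit f Γ ∧ AsymptoticallyStable f Γ := by
  obtain ⟨ρ, hper, hρ⟩ := hA.exists_periodic_radius hf
  refine ⟨range fun θ => pol (ρ θ) θ, ?_, hA.isPeriodicOrbit_graph hf hper hρ,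
    hA.asymptoticallyStable_graph hf hper hρ⟩
  rintro _ ⟨θ, rfl⟩
  rw [mem_closedBall_zero_iff]
  exact (norm_pol_le (hA.r₁_pos.trans (hρ θ).1.1).le).trans (hρ θ).1.2.le

end IsContractingAnnulus

end AnnulusOrbit

/-! ### Averaging of the polar equation near a weak focus -/

section PolarNormalForm

/-- The normal form of a planar field in polar coordinates, near a weak focus with linear part
`σ ± iω` and first Lyapunov coefficient `ℓ`. The functions `A₂`, `A₃` are the corrections that
average out the dependence on the angle, and `M` bounds all the data. -/
structure PolarNormalForm (f : ℝ × ℝ → ℝ × ℝ) (σ ω ℓ : ℝ) (C₃ D₃ C₄ A₂ A₃ : ℝ → ℝ)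
    (e₁ D₄ : ℝ → ℝ → ℝ) (M : ℝ) : Prop where
  radial : ∀ r ∈ Ioc (0 : ℝ) 1, ∀ θ,
    radialPart f r θ = σ * r + r ^ 2 * C₃ θ + r ^ 3 * C₄ θ + r ^ 4 * e₁ θ r
  angular : ∀ r ∈ Ioc (0 : ℝ) 1, ∀ θ, angularPart f r θ = ω + r * D₃ θ + r ^ 2 * D₄ θ r
  deriv_A₂ : ∀ θ, HasDerivAt A₂ (C₃ θ / ω) θ
  deriv_A₃ : ∀ θ, HasDerivAt A₃ (C₄ θ / ω - C₃ θ * D₃ θ / ω ^ 2 - ℓ / ω) θ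
  periodic_A₂ : ∀ θ, A₂ (θ + 2 * Real.pi) = A₂ θ
  periodic_A₃ : ∀ θ, A₃ (θ + 2 * Real.pi) = A₃ θ
  bound_C₃ : ∀ θ, |C₃ θ| ≤ M
  bound_D₃ : ∀ θ, |D₃ θ| ≤ M
  bound_C₄ : ∀ θ, |C₄ θ| ≤ M
  bound_A₂ : ∀ θ, |A₂ θ| ≤ M
  bound_A₃ : ∀ θ, |A₃ θ| ≤ M
  bound_e₁ : ∀ r ∈ Ioc (0 : ℝ) 1, ∀ θ, |e₁ θ r| ≤ M
  bound_D₄ : ∀ r ∈ Ioc (0 : ℝ) 1, ∀ θ, |D₄ θ r| ≤ M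
  lip_e₁ : ∀ r ∈ Ioc (0 : ℝ) 1, ∀ s ∈ Ioc (0 : ℝ) 1, ∀ θ, |e₁ θ r - e₁ θ s| ≤ M * |r - s|
  lip_D₄ : ∀ r ∈ Ioc (0 : ℝ) 1, ∀ s ∈ Ioc (0 : ℝ) 1, ∀ θ, |D₄ θ r - D₄ θ s| ≤ M * |r - s|

/-- The function that measures the distance between orbits in the annulus. -/
noncomputable def annulusHeight (δ : ℝ) (A₂ A₃ : ℝ → ℝ) (q : ℝ × ℝ) : ℝ :=
  (δ / q.2 + δ * A₂ q.1) ^ 2 / 2 + δ ^ 2 * A₃ q.1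

/-- Angular velocity in the scaled coordinate `x = δ / r`. -/
noncomputable def scaledAngular (δ x ω D₃ D₄ : ℝ) : ℝ := ω + δ * (D₃ / x + δ * D₄ / x ^ 2)

/-- The remainder terms of the averaged equation, before multiplication by the height. -/
noncomputable def innerRemainder (δ x ω C₃ D₃ C₄ D₄ e₁ : ℝ) : ℝ :=
  -((D₃ / x + δ * D₄ / x ^ 2) * (-x + (C₃ * D₃ / ω - C₄) / x)) / (ω * scaledAngular δ x ω D₃ D₄)
    + (C₃ * D₄ / ω - e₁) / (x ^ 2 * scaledAngular δ x ω D₃ D₄)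

/-- The remainder of the averaged equation. -/
noncomputable def averagedRemainder (δ x ω C₃ D₃ C₄ A₂ D₄ e₁ : ℝ) : ℝ :=
  A₂ * ((-x + (C₃ * D₃ / ω - C₄) / x) / ω + δ * innerRemainder δ x ω C₃ D₃ C₄ D₄ e₁)
    + x * innerRemainder δ x ω C₃ D₃ C₄ D₄ e₁

/-- Here `x = δ / r`. The shift `δ A₂` cancels the term `-δ C₃ / ω` of `dx/dθ`, and `δ² A₃` replaces
the oscillating part of order two by its mean `ℓ / ω`. The identity is exact: everything of higher
order is collected in `averagedRemainder`. -/
theorem averaged_identity {δ x ω ℓ C₃ D₃ C₄ A₂ D₄ e₁ : ℝ} (hδ : δ ≠ 0) (hx : x ≠ 0) (hω : ω ≠ 0)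
    (hN : scaledAngular δ x ω D₃ D₄ ≠ 0) :
    (x + δ * A₂) * (-(δ * ((δ ^ 2 * (δ / x) + (δ / x) ^ 2 * C₃ + (δ / x) ^ 3 * C₄
        + (δ / x) ^ 4 * e₁) / (ω + (δ / x) * D₃ + (δ / x) ^ 2 * D₄))) / (δ / x) ^ 2 + δ * (C₃ / ω))
      + δ ^ 2 * (C₄ / ω - C₃ * D₃ / ω ^ 2 - ℓ / ω)
    = δ ^ 2 * (-(x ^ 2 + ℓ) / ω + δ * averagedRemainder δ x ω C₃ D₃ C₄ A₂ D₄ e₁) := by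
  -- Opaque names for the recurring combinations keep the rational identities small: `ω + δ m` is
  -- the angular velocity, `B` and `g` give the numerator of `dx/dθ` after the shift.
  obtain ⟨m, hm⟩ : ∃ m, m = D₃ / x + δ * D₄ / x ^ 2 := ⟨_, rfl⟩
  obtain ⟨B, hB⟩ : ∃ B, B = -x + (C₃ * D₃ / ω - C₄) / x := ⟨_, rfl⟩
  obtain ⟨g, hg⟩ : ∃ g, g = C₃ * D₄ / ω - e₁ := ⟨_, rfl⟩
  have hNm : scaledAngular δ x ω D₃ D₄ = ω + δ * m := by rw [scaledAngular, hm]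
  have hN2 : ω + (δ / x) * D₃ + (δ / x) ^ 2 * D₄ = ω + δ * m := by
    rw [hm]; field_simp; ring
  rw [hNm] at hN
  have hK : B / ω + δ * innerRemainder δ x ω C₃ D₃ C₄ D₄ e₁
      = (B + δ * g / x ^ 2) / (ω + δ * m) := by
    unfold innerRemainder
    rw [hNm, ← hm, ← hB, ← hg]
    field_simp
    ring
  have hP : -(δ * ((δ ^ 2 * (δ / x) + (δ / x) ^ 2 * C₃ + (δ / x) ^ 3 * C₄
        + (δ / x) ^ 4 * e₁) / (ω + δ * m))) / (δ / x) ^ 2 + δ * (C₃ / ω)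
      = δ ^ 2 * ((B + δ * g / x ^ 2) / (ω + δ * m)) := by
    have h1 : (ω + δ * m) * (δ * (C₃ / ω)) = δ * C₃ + δ ^ 2 * m * C₃ / ω := by
      field_simp
    have h2 : δ * (C₃ / ω) = (δ * C₃ + δ ^ 2 * m * C₃ / ω) / (ω + δ * m) := by
      rw [← h1]; field_simp
    rw [h2, hB, hg, hm]
    rw [hm] at hN
    field_simp
    ring
  have hxB : x * (B / ω) + (C₄ / ω - C₃ * D₃ / ω ^ 2 - ℓ / ω) = -(x ^ 2 + ℓ) / ω := by
    rw [hB]; field_simp; ring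
  rw [hN2, hP, ← hK, averagedRemainder, ← hB, ← hxB]
  ring

theorem scaledAngular_lower_bound {M ω₀ x₁ : ℝ} (hM : 0 < M) (hω₀ : 0 < ω₀) (hx₁ : 0 < x₁) :
    ∃ δ₀ > 0, δ₀ ≤ 1 ∧ ∀ δ ∈ Icc 0 δ₀, ∀ x, x₁ ≤ x → ∀ ω, ω₀ ≤ ω → ∀ D₃ D₄ : ℝ, |D₃| ≤ M →
      |D₄| ≤ M → ω₀ / 2 ≤ scaledAngular δ x ω D₃ D₄ := by
  set B : ℝ := M / x₁ + M / x₁ ^ 2 with hB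
  have hB0 : 0 < B := by positivity
  refine ⟨min 1 (ω₀ / (2 * B)), lt_min one_pos (by positivity), min_le_left _ _, ?_⟩
  intro δ hδ x hx ω hω D₃ D₄ h3 h4
  have hδ1 : δ ≤ 1 := hδ.2.trans (min_le_left _ _)
  have hδ2 : δ * B ≤ ω₀ / 2 := by
    have := mul_le_mul_of_nonneg_right (hδ.2.trans (min_le_right _ _)) hB0.le
    refine this.trans (le_of_eq ?_)
    field_simp
  have hxp : 0 < x := hx₁.trans_le hx
  have h5 : |D₃ / x + δ * D₄ / x ^ 2| ≤ B := by
    refine (abs_add_le _ _).trans ?_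
    rw [abs_div, abs_div, abs_mul, abs_of_pos hxp, abs_of_pos (pow_pos hxp 2), abs_of_nonneg hδ.1]
    have h6 : |D₃| / x ≤ M / x₁ := by gcongr
    have h7 : δ * |D₄| / x ^ 2 ≤ M / x₁ ^ 2 := by
      have : δ * |D₄| ≤ 1 * M := mul_le_mul hδ1 h4 (abs_nonneg _) zero_le_one
      rw [one_mul] at this
      gcongr
    linarith
  have h8 : -(δ * B) ≤ δ * (D₃ / x + δ * D₄ / x ^ 2) := by
    have := mul_le_mul_of_nonneg_left (neg_le_of_abs_le h5) hδ.1
    linarith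
  unfold scaledAngular
  linarith

/-- The remainder is rational with denominators bounded away from 0 on a compact box of parameters
that includes `δ = 0`. Being `C¹` there, it is bounded and Lipschitz with constants that depend on
the bounds of the data only. -/
theorem averagedRemainder_lipschitz {M ω₀ x₁ x₂ : ℝ} (hM : 0 < M) (hω₀ : 0 < ω₀) (hx₁ : 0 < x₁) :
    ∃ δ₀ > 0, δ₀ ≤ 1 ∧ ∃ L > 0, ∀ δ ∈ Icc 0 δ₀, ∀ ω ∈ Icc ω₀ M, ∀ C₃ D₃ C₄ A₂ : ℝ, |C₃| ≤ M →
      |D₃| ≤ M → |C₄| ≤ M → |A₂| ≤ M → ∀ x ∈ Icc x₁ x₂, ∀ D₄ e₁ : ℝ, |D₄| ≤ M → |e₁| ≤ M →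
      ω₀ / 2 ≤ scaledAngular δ x ω D₃ D₄ ∧ |averagedRemainder δ x ω C₃ D₃ C₄ A₂ D₄ e₁| ≤ L ∧
      ∀ x' ∈ Icc x₁ x₂, ∀ D₄' e₁' : ℝ, |D₄'| ≤ M → |e₁'| ≤ M →
        |averagedRemainder δ x ω C₃ D₃ C₄ A₂ D₄ e₁ - averagedRemainder δ x' ω C₃ D₃ C₄ A₂ D₄' e₁'|
          ≤ L * (|x - x'| + |D₄ - D₄'| + |e₁ - e₁'|) := by
  obtain ⟨δ₀, hδ₀, hδ₁, hlow⟩ := scaledAngular_lower_bound hM hω₀ hx₁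
  let F : ℝ × ℝ × ℝ × ℝ × ℝ × ℝ × ℝ × ℝ × ℝ → ℝ := fun p =>
    averagedRemainder p.1 p.2.1 p.2.2.1 p.2.2.2.1 p.2.2.2.2.1 p.2.2.2.2.2.1 p.2.2.2.2.2.2.1
      p.2.2.2.2.2.2.2.1 p.2.2.2.2.2.2.2.2
  set S : Set (ℝ × ℝ × ℝ × ℝ × ℝ × ℝ × ℝ × ℝ × ℝ) := Icc 0 δ₀ ×ˢ Icc x₁ x₂ ×ˢ Icc ω₀ M ×ˢ
    Icc (-M) M ×ˢ Icc (-M) M ×ˢ Icc (-M) M ×ˢ Icc (-M) M ×ˢ Icc (-M) M ×ˢ Icc (-M) M with hS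
  have hcomp : IsCompact S := isCompact_Icc.prod (isCompact_Icc.prod (isCompact_Icc.prod
    (isCompact_Icc.prod (isCompact_Icc.prod (isCompact_Icc.prod (isCompact_Icc.prod
    (isCompact_Icc.prod isCompact_Icc)))))))
  have hcd : ∀ p ∈ S, ContDiffAt ℝ 1 F p := by
    rintro ⟨δ, x, ω, C₃, D₃, C₄, A₂, D₄, e₁⟩ ⟨h1, h2, h3, h4, h5, h6, h7, h8, h9⟩
    simp only at h1 h2 h3 h4 h5 h6 h7 h8 h9
    have hx : x ≠ 0 := (hx₁.trans_le h2.1).ne'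
    have hω : ω ≠ 0 := (hω₀.trans_le h3.1).ne'
    have hN : ω + δ * (D₃ / x + δ * D₄ / x ^ 2) ≠ 0 := by
      have := hlow δ h1 x h2.1 ω h3.1 D₃ D₄ (abs_le.2 h5) (abs_le.2 h8)
      unfold scaledAngular at this
      exact (by linarith : 0 < ω + δ * (D₃ / x + δ * D₄ / x ^ 2)).ne'
    simp only [F, averagedRemainder, innerRemainder, scaledAngular]
    fun_prop (disch := simp [hx, hω, hN])
  obtain ⟨K, hK⟩ := LocallyLipschitzOn.exists_lipschitzOnWith_of_compact hcomp
    (f := F) fun p hp => by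
      obtain ⟨K, t, ht, h⟩ := (hcd p hp).exists_lipschitzOnWith
      exact ⟨K, t, mem_nhdsWithin_of_mem_nhds ht, h⟩
  obtain ⟨B, hB⟩ := hcomp.exists_bound_of_continuousOn
    (f := F) fun p hp => (hcd p hp).continuousAt.continuousWithinAt
  refine ⟨δ₀, hδ₀, hδ₁, max 1 (max K B), lt_max_of_lt_left one_pos, ?_⟩
  intro δ hδ ω hω C₃ D₃ C₄ A₂ hC₃ hD₃ hC₄ hA₂ x hx D₄ e₁ hD₄ he₁
  have hp : (δ, x, ω, C₃, D₃, C₄, A₂, D₄, e₁) ∈ S :=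
    ⟨hδ, hx, hω, abs_le.1 hC₃, abs_le.1 hD₃, abs_le.1 hC₄, abs_le.1 hA₂, abs_le.1 hD₄, abs_le.1 he₁⟩
  refine ⟨hlow δ hδ x hx.1 ω hω.1 D₃ D₄ hD₃ hD₄, ?_, ?_⟩
  · exact (hB _ hp).trans ((le_max_right _ _).trans (le_max_right _ _))
  · intro x' hx' D₄' e₁' hD₄' he₁'
    have hp' : (δ, x', ω, C₃, D₃, C₄, A₂, D₄', e₁') ∈ S :=
      ⟨hδ, hx', hω, abs_le.1 hC₃, abs_le.1 hD₃, abs_le.1 hC₄, abs_le.1 hA₂, abs_le.1 hD₄',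
        abs_le.1 he₁'⟩
    have h1 := hK.dist_le_mul _ hp _ hp'
    rw [Real.dist_eq] at h1
    refine h1.trans ?_
    refine mul_le_mul ((le_max_left _ _).trans (le_max_right _ _)) ?_ dist_nonneg
      (zero_le_one.trans (le_max_left _ _))
    have n1 := abs_nonneg (x - x')
    have n2 := abs_nonneg (D₄ - D₄')
    have n3 := abs_nonneg (e₁ - e₁')
    simp only [Prod.dist_eq, dist_self, Real.dist_eq]
    refine max_le (by positivity) (max_le (by linarith) ?_)
    refine max_le (by positivity) (max_le (by positivity) (max_le (by positivity)
      (max_le (by positivity) (max_le (by positivity) (max_le (by linarith) (by linarith))))))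

end PolarNormalForm

/-! ### The contracting annulus of the averaged equation -/

section PolarNormalForm

/-- The averaged equation: the derivative of `annulusHeight` with respect to the angle. -/
noncomputable def averagedRate (δ ω ℓ : ℝ) (C₃ D₃ C₄ A₂ : ℝ → ℝ) (e₁ D₄ : ℝ → ℝ → ℝ) (q : ℝ × ℝ) :
    ℝ :=
  -((δ / q.2) ^ 2 + ℓ) / ω + δ * averagedRemainder δ (δ / q.2) ω (C₃ q.1) (D₃ q.1) (C₄ q.1)
    (A₂ q.1) (D₄ q.1 q.2) (e₁ q.1 q.2)

variable {f : ℝ × ℝ → ℝ × ℝ} {δ ω ℓ M : ℝ} {C₃ D₃ C₄ A₂ A₃ : ℝ → ℝ} {e₁ D₄ : ℝ → ℝ → ℝ}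

namespace PolarNormalForm

theorem hasFDerivAt_annulusHeight {σ : ℝ} (hP : PolarNormalForm f σ ω ℓ C₃ D₃ C₄ A₂ A₃ e₁ D₄ M)
    {θ r : ℝ} (hr : 0 < r) :
    HasFDerivAt (annulusHeight δ A₂ A₃)
      (((δ / r + δ * A₂ θ) * (δ * (C₃ θ / ω))
          + δ ^ 2 * (C₄ θ / ω - C₃ θ * D₃ θ / ω ^ 2 - ℓ / ω)) • ContinuousLinearMap.fst ℝ ℝ ℝ
        + ((δ / r + δ * A₂ θ) * (-δ / r ^ 2)) • ContinuousLinearMap.snd ℝ ℝ ℝ) (θ, r) := by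
  have h1 : HasFDerivAt (fun q : ℝ × ℝ => A₂ q.1) ((C₃ θ / ω) • ContinuousLinearMap.fst ℝ ℝ ℝ)
      (θ, r) := by
    have := (hP.deriv_A₂ θ).hasFDerivAt.comp (θ, r) (hasFDerivAt_fst (𝕜 := ℝ) (p := ((θ, r) : ℝ × ℝ)))
    refine this.congr_fderiv ?_
    ext <;> simp
  have h2 : HasFDerivAt (fun q : ℝ × ℝ => A₃ q.1)
      ((C₄ θ / ω - C₃ θ * D₃ θ / ω ^ 2 - ℓ / ω) • ContinuousLinearMap.fst ℝ ℝ ℝ) (θ, r) := by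
    have := (hP.deriv_A₃ θ).hasFDerivAt.comp (θ, r) (hasFDerivAt_fst (𝕜 := ℝ) (p := ((θ, r) : ℝ × ℝ)))
    refine this.congr_fderiv ?_
    ext <;> simp
  have h3 : HasFDerivAt (fun q : ℝ × ℝ => δ / q.2) ((-δ / r ^ 2) • ContinuousLinearMap.snd ℝ ℝ ℝ)
      (θ, r) := by
    have h0 : HasDerivAt (fun r => δ / r) (-δ / r ^ 2) r := by
      have := (hasDerivAt_inv hr.ne').const_mul δ
      refine (this.congr_deriv ?_).congr_of_eventuallyEq ?_
      · field_simp
      · exact Eventually.of_forall fun r => div_eq_mul_inv _ _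
    have := h0.hasFDerivAt.comp (θ, r) (hasFDerivAt_snd (𝕜 := ℝ) (p := ((θ, r) : ℝ × ℝ)))
    refine this.congr_fderiv ?_
    ext <;> simp
  have h4 := (((h3.add (h1.const_mul δ)).pow 2).const_mul (1 / 2)).add (h2.const_mul (δ ^ 2))
  refine (h4.congr_fderiv ?_).congr_of_eventuallyEq (Eventually.of_forall fun q => ?_)
  · ext <;> simp <;> ring
  · simp only [annulusHeight, Pi.add_apply]; ring

/-- `averaged_identity` at `x = δ / r`, with the normal form supplying the slope of the orbits and
the derivatives of `A₂` and `A₃`. -/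
theorem fderiv_annulusHeight (hP : PolarNormalForm f (δ ^ 2) ω ℓ C₃ D₃ C₄ A₂ A₃ e₁ D₄ M)
    (hδ : 0 < δ) (hω : 0 < ω) {θ r : ℝ} (hr : r ∈ Ioc (0 : ℝ) 1)
    (hN : 0 < scaledAngular δ (δ / r) ω (D₃ θ) (D₄ θ r)) :
    fderiv ℝ (annulusHeight δ A₂ A₃) (θ, r) (1, polarSlope f r θ)
      = δ ^ 2 * averagedRate δ ω ℓ C₃ D₃ C₄ A₂ e₁ D₄ (θ, r) := by
  rw [(hP.hasFDerivAt_annulusHeight hr.1).fderiv, averagedRate,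
    ← averaged_identity hδ.ne' (div_pos hδ hr.1).ne' hω.ne' hN.ne', polarSlope, hP.radial r hr,
    hP.angular r hr]
  simp only [add_apply, smul_apply, ContinuousLinearMap.coe_fst', ContinuousLinearMap.coe_snd',
    smul_eq_mul, mul_one]
  rw [div_div_cancel₀ hδ.ne']
  ring

theorem angular_eq {σ : ℝ} (hP : PolarNormalForm f σ ω ℓ C₃ D₃ C₄ A₂ A₃ e₁ D₄ M)
    (hδ : 0 < δ) {θ r : ℝ} (hr : r ∈ Ioc (0 : ℝ) 1) :
    angularPart f r θ = scaledAngular δ (δ / r) ω (D₃ θ) (D₄ θ r) := by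
  have := hr.1.ne'
  rw [hP.angular r hr, scaledAngular]
  field_simp
  ring

/-- Near a weak focus with negative first Lyapunov coefficient that has just become unstable, there
is a contracting annulus, of radius `O(√σ)`, with `σ = δ²`; all constants are uniform. -/
theorem exists_contractingAnnulus {M ω₀ ℓ₀ : ℝ} (hM : 0 < M) (hω₀ : 0 < ω₀) (hℓ₀ : 0 < ℓ₀) :
    ∃ δ₀ > 0, ∃ X > 0, ∀ δ ∈ Ioo 0 δ₀, ∀ (f : ℝ × ℝ → ℝ × ℝ) (ω ℓ : ℝ) (C₃ D₃ C₄ A₂ A₃ : ℝ → ℝ)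
      (e₁ D₄ : ℝ → ℝ → ℝ), ω ∈ Icc ω₀ M → ℓ ∈ Icc (-M) (-ℓ₀) →
      PolarNormalForm f (δ ^ 2) ω ℓ C₃ D₃ C₄ A₂ A₃ e₁ D₄ M →
      ∃ (w H : ℝ × ℝ → ℝ) (r₁ M₁ m₁ m₂ M₂ κ c : ℝ),
        IsContractingAnnulus f w H r₁ (X * δ) M₁ m₁ m₂ M₂ κ c := by
  -- The averaged equation rests at `x² = -ℓ`, which lies in `[ℓ₀, M]`. The interval from `x₁² = ℓ₀
  -- / 4` to `x₂² = 4M` leaves room on both sides.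
  obtain ⟨x₁, hx₁, hx₁sq⟩ : ∃ x > 0, x ^ 2 = ℓ₀ / 4 :=
    ⟨√(ℓ₀ / 4), Real.sqrt_pos.2 (by positivity), Real.sq_sqrt (by positivity)⟩
  obtain ⟨x₂, hx₂, hx₂sq⟩ : ∃ x > 0, x ^ 2 = 4 * M :=
    ⟨√(4 * M), Real.sqrt_pos.2 (by positivity), Real.sq_sqrt (by positivity)⟩
  obtain ⟨δ₁, hδ₁, hδ₁', L, hL, hQ⟩ := averagedRemainder_lipschitz (x₂ := x₂) hM hω₀ hx₁
  set L' : ℝ := L * (1 + 2 * (M / x₁ ^ 2)) with hL'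
  have hL'0 : 0 < L' := by positivity
  set W₀ : ℝ := x₂ * M + M ^ 2 / 2 + M with hW₀
  have hW₀0 : 0 < W₀ := by positivity
  have hsmall : ∀ B > (0 : ℝ), ∀ η > (0 : ℝ), ∃ δ₀ > (0 : ℝ), ∀ δ ∈ Ioo 0 δ₀, δ * B ≤ η := fun B hB η hη =>
    ⟨η / B, by positivity, fun δ hδ => ((lt_div_iff₀ hB).1 hδ.2).le⟩
  -- Five smallness conditions: radii stay at most 1; the height is within `ℓ₀ / 64` of `x² / 2`;
  -- the remainder, times `ω`, is at most `ℓ₀ / 64`; its Lipschitz constant costs at most half of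
  -- the contraction; the shift `δ A₂` is at most `x₁ / 2`.
  obtain ⟨d₁, hd₁, h₁⟩ := hsmall 1 one_pos x₁ hx₁
  obtain ⟨d₂, hd₂, h₂⟩ := hsmall W₀ hW₀0 (ℓ₀ / 64) (by positivity)
  obtain ⟨d₃, hd₃, h₃⟩ := hsmall (M * L) (by positivity) (ℓ₀ / 64) (by positivity)
  obtain ⟨d₄, hd₄, h₄⟩ := hsmall (M * L') (by positivity) x₁ hx₁
  obtain ⟨d₅, hd₅, h₅⟩ := hsmall M hM (x₁ / 2) (by positivity)
  refine ⟨min δ₁ (min d₁ (min d₂ (min d₃ (min d₄ d₅)))), by positivity, 1 / x₁, by positivity, ?_⟩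
  intro δ hδ f ω ℓ C₃ D₃ C₄ A₂ A₃ e₁ D₄ hω hℓ hP
  obtain ⟨hδ0, hδlt⟩ := hδ
  simp only [lt_min_iff] at hδlt
  obtain ⟨k₀, k₁, k₂, k₃, k₄, k₅⟩ := hδlt
  have g₁ := h₁ δ ⟨hδ0, k₁⟩
  have g₂ := h₂ δ ⟨hδ0, k₂⟩
  have g₃ := h₃ δ ⟨hδ0, k₃⟩
  have g₄ := h₄ δ ⟨hδ0, k₄⟩
  have g₅ := h₅ δ ⟨hδ0, k₅⟩
  have hδ1 : δ ≤ 1 := k₀.le.trans hδ₁'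
  have hωp : 0 < ω := hω₀.trans_le hω.1
  have hℓM : ℓ₀ ≤ M := by linarith [hℓ.1, hℓ.2]
  have hx12 : x₁ < x₂ := lt_of_pow_lt_pow_left₀ 2 hx₂.le (by rw [hx₁sq, hx₂sq]; linarith)
  have hXδ : 1 / x₁ * δ = δ / x₁ := by ring
  rw [hXδ]
  have hx : ∀ r ∈ Icc (δ / x₂) (δ / x₁), δ / r ∈ Icc x₁ x₂ ∧ r ∈ Ioc (0 : ℝ) 1 := by
    intro r hr
    have hr0 : 0 < r := (div_pos hδ0 hx₂).trans_le hr.1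
    refine ⟨⟨?_, ?_⟩, hr0, hr.2.trans ((div_le_one hx₁).2 (by linarith))⟩
    · rw [le_div_iff₀ hr0]
      have := (le_div_iff₀ hx₁).1 hr.2
      linarith
    · rw [div_le_iff₀ hr0]
      have := (div_le_iff₀ hx₂).1 hr.1
      linarith
  have hrem : ∀ θ, ∀ r ∈ Icc (δ / x₂) (δ / x₁), _ := fun θ r hr =>
    hQ δ ⟨hδ0.le, k₀.le⟩ ω hω (C₃ θ) (D₃ θ) (C₄ θ) (A₂ θ) (hP.bound_C₃ θ) (hP.bound_D₃ θ)
      (hP.bound_C₄ θ) (hP.bound_A₂ θ) (δ / r) (hx r hr).1 (D₄ θ r) (e₁ θ r)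
      (hP.bound_D₄ r (hx r hr).2 θ) (hP.bound_e₁ r (hx r hr).2 θ)
  have hNpos : ∀ θ, ∀ r ∈ Icc (δ / x₂) (δ / x₁),
      0 < scaledAngular δ (δ / r) ω (D₃ θ) (D₄ θ r) := fun θ r hr =>
    (half_pos hω₀).trans_le (hrem θ r hr).1
  have hheight : ∀ θ, ∀ x ∈ Icc x₁ x₂,
      |(x + δ * A₂ θ) ^ 2 / 2 + δ ^ 2 * A₃ θ - x ^ 2 / 2| ≤ ℓ₀ / 64 := by
    intro θ x hx
    have e1 : (x + δ * A₂ θ) ^ 2 / 2 + δ ^ 2 * A₃ θ - x ^ 2 / 2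
        = δ * (x * A₂ θ + δ * A₂ θ ^ 2 / 2 + δ * A₃ θ) := by ring
    have hxp : 0 ≤ x := hx₁.le.trans hx.1
    rw [e1, abs_mul, abs_of_pos hδ0]
    refine le_trans (mul_le_mul_of_nonneg_left ?_ hδ0.le) g₂
    refine (abs_add_le _ _).trans (add_le_add ((abs_add_le _ _).trans (add_le_add ?_ ?_)) ?_)
    · rw [abs_mul, abs_of_nonneg hxp]
      exact mul_le_mul hx.2 (hP.bound_A₂ θ) (abs_nonneg _) hx₂.le
    · rw [abs_div, abs_mul, abs_of_pos hδ0, abs_two, abs_pow]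
      have : δ * |A₂ θ| ^ 2 ≤ 1 * M ^ 2 := by
        have := hP.bound_A₂ θ
        gcongr
      linarith
    · rw [abs_mul, abs_of_pos hδ0]
      have : δ * |A₃ θ| ≤ 1 * M := mul_le_mul hδ1 (hP.bound_A₃ θ) (abs_nonneg _) zero_le_one
      linarith
  have hdiff : ∀ a b θ, annulusHeight δ A₂ A₃ (θ, a) - annulusHeight δ A₂ A₃ (θ, b)
      = (δ / a - δ / b) * ((δ / a + δ / b) / 2 + δ * A₂ θ) := by
    intro a b θ
    simp only [annulusHeight]
    ring
  have hδA : ∀ θ, |δ * A₂ θ| ≤ x₁ / 2 := fun θ => by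
    rw [abs_mul, abs_of_pos hδ0]
    exact (mul_le_mul_of_nonneg_left (hP.bound_A₂ θ) hδ0.le).trans g₅
  have hscale : ∀ θ, ∀ r ∈ Icc (δ / x₂) (δ / x₁),
      |ω * (δ * averagedRemainder δ (δ / r) ω (C₃ θ) (D₃ θ) (C₄ θ) (A₂ θ) (D₄ θ r) (e₁ θ r))|
        ≤ ℓ₀ / 64 := by
    intro θ r hr
    rw [abs_mul, abs_mul, abs_of_pos hωp, abs_of_pos hδ0]
    have h1 := (hrem θ r hr).2.1
    calc ω * (δ * _) ≤ M * (δ * L) := by have := hω.2; gcongr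
      _ = δ * (M * L) := by ring
      _ ≤ ℓ₀ / 64 := g₃
  have hrate : ∀ θ r, ω * averagedRate δ ω ℓ C₃ D₃ C₄ A₂ e₁ D₄ (θ, r) = -((δ / r) ^ 2 + ℓ)
      + ω * (δ * averagedRemainder δ (δ / r) ω (C₃ θ) (D₃ θ) (C₄ θ) (A₂ θ) (D₄ θ r) (e₁ θ r)) := by
    intro θ r
    rw [averagedRate]
    field_simp
  have hr12 : δ / x₂ < δ / x₁ := div_lt_div_of_pos_left hδ0 hx₁ hx12
  -- Since `w ≈ x² / 2`, the circles `x = x₁` and `x = x₂` have heights near `ℓ₀ / 8` and `2M`. The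
  -- levels `3ℓ₀/16 < ℓ₀/4` and `M < 3M/2` lie strictly between them, and beyond `ℓ₀/4` and `M` the
  -- sign of `-(x² + ℓ)` is decided despite the errors.
  refine ⟨annulusHeight δ A₂ A₃, fun q => δ ^ 2 * averagedRate δ ω ℓ C₃ D₃ C₄ A₂ e₁ D₄ q,
    δ / x₂, 3 * ℓ₀ / 16, ℓ₀ / 4, M, 3 * M / 2, δ ^ 2 * (x₁ / M) / (x₂ + x₁ / 2),
    x₁ ^ 2 / δ * (x₁ / 2), ?_⟩
  refine
    { r₁_pos := by positivity
      r₁_lt := hr12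
      M₁_lt := by linarith
      m₁_lt := by linarith
      m₂_lt := by linarith
      κ_pos := by positivity
      c_pos := by positivity
      angular_pos := fun θ r hr => by
        rw [hP.angular_eq hδ0 (hx r hr).2]
        exact hNpos θ r hr
      periodic := fun θ r => by
        simp only [annulusHeight, hP.periodic_A₂, hP.periodic_A₃]
      differentiableAt := fun θ r hr => (hP.hasFDerivAt_annulusHeight hr).differentiableAt
      along := fun θ r hr => hP.fderiv_annulusHeight hδ0 hωp (hx r hr).2 (hNpos θ r hr)
      mono := ?_
      contr := ?_
      top := ?_
      bot := ?_
      inner := ?_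
      outer := ?_ }
  · intro θ a ha b hb hab
    rw [hdiff]
    obtain ⟨hxa, ha0⟩ := hx a ha
    obtain ⟨hxb, hb0⟩ := hx b hb
    have h1 : x₁ ^ 2 / δ * (b - a) ≤ δ / a - δ / b := by
      have e1 : δ / a - δ / b = (δ / a) * (δ / b) / δ * (b - a) := by
        have := ha0.1.ne'
        have := hb0.1.ne'
        field_simp
      rw [e1]
      have : x₁ ^ 2 ≤ (δ / a) * (δ / b) := by
        rw [sq]; exact mul_le_mul hxa.1 hxb.1 hx₁.le (hx₁.le.trans hxa.1)
      have := sub_nonneg.2 hab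
      gcongr
    have h2 : x₁ / 2 ≤ (δ / a + δ / b) / 2 + δ * A₂ θ := by
      linarith [neg_le_of_abs_le (hδA θ), hxa.1, hxb.1]
    have h3 : 0 ≤ x₁ ^ 2 / δ * (b - a) := mul_nonneg (by positivity) (sub_nonneg.2 hab)
    calc x₁ ^ 2 / δ * (x₁ / 2) * (b - a) = x₁ ^ 2 / δ * (b - a) * (x₁ / 2) := by ring
      _ ≤ _ := mul_le_mul h1 h2 (by positivity) (h3.trans h1)
  · intro θ a ha b hb hab
    rw [hdiff]
    obtain ⟨hxa, ha0⟩ := hx a ha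
    obtain ⟨hxb, hb0⟩ := hx b hb
    have hxab : 0 ≤ δ / a - δ / b := sub_nonneg.2 (div_le_div_of_nonneg_left hδ0.le ha0.1 hab)
    -- `e₁` and `D₄` are Lipschitz in `r`, while the estimate is wanted in `x = δ / r`. On the
    -- annulus `dr = -(r² / δ) dx` and `r² / δ ≤ δ / x₁²`, which `δ ≤ 1` simplifies.
    have hab' : |a - b| ≤ |δ / a - δ / b| / x₁ ^ 2 := by
      have e1 : δ * (a - b) = -((δ / a - δ / b) * (a * b)) := by
        have := ha0.1.ne'
        have := hb0.1.ne'
        field_simp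
        ring
      have e2 : a * b ≤ (δ / x₁) * (δ / x₁) := mul_le_mul ha.2 hb.2 hb0.1.le (by positivity)
      have e3 : δ * |a - b| = |δ / a - δ / b| * (a * b) := by
        rw [← abs_of_pos hδ0, ← abs_mul, abs_of_pos hδ0, e1, abs_neg, abs_mul,
          abs_of_pos (mul_pos ha0.1 hb0.1)]
      have e4 : δ * |a - b| ≤ δ * (|δ / a - δ / b| / x₁ ^ 2) := by
        rw [e3]
        refine (mul_le_mul_of_nonneg_left e2 (abs_nonneg _)).trans ?_
        have e5 : |δ / a - δ / b| * (δ / x₁ * (δ / x₁))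
            = δ * (δ * (|δ / a - δ / b| / x₁ ^ 2)) := by field_simp
        rw [e5]
        refine mul_le_of_le_one_left (by positivity) hδ1
      exact le_of_mul_le_mul_left e4 hδ0
    have hQab := (hrem θ a ha).2.2 (δ / b) hxb (D₄ θ b) (e₁ θ b) (hP.bound_D₄ b hb0 θ)
      (hP.bound_e₁ b hb0 θ)
    have l1 := hP.lip_D₄ a ha0 b hb0 θ
    have l2 := hP.lip_e₁ a ha0 b hb0 θ
    rw [abs_of_nonneg hxab] at hQab hab'
    have hQ2 : averagedRemainder δ (δ / a) ω (C₃ θ) (D₃ θ) (C₄ θ) (A₂ θ) (D₄ θ a) (e₁ θ a)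
        - averagedRemainder δ (δ / b) ω (C₃ θ) (D₃ θ) (C₄ θ) (A₂ θ) (D₄ θ b) (e₁ θ b)
        ≤ L' * (δ / a - δ / b) := by
      refine (le_abs_self _).trans (hQab.trans ?_)
      have l3 := mul_le_mul_of_nonneg_left hab' hM.le
      have e6 : L' * (δ / a - δ / b) = L * ((δ / a - δ / b) + 2 * (M * ((δ / a - δ / b) / x₁ ^ 2))) := by
        rw [hL']; field_simp
      rw [e6]
      exact mul_le_mul_of_nonneg_left (by linarith) hL.le
    -- The difference of squares contributes at least `2 x₁` times the gap in `x`; the remainder may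
    -- consume half of this.
    have h1 : ω * (averagedRate δ ω ℓ C₃ D₃ C₄ A₂ e₁ D₄ (θ, a)
        - averagedRate δ ω ℓ C₃ D₃ C₄ A₂ e₁ D₄ (θ, b)) ≤ -(x₁ * (δ / a - δ / b)) := by
      rw [mul_sub, hrate, hrate]
      have h2 : ω * (δ * (averagedRemainder δ (δ / a) ω (C₃ θ) (D₃ θ) (C₄ θ) (A₂ θ) (D₄ θ a) (e₁ θ a)
          - averagedRemainder δ (δ / b) ω (C₃ θ) (D₃ θ) (C₄ θ) (A₂ θ) (D₄ θ b) (e₁ θ b)))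
          ≤ x₁ * (δ / a - δ / b) := by
        calc _ ≤ ω * (δ * (L' * (δ / a - δ / b))) := by gcongr
          _ ≤ M * (δ * (L' * (δ / a - δ / b))) := by
            have := hω.2
            gcongr
          _ = δ * (M * L') * (δ / a - δ / b) := by ring
          _ ≤ x₁ * (δ / a - δ / b) := by gcongr
      have h3 : 2 * x₁ * (δ / a - δ / b) ≤ (δ / a + δ / b) * (δ / a - δ / b) := by
        have : 2 * x₁ ≤ δ / a + δ / b := by linarith [hxa.1, hxb.1]
        gcongr
      linarith
    have h4 : averagedRate δ ω ℓ C₃ D₃ C₄ A₂ e₁ D₄ (θ, a)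
        - averagedRate δ ω ℓ C₃ D₃ C₄ A₂ e₁ D₄ (θ, b) ≤ -(x₁ / M * (δ / a - δ / b)) := by
      have h5 : x₁ / M * (δ / a - δ / b) ≤ x₁ / ω * (δ / a - δ / b) := by
        have := hω.2
        gcongr
      refine le_trans ?_ (neg_le_neg h5)
      rw [div_mul_eq_mul_div, ← neg_div, le_div_iff₀ hωp]
      linarith
    have h6 : (δ / a + δ / b) / 2 + δ * A₂ θ ≤ x₂ + x₁ / 2 := by
      linarith [le_of_abs_le (hδA θ), hxa.2, hxb.2]
    have h7 := mul_le_mul_of_nonneg_left h6 (mul_nonneg (by positivity :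
      0 ≤ δ ^ 2 * (x₁ / M) / (x₂ + x₁ / 2)) hxab)
    have h8 : δ ^ 2 * (x₁ / M) / (x₂ + x₁ / 2) * (δ / a - δ / b) * (x₂ + x₁ / 2)
        = δ ^ 2 * (x₁ / M * (δ / a - δ / b)) := by
      have : x₂ + x₁ / 2 ≠ 0 := by positivity
      field_simp
    have h9 := mul_le_mul_of_nonneg_left h4 (sq_nonneg δ)
    linarith
  · intro θ r hr hw
    obtain ⟨hxr, -⟩ := hx r hr
    have h1 := (abs_le.1 (hheight θ (δ / r) hxr)).2
    simp only [annulusHeight] at hw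
    have h2 := (abs_le.1 (hscale θ r hr)).2
    have h3 := hrate θ r
    have h4 : ω * averagedRate δ ω ℓ C₃ D₃ C₄ A₂ e₁ D₄ (θ, r) < 0 := by
      rw [h3]; linarith [hℓ.1]
    exact mul_neg_of_pos_of_neg (by positivity) (neg_of_mul_neg_right h4 hωp.le)
  · intro θ r hr hw
    obtain ⟨hxr, -⟩ := hx r hr
    have h1 := (abs_le.1 (hheight θ (δ / r) hxr)).1
    simp only [annulusHeight] at hw
    have h2 := (abs_le.1 (hscale θ r hr)).1
    have h3 := hrate θ r
    have h4 : 0 < ω * averagedRate δ ω ℓ C₃ D₃ C₄ A₂ e₁ D₄ (θ, r) := by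
      rw [h3]; linarith [hℓ.2]
    exact mul_pos (by positivity) (pos_of_mul_pos_right h4 hωp.le)
  · intro θ
    have h1 := (abs_le.1 (hheight θ x₂ ⟨hx12.le, le_rfl⟩)).1
    simp only [annulusHeight, div_div_cancel₀ hδ0.ne']
    rw [hx₂sq] at h1
    linarith
  · intro θ
    have h1 := (abs_le.1 (hheight θ x₁ ⟨le_rfl, hx12.le⟩)).2
    simp only [annulusHeight, div_div_cancel₀ hδ0.ne']
    rw [hx₁sq] at h1
    linarith

end PolarNormalForm

end PolarNormalForm

/-! ### Cubic normal form with nonlinearity affine in the second variable -/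

section CubicField

/-- A planar field with linear part `!![σ, -ω; ω, σ]`, affine in the second variable `v` in its
nonlinear part. The coefficients of `u², uv, u³, u²v` are `k 0, …, k 3` in the first component and
`k 4, …, k 7` in the second one; the remainder is of order four. -/
def cubicField (σ ω : ℝ) (k : Fin 8 → ℝ) (a : Fin 4 → ℝ → ℝ) (p : ℝ × ℝ) : ℝ × ℝ :=
  (σ * p.1 - ω * p.2 + k 0 * p.1 ^ 2 + k 1 * p.1 * p.2 + k 2 * p.1 ^ 3 + k 3 * p.1 ^ 2 * p.2
      + p.1 ^ 3 * (p.1 * a 0 p.1 + p.2 * a 1 p.1),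
    ω * p.1 + σ * p.2 + k 4 * p.1 ^ 2 + k 5 * p.1 * p.2 + k 6 * p.1 ^ 3 + k 7 * p.1 ^ 2 * p.2
      + p.1 ^ 3 * (p.1 * a 2 p.1 + p.2 * a 3 p.1))

/-- The first Lyapunov coefficient of `cubicField 0 ω k a`. -/
noncomputable def cubicLyapunov (ω : ℝ) (k : Fin 8 → ℝ) : ℝ :=
  (1 / 8) * (3 * k 2 + k 7 + (k 1 * k 0 - k 5 * k 4 - 2 * k 0 * k 4) / ω)

/-- At `c = cos θ`, `s = sin θ`, this and `radialQuartic` are the coefficients of `r²` and `r³` in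
the radial component of `cubicField`; `angularCubic` and `angularQuartic` are those of `r` and of
the leading `r²` term in its angular velocity. -/
def radialCubic (k : Fin 8 → ℝ) (c s : ℝ) : ℝ :=
  k 0 * c ^ 3 + (k 1 + k 4) * c ^ 2 * s + k 5 * c * s ^ 2

def angularCubic (k : Fin 8 → ℝ) (c s : ℝ) : ℝ :=
  k 4 * c ^ 3 + (k 5 - k 0) * c ^ 2 * s - k 1 * c * s ^ 2

def radialQuartic (k : Fin 8 → ℝ) (c s : ℝ) : ℝ :=
  k 2 * c ^ 4 + (k 3 + k 6) * c ^ 3 * s + k 7 * c ^ 2 * s ^ 2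

def angularQuartic (k : Fin 8 → ℝ) (c s : ℝ) : ℝ :=
  k 6 * c ^ 4 + (k 7 - k 2) * c ^ 3 * s - k 3 * c ^ 2 * s ^ 2

/-- A primitive of `radialCubic / ω`, for `(c, s) = (cos, sin)`. -/
noncomputable def cubicPrimitive (ω : ℝ) (k : Fin 8 → ℝ) (c s : ℝ) : ℝ :=
  (k 0 * (s - s ^ 3 / 3) - (k 1 + k 4) * (c ^ 3 / 3) + k 5 * (s ^ 3 / 3)) / ω

/-- A primitive of `cos ^ 4 - 3 / 8`, for `(c, s) = (cos, sin)`. -/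
noncomputable def cosFourPrimitive (c s : ℝ) : ℝ := c ^ 3 * s / 4 + 3 / 8 * (c * s)

/-- A primitive of `cos ^ 6 - 5 / 16`, for `(c, s) = (cos, sin)`. -/
noncomputable def cosSixPrimitive (c s : ℝ) : ℝ := c ^ 5 * s / 6 + 5 / 6 * cosFourPrimitive c s

/-- A primitive of `radialQuartic / ω - radialCubic * angularCubic / ω ^ 2`, up to its mean. -/
noncomputable def quarticPrimitive (ω : ℝ) (k : Fin 8 → ℝ) (c s : ℝ) : ℝ :=
  (k 2 * cosFourPrimitive c s - (k 3 + k 6) * (c ^ 4 / 4)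
      + k 7 * (c * s / 2 - cosFourPrimitive c s)) / ω
    - (k 0 * k 4 * cosSixPrimitive c s
      - (k 0 * (k 5 - k 0) + (k 1 + k 4) * k 4) * (c ^ 6 / 6)
      + (-(k 0 * k 1) + (k 1 + k 4) * (k 5 - k 0) + k 5 * k 4)
        * (cosFourPrimitive c s - cosSixPrimitive c s)
      + (-((k 1 + k 4) * k 1) + k 5 * (k 5 - k 0)) * (c ^ 6 / 6 - c ^ 4 / 4)
      - k 5 * k 1 * (cosSixPrimitive c s - 2 * cosFourPrimitive c s + c * s / 2)) / ω ^ 2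

variable {σ ω : ℝ} {k : Fin 8 → ℝ} {a : Fin 4 → ℝ → ℝ}

theorem hasDerivAt_cubicPrimitive (θ : ℝ) :
    HasDerivAt (fun θ => cubicPrimitive ω k (Real.cos θ) (Real.sin θ))
      (radialCubic k (Real.cos θ) (Real.sin θ) / ω) θ := by
  have hc := Real.hasDerivAt_cos θ
  have hs := Real.hasDerivAt_sin θ
  have h := ((((hs.sub ((hs.pow 3).div_const 3)).const_mul (k 0)).sub
    (((hc.pow 3).div_const 3).const_mul (k 1 + k 4))).add
    (((hs.pow 3).div_const 3).const_mul (k 5))).div_const ω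
  refine h.congr_deriv ?_
  have hcs := Real.sin_sq θ
  rw [radialCubic]
  congr 1
  simp only [Nat.cast_ofNat, Nat.add_one_sub_one]
  linear_combination (-(k 0) * Real.cos θ) * hcs

theorem hasDerivAt_cosFourPrimitive (θ : ℝ) :
    HasDerivAt (fun θ => cosFourPrimitive (Real.cos θ) (Real.sin θ)) (Real.cos θ ^ 4 - 3 / 8) θ := by
  have hc := Real.hasDerivAt_cos θ
  have hs := Real.hasDerivAt_sin θ
  have h := (((hc.pow 3).mul hs).div_const 4).add ((hc.mul hs).const_mul (3 / 8))
  refine h.congr_deriv ?_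
  have hcs := Real.sin_sq θ
  simp only [Nat.cast_ofNat, Nat.add_one_sub_one, Pi.pow_apply]
  linear_combination (-(3 / 4) * Real.cos θ ^ 2 - 3 / 8) * hcs

theorem hasDerivAt_cosSixPrimitive (θ : ℝ) :
    HasDerivAt (fun θ => cosSixPrimitive (Real.cos θ) (Real.sin θ)) (Real.cos θ ^ 6 - 5 / 16) θ := by
  have hc := Real.hasDerivAt_cos θ
  have hs := Real.hasDerivAt_sin θ
  have h := (((hc.pow 5).mul hs).div_const 6).add
    ((hasDerivAt_cosFourPrimitive θ).const_mul (5 / 6))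
  refine h.congr_deriv ?_
  have hcs := Real.sin_sq θ
  simp only [Nat.cast_ofNat, Nat.add_one_sub_one, Pi.pow_apply]
  linear_combination (-(5 / 6) * Real.cos θ ^ 4) * hcs

/-- Powers of the sine are reduced by `sin² = 1 - cos²`. The means `3/8` of `cos⁴`, `5/16` of `cos⁶`
and `1/2` of `cos²` then add up to `cubicLyapunov ω k / ω`: the averaged cubic coefficient is the
first Lyapunov coefficient. -/
theorem hasDerivAt_quarticPrimitive (hω : ω ≠ 0) (θ : ℝ) :
    HasDerivAt (fun θ => quarticPrimitive ω k (Real.cos θ) (Real.sin θ))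
      (radialQuartic k (Real.cos θ) (Real.sin θ) / ω
        - radialCubic k (Real.cos θ) (Real.sin θ) * angularCubic k (Real.cos θ) (Real.sin θ) / ω ^ 2
        - cubicLyapunov ω k / ω) θ := by
  have hc := Real.hasDerivAt_cos θ
  have hs := Real.hasDerivAt_sin θ
  have h4 := hasDerivAt_cosFourPrimitive θ
  have h6 := hasDerivAt_cosSixPrimitive θ
  have hcs2 := (hc.mul hs).div_const 2
  have c4 := (hc.pow 4).div_const 4
  have c6 := (hc.pow 6).div_const 6
  have h := ((((h4.const_mul (k 2)).sub (c4.const_mul (k 3 + k 6))).add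
      ((hcs2.sub h4).const_mul (k 7))).div_const ω).sub
    ((((((h6.const_mul (k 0 * k 4)).sub
      (c6.const_mul (k 0 * (k 5 - k 0) + (k 1 + k 4) * k 4))).add
      ((h4.sub h6).const_mul (-(k 0 * k 1) + (k 1 + k 4) * (k 5 - k 0) + k 5 * k 4))).add
      ((c6.sub c4).const_mul (-((k 1 + k 4) * k 1) + k 5 * (k 5 - k 0)))).sub
      (((h6.sub (h4.const_mul 2)).add hcs2).const_mul (k 5 * k 1))).div_const (ω ^ 2))
  refine h.congr_deriv ?_
  have hcs := Real.sin_sq θ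
  have hs4 : Real.sin θ ^ 4 = (1 - Real.cos θ ^ 2) ^ 2 := by rw [← hcs]; ring
  have hs3 : Real.sin θ ^ 3 = (1 - Real.cos θ ^ 2) * Real.sin θ := by rw [← hcs]; ring
  rw [radialQuartic, radialCubic, angularCubic, cubicLyapunov]
  simp only [Nat.cast_ofNat, Nat.add_one_sub_one]
  set c := Real.cos θ
  set s := Real.sin θ
  have e1 : k 2 * (c ^ 4 - 3 / 8) - (k 3 + k 6) * (4 * c ^ 3 * -s / 4)
      + k 7 * ((-s * s + c * c) / 2 - (c ^ 4 - 3 / 8))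
      = k 2 * c ^ 4 + (k 3 + k 6) * c ^ 3 * s + k 7 * c ^ 2 * s ^ 2 - (3 * k 2 + k 7) / 8 := by
    linear_combination (-(k 7) / 2 - k 7 * c ^ 2) * hcs
  have e2 : k 0 * k 4 * (c ^ 6 - 5 / 16)
      - (k 0 * (k 5 - k 0) + (k 1 + k 4) * k 4) * (6 * c ^ 5 * -s / 6)
      + (-(k 0 * k 1) + (k 1 + k 4) * (k 5 - k 0) + k 5 * k 4) * (c ^ 4 - 3 / 8 - (c ^ 6 - 5 / 16))
      + (-((k 1 + k 4) * k 1) + k 5 * (k 5 - k 0)) * (6 * c ^ 5 * -s / 6 - 4 * c ^ 3 * -s / 4)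
      - k 5 * k 1 * (c ^ 6 - 5 / 16 - 2 * (c ^ 4 - 3 / 8) + (-s * s + c * c) / 2)
      = (k 0 * c ^ 3 + (k 1 + k 4) * c ^ 2 * s + k 5 * c * s ^ 2) *
        (k 4 * c ^ 3 + (k 5 - k 0) * c ^ 2 * s - k 1 * c * s ^ 2)
        + (k 1 * k 0 - k 5 * k 4 - 2 * k 0 * k 4) / 8 := by
    have x2 : (k 0 * c ^ 3 + (k 1 + k 4) * c ^ 2 * s + k 5 * c * s ^ 2) *
        (k 4 * c ^ 3 + (k 5 - k 0) * c ^ 2 * s - k 1 * c * s ^ 2)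
        = k 0 * k 4 * c ^ 6 + (k 0 * (k 5 - k 0) + (k 1 + k 4) * k 4) * c ^ 5 * s
          + (-(k 0 * k 1) + (k 1 + k 4) * (k 5 - k 0) + k 5 * k 4) * c ^ 4 * s ^ 2
          + (-((k 1 + k 4) * k 1) + k 5 * (k 5 - k 0)) * c ^ 3 * s ^ 3
          - k 5 * k 1 * c ^ 2 * s ^ 4 := by ring
    have x3 : -s * s = -(1 - c ^ 2) := by rw [← hcs]; ring
    rw [x2, hs4, hs3, hcs, x3]
    ring
  rw [e1, e2]
  field_simp
  ring

theorem cubic_radialPart {r θ : ℝ} :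
    radialPart (cubicField σ ω k a) r θ = σ * r + r ^ 2 * radialCubic k (Real.cos θ) (Real.sin θ)
      + r ^ 3 * radialQuartic k (Real.cos θ) (Real.sin θ)
      + r ^ 4 * (Real.cos θ ^ 3 * (Real.cos θ * (Real.cos θ * a 0 (r * Real.cos θ)
          + Real.sin θ * a 1 (r * Real.cos θ))
        + Real.sin θ * (Real.cos θ * a 2 (r * Real.cos θ)
          + Real.sin θ * a 3 (r * Real.cos θ)))) := by
  simp only [radialPart, cubicField, pol, radialCubic, radialQuartic]
  linear_combination (σ * r) * Real.cos_sq_add_sin_sq θ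

theorem cubic_angularPart {r θ : ℝ} (hr : r ≠ 0) :
    angularPart (cubicField σ ω k a) r θ = ω + r * angularCubic k (Real.cos θ) (Real.sin θ)
      + r ^ 2 * (angularQuartic k (Real.cos θ) (Real.sin θ)
      + r * (Real.cos θ ^ 3 * (Real.cos θ * (Real.cos θ * a 2 (r * Real.cos θ)
          + Real.sin θ * a 3 (r * Real.cos θ))
        - Real.sin θ * (Real.cos θ * a 0 (r * Real.cos θ)
          + Real.sin θ * a 1 (r * Real.cos θ))))) := by
  simp only [angularPart, cubicField, pol, angularCubic, angularQuartic]
  rw [div_eq_iff hr]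
  linear_combination (ω * r) * Real.cos_sq_add_sin_sq θ

/-- Uniform bounds for the trigonometric polynomials of the normal form. -/
theorem exists_coefficient_bound {M ω₀ : ℝ} (hω₀ : 0 < ω₀) :
    ∃ B > 0, ∀ ω ∈ Icc ω₀ M, ∀ k : Fin 8 → ℝ, (∀ i, |k i| ≤ M) → ∀ θ,
      |radialCubic k (Real.cos θ) (Real.sin θ)| ≤ B ∧
      |angularCubic k (Real.cos θ) (Real.sin θ)| ≤ B ∧
      |radialQuartic k (Real.cos θ) (Real.sin θ)| ≤ B ∧
      |angularQuartic k (Real.cos θ) (Real.sin θ)| ≤ B ∧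
      |cubicPrimitive ω k (Real.cos θ) (Real.sin θ)| ≤ B ∧
      |quarticPrimitive ω k (Real.cos θ) (Real.sin θ)| ≤ B ∧ |cubicLyapunov ω k| ≤ B := by
  set S : Set (ℝ × (Fin 8 → ℝ) × ℝ × ℝ) := Icc ω₀ M ×ˢ
    Icc (fun _ => -M) (fun _ => M) ×ˢ Icc (-1) 1 ×ˢ Icc (-1) 1 with hS
  have hcomp : IsCompact S :=
    isCompact_Icc.prod (isCompact_Icc.prod (isCompact_Icc.prod isCompact_Icc))
  have hbd : ∀ F : ℝ × (Fin 8 → ℝ) × ℝ × ℝ → ℝ, (∀ p, p.1 ≠ 0 → ContinuousAt F p) →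
      ∃ B, ∀ ω ∈ Icc ω₀ M, ∀ k : Fin 8 → ℝ, (∀ i, |k i| ≤ M) → ∀ θ,
        |F (ω, k, Real.cos θ, Real.sin θ)| ≤ B := by
    intro F hF
    obtain ⟨B, hB⟩ := hcomp.exists_bound_of_continuousOn (f := F) fun p hp =>
      (hF p (hω₀.trans_le hp.1.1).ne').continuousWithinAt
    exact ⟨B, fun ω hω k hk θ => hB _ ⟨hω, ⟨fun i => neg_le_of_abs_le (hk i),
      fun i => le_of_abs_le (hk i)⟩, ⟨Real.neg_one_le_cos θ, Real.cos_le_one θ⟩,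
      ⟨Real.neg_one_le_sin θ, Real.sin_le_one θ⟩⟩⟩
  obtain ⟨B₁, h₁⟩ := hbd (fun p => radialCubic p.2.1 p.2.2.1 p.2.2.2) fun p _ => by
    unfold radialCubic; fun_prop
  obtain ⟨B₂, h₂⟩ := hbd (fun p => angularCubic p.2.1 p.2.2.1 p.2.2.2) fun p _ => by
    unfold angularCubic; fun_prop
  obtain ⟨B₃, h₃⟩ := hbd (fun p => radialQuartic p.2.1 p.2.2.1 p.2.2.2) fun p _ => by
    unfold radialQuartic; fun_prop
  obtain ⟨B₄, h₄⟩ := hbd (fun p => angularQuartic p.2.1 p.2.2.1 p.2.2.2) fun p _ => by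
    unfold angularQuartic; fun_prop
  obtain ⟨B₅, h₅⟩ := hbd (fun p => cubicPrimitive p.1 p.2.1 p.2.2.1 p.2.2.2) fun p hp => by
    unfold cubicPrimitive; fun_prop (disch := exact hp)
  obtain ⟨B₆, h₆⟩ := hbd (fun p => quarticPrimitive p.1 p.2.1 p.2.2.1 p.2.2.2) fun p hp => by
    unfold quarticPrimitive cosSixPrimitive cosFourPrimitive
    fun_prop (disch := simp [hp])
  obtain ⟨B₇, h₇⟩ := hbd (fun p => cubicLyapunov p.1 p.2.1) fun p hp => by
    unfold cubicLyapunov; fun_prop (disch := exact hp)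
  refine ⟨max 1 (max B₁ (max B₂ (max B₃ (max B₄ (max B₅ (max B₆ B₇)))))),
    lt_max_of_lt_left one_pos, fun ω hω k hk θ => ?_⟩
  simp only [le_max_iff]
  exact ⟨.inr (.inl (h₁ ω hω k hk θ)), .inr (.inr (.inl (h₂ ω hω k hk θ))),
    .inr (.inr (.inr (.inl (h₃ ω hω k hk θ)))), .inr (.inr (.inr (.inr (.inl (h₄ ω hω k hk θ))))),
    .inr (.inr (.inr (.inr (.inr (.inl (h₅ ω hω k hk θ)))))),
    .inr (.inr (.inr (.inr (.inr (.inr (.inl (h₆ ω hω k hk θ))))))),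
    .inr (.inr (.inr (.inr (.inr (.inr (.inr (h₇ ω hω k hk θ)))))))⟩

/-- Serves twice: with the values of the remainders for the sup bounds, and with their differences
for the Lipschitz bounds. -/
theorem abs_trig_combination_le {c s B x y z w : ℝ} (hc : |c| ≤ 1) (hs : |s| ≤ 1)
    (hx : |x| ≤ B) (hy : |y| ≤ B) (hz : |z| ≤ B) (hw : |w| ≤ B) :
    |c ^ 3 * (c * (c * x + s * y) + s * (c * z + s * w))| ≤ 4 * B := by
  have h2 : ∀ {t u : ℝ}, |t| ≤ 1 → |t * u| ≤ |u| := fun ht => by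
    rw [abs_mul]; exact mul_le_of_le_one_left (abs_nonneg _) ht
  have h3 : ∀ {u v : ℝ}, |c * u + s * v| ≤ |u| + |v| := fun {u v} =>
    (abs_add_le _ _).trans (add_le_add (h2 hc) (h2 hs))
  have hc3 : |c ^ 3| ≤ 1 := by rw [abs_pow]; exact pow_le_one₀ (abs_nonneg _) hc
  have h4 := h3 (u := x) (v := y)
  have h5 := h3 (u := z) (v := w)
  have h6 := h3 (u := c * x + s * y) (v := c * z + s * w)
  have h7 := h2 (u := c * (c * x + s * y) + s * (c * z + s * w)) hc3
  linarith

/-- A planar field with a weak focus of negative first Lyapunov coefficient, and with small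
`σ = δ² > 0`, has an asymptotically stable periodic orbit of size `O(δ)`; the constants are
uniform. -/
theorem exists_stable_orbit_cubicField {M ω₀ ℓ₀ : ℝ} (hM : 0 < M) (hω₀ : 0 < ω₀) (hℓ₀ : 0 < ℓ₀) :
    ∃ δ₀ > 0, ∃ X > 0, ∀ δ ∈ Ioo 0 δ₀, ∀ ω ∈ Icc ω₀ M, ∀ (k : Fin 8 → ℝ) (a : Fin 4 → ℝ → ℝ),
      (∀ i, |k i| ≤ M) → (∀ i, ∀ x ∈ Icc (-1 : ℝ) 1, |a i x| ≤ M) →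
      (∀ i, ∀ x ∈ Icc (-1 : ℝ) 1, ∀ y ∈ Icc (-1 : ℝ) 1, |a i x - a i y| ≤ M * |x - y|) →
      cubicLyapunov ω k ≤ -ℓ₀ → ContDiff ℝ 1 (cubicField (δ ^ 2) ω k a) →
      ∃ Γ ⊆ Metric.closedBall (0 : ℝ × ℝ) (X * δ), IsPeriodicOrbit (cubicField (δ ^ 2) ω k a) Γ ∧
        AsymptoticallyStable (cubicField (δ ^ 2) ω k a) Γ := by
  obtain ⟨B, hB, hbound⟩ := exists_coefficient_bound (M := M) hω₀
  -- The term `8M` covers the Lipschitz bound of `D₄`, a product `r · x` whose two factors cost `4M`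
  -- each; every other bound needs less.
  set M' : ℝ := B + 8 * M with hM'
  obtain ⟨δ₀, hδ₀, X, hX, hann⟩ := PolarNormalForm.exists_contractingAnnulus
    (M := M') (by positivity) hω₀ hℓ₀
  refine ⟨δ₀, hδ₀, X, hX, fun δ hδ ω hω k a hk ha hlip hℓ hcd => ?_⟩
  have hmem : ∀ r ∈ Ioc (0 : ℝ) 1, ∀ θ, r * Real.cos θ ∈ Icc (-1 : ℝ) 1 := by
    intro r hr θ
    rw [mem_Icc, ← abs_le, abs_mul, abs_of_pos hr.1]
    exact mul_le_one₀ hr.2 (abs_nonneg _) (Real.abs_cos_le_one θ)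
  have ha' : ∀ i, ∀ r ∈ Ioc (0 : ℝ) 1, ∀ θ, |a i (r * Real.cos θ)| ≤ M := fun i r hr θ =>
    ha i _ (hmem r hr θ)
  have hlip' : ∀ i, ∀ r ∈ Ioc (0 : ℝ) 1, ∀ s ∈ Ioc (0 : ℝ) 1, ∀ θ,
      |a i (r * Real.cos θ) - a i (s * Real.cos θ)| ≤ M * |r - s| := by
    intro i r hr s hs θ
    refine (hlip i _ (hmem r hr θ) _ (hmem s hs θ)).trans ?_
    rw [← sub_mul, abs_mul]
    have := mul_le_of_le_one_right (abs_nonneg (r - s)) (Real.abs_cos_le_one θ)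
    gcongr
  have hc := Real.abs_cos_le_one
  have hs := Real.abs_sin_le_one
  have e1b : ∀ r ∈ Ioc (0 : ℝ) 1, ∀ θ, _ := fun r hr θ =>
    abs_trig_combination_le (hc θ) (hs θ) (ha' 0 r hr θ) (ha' 1 r hr θ) (ha' 2 r hr θ) (ha' 3 r hr θ)
  have e2b : ∀ r ∈ Ioc (0 : ℝ) 1, ∀ θ, |Real.cos θ ^ 3 * (Real.cos θ * (Real.cos θ
      * a 2 (r * Real.cos θ) + Real.sin θ * a 3 (r * Real.cos θ)) - Real.sin θ * (Real.cos θ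
      * a 0 (r * Real.cos θ) + Real.sin θ * a 1 (r * Real.cos θ)))| ≤ 4 * M := fun r hr θ => by
    have := abs_trig_combination_le (hc θ) (hs θ) (ha' 2 r hr θ) (ha' 3 r hr θ)
      (z := -a 0 (r * Real.cos θ)) (w := -a 1 (r * Real.cos θ))
      (by rw [abs_neg]; exact ha' 0 r hr θ) (by rw [abs_neg]; exact ha' 1 r hr θ)
    refine le_trans (le_of_eq ?_) this
    congr 1; ring
  have e1l : ∀ r ∈ Ioc (0 : ℝ) 1, ∀ t ∈ Ioc (0 : ℝ) 1, ∀ θ, _ := fun r hr t ht θ =>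
    abs_trig_combination_le (hc θ) (hs θ) (hlip' 0 r hr t ht θ) (hlip' 1 r hr t ht θ)
      (hlip' 2 r hr t ht θ) (hlip' 3 r hr t ht θ)
  have e2l : ∀ r ∈ Ioc (0 : ℝ) 1, ∀ t ∈ Ioc (0 : ℝ) 1, ∀ θ, _ := fun r hr t ht θ =>
    abs_trig_combination_le (hc θ) (hs θ) (hlip' 2 r hr t ht θ) (hlip' 3 r hr t ht θ)
      (z := -(a 0 (r * Real.cos θ) - a 0 (t * Real.cos θ)))
      (w := -(a 1 (r * Real.cos θ) - a 1 (t * Real.cos θ)))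
      (by rw [abs_neg]; exact hlip' 0 r hr t ht θ) (by rw [abs_neg]; exact hlip' 1 r hr t ht θ)
  have hb := hbound ω hω k hk
  have hBM : B ≤ M' := by linarith
  have hP : PolarNormalForm (cubicField (δ ^ 2) ω k a) (δ ^ 2) ω (cubicLyapunov ω k)
      (fun θ => radialCubic k (Real.cos θ) (Real.sin θ))
      (fun θ => angularCubic k (Real.cos θ) (Real.sin θ))
      (fun θ => radialQuartic k (Real.cos θ) (Real.sin θ))
      (fun θ => cubicPrimitive ω k (Real.cos θ) (Real.sin θ))
      (fun θ => quarticPrimitive ω k (Real.cos θ) (Real.sin θ))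
      (fun θ r => Real.cos θ ^ 3 * (Real.cos θ * (Real.cos θ * a 0 (r * Real.cos θ)
          + Real.sin θ * a 1 (r * Real.cos θ))
        + Real.sin θ * (Real.cos θ * a 2 (r * Real.cos θ) + Real.sin θ * a 3 (r * Real.cos θ))))
      (fun θ r => angularQuartic k (Real.cos θ) (Real.sin θ)
        + r * (Real.cos θ ^ 3 * (Real.cos θ * (Real.cos θ * a 2 (r * Real.cos θ)
          + Real.sin θ * a 3 (r * Real.cos θ))
        - Real.sin θ * (Real.cos θ * a 0 (r * Real.cos θ)
          + Real.sin θ * a 1 (r * Real.cos θ))))) M' :=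
    { radial := fun r _ θ => cubic_radialPart
      angular := fun r hr θ => cubic_angularPart hr.1.ne'
      deriv_A₂ := hasDerivAt_cubicPrimitive
      deriv_A₃ := hasDerivAt_quarticPrimitive (hω₀.trans_le hω.1).ne'
      periodic_A₂ := fun θ => by simp only [Real.cos_add_two_pi, Real.sin_add_two_pi]
      periodic_A₃ := fun θ => by simp only [Real.cos_add_two_pi, Real.sin_add_two_pi]
      bound_C₃ := fun θ => (hb θ).1.trans hBM
      bound_D₃ := fun θ => (hb θ).2.1.trans hBM
      bound_C₄ := fun θ => (hb θ).2.2.1.trans hBM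
      bound_A₂ := fun θ => (hb θ).2.2.2.2.1.trans hBM
      bound_A₃ := fun θ => (hb θ).2.2.2.2.2.1.trans hBM
      bound_e₁ := fun r hr θ => (e1b r hr θ).trans (by linarith)
      bound_D₄ := fun r hr θ => by
        refine (abs_add_le _ _).trans ?_
        rw [abs_mul, abs_of_pos hr.1]
        have h1 := mul_le_mul hr.2 (e2b r hr θ) (abs_nonneg _) zero_le_one
        have h2 := (hb θ).2.2.2.1
        linarith
      lip_e₁ := fun r hr t ht θ => by
        refine le_trans (le_of_eq ?_) ((e1l r hr t ht θ).trans ?_)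
        · congr 1; ring
        · rw [← mul_assoc]
          exact mul_le_mul_of_nonneg_right (by linarith) (abs_nonneg _)
      lip_D₄ := fun r hr t ht θ => by
        have h1 := e2b r hr θ
        have h2 := e2l r hr t ht θ
        set x := Real.cos θ ^ 3 * (Real.cos θ * (Real.cos θ
          * a 2 (r * Real.cos θ) + Real.sin θ * a 3 (r * Real.cos θ)) - Real.sin θ * (Real.cos θ
          * a 0 (r * Real.cos θ) + Real.sin θ * a 1 (r * Real.cos θ))) with hx
        set y := Real.cos θ ^ 3 * (Real.cos θ * (Real.cos θ
          * a 2 (t * Real.cos θ) + Real.sin θ * a 3 (t * Real.cos θ)) - Real.sin θ * (Real.cos θ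
          * a 0 (t * Real.cos θ) + Real.sin θ * a 1 (t * Real.cos θ))) with hy
        have h3 : |x - y| ≤ 4 * (M * |r - t|) := by
          refine le_trans (le_of_eq ?_) h2
          rw [hx, hy]
          congr 1; ring
        have h4 : angularQuartic k (Real.cos θ) (Real.sin θ) + r * x
            - (angularQuartic k (Real.cos θ) (Real.sin θ) + t * y)
            = (r - t) * x + t * (x - y) := by ring
        rw [h4]
        refine (abs_add_le _ _).trans ?_
        rw [abs_mul (r - t) x, abs_mul t (x - y), abs_of_pos ht.1]
        have h5 := mul_le_mul_of_nonneg_left h1 (abs_nonneg (r - t))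
        have h6 := mul_le_mul ht.2 h3 (abs_nonneg _) zero_le_one
        have h7 := mul_nonneg hB.le (abs_nonneg (r - t))
        rw [hM', add_mul]
        linarith }
  obtain ⟨w, H, r₁, M₁, m₁, m₂, M₂, κ, c, hA⟩ := hann δ hδ (cubicField (δ ^ 2) ω k a) ω
    (cubicLyapunov ω k) _ _ _ _ _ _ _ ⟨hω.1, hω.2.trans (by linarith)⟩
    ⟨by linarith [neg_le_of_abs_le (hb 0).2.2.2.2.2.2], hℓ⟩ hP
  exact hA.exists_stable_orbit hcd

end CubicField

section Conjugacy

/-! ### Affine changes of coordinates -/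

variable {f : ℝ × ℝ → ℝ × ℝ} {e : ℝ × ℝ} {L : (ℝ × ℝ) ≃L[ℝ] (ℝ × ℝ)} {Γ : Set (ℝ × ℝ)}

/-- The field `f` in the affine coordinates `u = L (p - e)`. -/
def conjField (f : ℝ × ℝ → ℝ × ℝ) (e : ℝ × ℝ) (L : (ℝ × ℝ) ≃L[ℝ] (ℝ × ℝ)) (u : ℝ × ℝ) : ℝ × ℝ :=
  L (f (e + L.symm u))

theorem isIntegralCurveOn_conjField {γ : ℝ → ℝ × ℝ} {s : Set ℝ}
    (h : IsIntegralCurveOn γ (fun _ => f) s) :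
    IsIntegralCurveOn (fun t => L (γ t - e)) (fun _ => conjField f e L) s := fun t ht => by
  have h1 := L.hasFDerivAt.comp_hasDerivWithinAt t ((h t ht).sub_const e)
  simpa [conjField, Function.comp_def] using h1

theorem isIntegralCurveOn_of_conjField {γ : ℝ → ℝ × ℝ} {s : Set ℝ}
    (h : IsIntegralCurveOn γ (fun _ => conjField f e L) s) :
    IsIntegralCurveOn (fun t => e + L.symm (γ t)) (fun _ => f) s := fun t ht => by
  have h1 := (L.symm.hasFDerivAt.comp_hasDerivWithinAt t (h t ht)).const_add e
  simpa [conjField, Function.comp_def] using h1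

theorem lyapunovStable_of_conjField (h : LyapunovStable (conjField f e L) Γ) :
    LyapunovStable f ((fun u => e + L.symm u) '' Γ) := by
  intro U hU hΓ
  have hc : Continuous fun u => e + L.symm u := by fun_prop
  have hc' : Continuous fun p => L (p - e) := by fun_prop
  obtain ⟨V, hV, hΓV, hst⟩ := h _ (hU.preimage hc) (image_subset_iff.1 hΓ)
  refine ⟨_, hV.preimage hc', ?_, fun γ T hT hγ h0 t ht => ?_⟩
  · rintro _ ⟨u, hu, rfl⟩
    simpa using hΓV hu
  · simpa using hst _ T hT (isIntegralCurveOn_conjField hγ) h0 t ht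

theorem infDist_image_affine_le (u : ℝ × ℝ) :
    Metric.infDist (e + L.symm u) ((fun u => e + L.symm u) '' Γ)
      ≤ (‖(L.symm : (ℝ × ℝ) →L[ℝ] (ℝ × ℝ))‖ + 1) * Metric.infDist u Γ := by
  rcases Γ.eq_empty_or_nonempty with rfl | hΓ
  · simp
  have hC : 0 < ‖(L.symm : (ℝ × ℝ) →L[ℝ] (ℝ × ℝ))‖ + 1 := by positivity
  rw [← div_le_iff₀' hC, Metric.le_infDist hΓ]
  intro v hv
  rw [div_le_iff₀' hC]
  refine (Metric.infDist_le_dist_of_mem (mem_image_of_mem _ hv)).trans ?_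
  rw [dist_add_left, dist_eq_norm, dist_eq_norm, ← map_sub]
  refine ((L.symm : (ℝ × ℝ) →L[ℝ] (ℝ × ℝ)).le_opNorm (u - v)).trans ?_
  exact mul_le_mul_of_nonneg_right (by linarith) (norm_nonneg _)

theorem asymptoticallyStable_of_conjField (h : AsymptoticallyStable (conjField f e L) Γ) :
    AsymptoticallyStable f ((fun u => e + L.symm u) '' Γ) := by
  obtain ⟨hst, V, hV, hΓV, hatt⟩ := h
  refine ⟨lyapunovStable_of_conjField hst, _,
    hV.preimage (by fun_prop : Continuous fun p => L (p - e)), ?_, fun p hp => ?_⟩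
  · rintro _ ⟨u, hu, rfl⟩
    simpa using hΓV hu
  · obtain ⟨γ, hγ, h0, hlim⟩ := hatt _ hp
    refine ⟨_, isIntegralCurveOn_of_conjField hγ, by simp [h0], ?_⟩
    refine squeeze_zero (fun _ => Metric.infDist_nonneg) (fun t => infDist_image_affine_le _) ?_
    simpa using hlim.const_mul (‖(L.symm : (ℝ × ℝ) →L[ℝ] (ℝ × ℝ))‖ + 1)

theorem isPeriodicOrbit_of_conjField (h : IsPeriodicOrbit (conjField f e L) Γ) :
    IsPeriodicOrbit f ((fun u => e + L.symm u) '' Γ) := by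
  obtain ⟨γ, T, hT, hγ, hper, ⟨t, ht⟩, rfl⟩ := h
  refine ⟨fun t => e + L.symm (γ t), T, hT, ?_, fun t => ?_, ⟨t, ?_⟩, ?_⟩
  · rw [← isIntegralCurveOn_univ] at hγ ⊢
    exact isIntegralCurveOn_of_conjField hγ
  · simp only [hper t]
  · simpa using ht
  · rw [← range_comp]; rfl

end Conjugacy

section Derivatives

/-! ### Higher derivatives -/

variable {E F : Type*} [NormedAddCommGroup E] [NormedSpace ℝ E] [NormedAddCommGroup F]
  [NormedSpace ℝ F]

/-- Peels off the first direction, so that the mixed partials in `d2` and `d3` become nested first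
derivatives. -/
theorem iteratedFDeriv_succ_apply_eq_fderiv {G : E → F} (hG : ContDiff ℝ ⊤ G) (n : ℕ) (p : E)
    (m : Fin (n + 1) → E) : iteratedFDeriv ℝ (n + 1) G p m
      = fderiv ℝ (fun q => iteratedFDeriv ℝ n G q (Fin.tail m)) p (m 0) := by
  rw [iteratedFDeriv_succ_apply_left, fderiv_continuousMultilinear_apply_const_apply]
  exact (hG.differentiable_iteratedFDeriv (by simp)) p

/-- A map of the plane which is affine in the second variable. -/
def sndAffine (φ ψ : ℝ → F) (p : ℝ × ℝ) : F := φ p.1 + p.2 • ψ p.1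

theorem contDiff_sndAffine {φ ψ : ℝ → F} (hφ : ContDiff ℝ ⊤ φ) (hψ : ContDiff ℝ ⊤ ψ) :
    ContDiff ℝ ⊤ (sndAffine φ ψ) := by
  unfold sndAffine; fun_prop

theorem fderiv_sndAffine {φ ψ : ℝ → F} (hφ : ContDiff ℝ ⊤ φ) (hψ : ContDiff ℝ ⊤ ψ) (p u : ℝ × ℝ) :
    fderiv ℝ (sndAffine φ ψ) p u
      = u.1 • sndAffine (deriv φ) (deriv ψ) p + u.2 • ψ p.1 := by
  have h1 := ((hφ.differentiable (by simp)) p.1).hasDerivAt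
  have h2 := ((hψ.differentiable (by simp)) p.1).hasDerivAt
  have h3 : HasFDerivAt (fun q : ℝ × ℝ => q.1) (ContinuousLinearMap.fst ℝ ℝ ℝ) p := hasFDerivAt_fst
  have h4 : HasFDerivAt (fun q : ℝ × ℝ => q.2) (ContinuousLinearMap.snd ℝ ℝ ℝ) p := hasFDerivAt_snd
  have h := (h1.hasFDerivAt.comp p h3).add (h4.smul (h2.hasFDerivAt.comp p h3))
  have h' : HasFDerivAt (sndAffine φ ψ) _ p := h
  rw [h'.fderiv]
  simp [sndAffine, smul_smul, mul_comm]
  abel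

theorem contDiff_top_deriv {φ : ℝ → F} (hφ : ContDiff ℝ ⊤ φ) : ContDiff ℝ ⊤ (deriv φ) := by
  have h : ContDiff ℝ (⊤ + 1) φ := by simpa using hφ
  exact (contDiff_succ_iff_deriv.1 h).2.2

/-- The coefficient maps of the derivative of `sndAffine φ ψ` in the direction `u`. -/
theorem fderiv_sndAffine_eq {φ ψ : ℝ → F} (hφ : ContDiff ℝ ⊤ φ) (hψ : ContDiff ℝ ⊤ ψ) (u : ℝ × ℝ) :
    (fun p => fderiv ℝ (sndAffine φ ψ) p u)
      = sndAffine (fun x => u.1 • deriv φ x + u.2 • ψ x) (fun x => u.1 • deriv ψ x) := by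
  funext p
  rw [fderiv_sndAffine hφ hψ]
  simp only [sndAffine, smul_add, smul_smul, mul_comm]
  abel

section

variable {φ ψ : ℝ → F}

theorem iteratedFDeriv_two_sndAffine (hφ : ContDiff ℝ ⊤ φ) (hψ : ContDiff ℝ ⊤ ψ) (p u v : ℝ × ℝ) :
    iteratedFDeriv ℝ 2 (sndAffine φ ψ) p ![u, v]
      = fderiv ℝ (fun q => fderiv ℝ (sndAffine φ ψ) q v) p u := by
  rw [iteratedFDeriv_succ_apply_eq_fderiv (contDiff_sndAffine hφ hψ)]
  congr 2
  funext q
  simp [iteratedFDeriv_one_apply]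

theorem iteratedFDeriv_three_sndAffine (hφ : ContDiff ℝ ⊤ φ) (hψ : ContDiff ℝ ⊤ ψ)
    (p u v w : ℝ × ℝ) : iteratedFDeriv ℝ 3 (sndAffine φ ψ) p ![u, v, w]
      = fderiv ℝ (fun q => fderiv ℝ (fun r => fderiv ℝ (sndAffine φ ψ) r w) q v) p u := by
  rw [iteratedFDeriv_succ_apply_eq_fderiv (contDiff_sndAffine hφ hψ)]
  congr 2
  funext q
  exact iteratedFDeriv_two_sndAffine hφ hψ q v w

/-- Leibniz's rule with a factor of degree one. At 0 only the first term remains, so the Taylor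
coefficients of nested expressions `c + x • b x` can be read off layer by layer. -/
theorem iteratedDeriv_succ_id_smul {b : ℝ → F} (hb : ContDiff ℝ ⊤ b) (n : ℕ) :
    iteratedDeriv (n + 1) (fun x => x • b x)
      = fun x => ((n : ℝ) + 1) • iteratedDeriv n b x + x • iteratedDeriv (n + 1) b x := by
  have hd : ∀ m x, HasDerivAt (iteratedDeriv m b) (iteratedDeriv (m + 1) b x) x := fun m x => by
    rw [iteratedDeriv_succ]
    exact ((hb.differentiable_iteratedDeriv m (by simp)) x).hasDerivAt
  induction n with
  | zero =>
    funext x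
    rw [iteratedDeriv_succ, iteratedDeriv_zero]
    have := ((hasDerivAt_id x).smul (hd 0 x)).deriv
    simp only [iteratedDeriv_zero] at this ⊢
    refine Eq.trans this ?_
    simp [add_comm]
  | succ n ih =>
    funext x
    rw [iteratedDeriv_succ, ih]
    have := (((hd n x).const_smul ((n : ℝ) + 1)).add ((hasDerivAt_id x).smul (hd (n + 1) x))).deriv
    refine Eq.trans this ?_
    push_cast
    simp only [id, one_smul, add_smul]
    abel

theorem iteratedDeriv_succ_const_add_smul {b : ℝ → F} (hb : ContDiff ℝ ⊤ b) (n : ℕ) (c : F) :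
    iteratedDeriv (n + 1) (fun x => c + x • b x) 0 = ((n : ℝ) + 1) • iteratedDeriv n b 0 := by
  rw [iteratedDeriv_const_add n.succ_pos, iteratedDeriv_succ_id_smul hb]
  simp

end

/-- Division by `x` of an analytic function that vanishes at `0`. -/
theorem exists_eq_const_add_mul {f : ℝ → ℝ} (hf : AnalyticOnNhd ℝ f univ) :
    ∃ g : ℝ → ℝ, AnalyticOnNhd ℝ g univ ∧ f = fun x => f 0 + x • g x := by
  refine ⟨dslope f 0, fun x _ => ?_, funext fun x => ?_⟩
  · rcases eq_or_ne x 0 with rfl | hx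
    · obtain ⟨p, hp⟩ := hf 0 trivial
      exact ⟨_, hp.has_fpower_series_dslope_fslope⟩
    · have h : AnalyticAt ℝ (fun y => (y - 0)⁻¹ • (f y - f 0)) x :=
        ((analyticAt_id.sub analyticAt_const).inv (by simpa using hx)).smul
          ((hf x trivial).sub analyticAt_const)
      refine h.congr ?_
      filter_upwards [isOpen_ne.mem_nhds hx] with y hy
      rw [dslope_of_ne _ hy, slope_def_module]
  · have := sub_smul_dslope f 0 x
    rw [sub_zero] at this
    rw [this]; ring

/-- Taylor's formula of order four with analytic remainder. -/
theorem exists_taylor_four {f : ℝ → ℝ} (hf : AnalyticOnNhd ℝ f univ) :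
    ∃ g : ℝ → ℝ, ContDiff ℝ ⊤ g ∧ ∀ x, f x = f 0 + iteratedDeriv 1 f 0 * x
      + iteratedDeriv 2 f 0 / 2 * x ^ 2 + iteratedDeriv 3 f 0 / 6 * x ^ 3 + x ^ 4 * g x := by
  obtain ⟨g₁, h₁, e₁⟩ := exists_eq_const_add_mul hf
  obtain ⟨g₂, h₂, e₂⟩ := exists_eq_const_add_mul h₁
  obtain ⟨g₃, h₃, e₃⟩ := exists_eq_const_add_mul h₂
  obtain ⟨g₄, h₄, e₄⟩ := exists_eq_const_add_mul h₃
  have d₁ : ∀ n : ℕ, iteratedDeriv (n + 1) f 0 = ((n : ℝ) + 1) • iteratedDeriv n g₁ 0 := fun n => by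
    conv_lhs => rw [e₁]
    exact iteratedDeriv_succ_const_add_smul h₁.contDiff n _
  have d₂ : ∀ n : ℕ, iteratedDeriv (n + 1) g₁ 0 = ((n : ℝ) + 1) • iteratedDeriv n g₂ 0 := fun n => by
    conv_lhs => rw [e₂]
    exact iteratedDeriv_succ_const_add_smul h₂.contDiff n _
  have d₃ : ∀ n : ℕ, iteratedDeriv (n + 1) g₂ 0 = ((n : ℝ) + 1) • iteratedDeriv n g₃ 0 := fun n => by
    conv_lhs => rw [e₃]
    exact iteratedDeriv_succ_const_add_smul h₃.contDiff n _
  refine ⟨g₄, h₄.contDiff, fun x => ?_⟩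
  rw [d₁ 0, d₁ 1, d₁ 2, d₂ 0, d₂ 1, d₃ 0]
  simp only [iteratedDeriv_zero, smul_eq_mul]
  have x₁ := congrFun e₁ x
  have x₂ := congrFun e₂ x
  have x₃ := congrFun e₃ x
  have x₄ := congrFun e₄ x
  simp only [smul_eq_mul] at x₁ x₂ x₃ x₄
  rw [x₁, x₂, x₃, x₄]
  push_cast
  ring

/-- The remainder of order four of the cosine. -/
theorem exists_cos_taylor : ∃ C : ℝ → ℝ, ContDiff ℝ ⊤ C ∧
    ∀ x, Real.cos x = 1 - x ^ 2 / 2 + x ^ 4 * C x := by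
  obtain ⟨g, hg, h⟩ := exists_taylor_four (f := Real.cos) fun x _ => Real.analyticAt_cos
  refine ⟨g, hg, fun x => ?_⟩
  rw [h x]
  simp [iteratedDeriv_succ]
  ring

theorem exists_sin_taylor : ∃ D : ℝ → ℝ, ContDiff ℝ ⊤ D ∧
    ∀ x, Real.sin x = x - x ^ 3 / 6 + x ^ 4 * D x := by
  obtain ⟨g, hg, h⟩ := exists_taylor_four (f := Real.sin) fun x _ => Real.analyticAt_sin
  refine ⟨g, hg, fun x => ?_⟩
  rw [h x]
  simp [iteratedDeriv_succ]
  ring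

/-! ### The first Lyapunov coefficient of `cubicField` -/

theorem cubicField_eq_sndAffine (σ ω : ℝ) (k : Fin 8 → ℝ) (a : Fin 4 → ℝ → ℝ) :
    cubicField σ ω k a = sndAffine
      (fun x => (0 : ℝ × ℝ) + x • ((σ, ω) + x • ((k 0, k 4) + x • ((k 2, k 6)
        + x • (a 0 x, a 2 x)))))
      (fun x => ((-ω, σ) : ℝ × ℝ) + x • ((k 1, k 5) + x • ((k 3, k 7)
        + x • (a 1 x, a 3 x)))) := by
  funext p
  ext
  · simp [cubicField, sndAffine]; ring
  · simp [cubicField, sndAffine]; ring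

/-- The field is affine in `v`, so every derivative with two `v` directions vanishes. What is left
of the classical formula involves only the second and third Taylor coefficients of `φ` and the first
two of `ψ`. -/
theorem lyapunovCoeff_cubicField {σ ω : ℝ} {k : Fin 8 → ℝ} {a : Fin 4 → ℝ → ℝ}
    (ha : ∀ i, ContDiff ℝ ⊤ (a i)) : lyapunovCoeff ω (cubicField σ ω k a) = cubicLyapunov ω k := by
  have ha0 := ha 0
  have ha1 := ha 1
  have ha2 := ha 2
  have ha3 := ha 3
  rw [cubicField_eq_sndAffine]
  set φ : ℝ → ℝ × ℝ := fun x => (0 : ℝ × ℝ) + x • ((σ, ω) + x • ((k 0, k 4) + x • ((k 2, k 6)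
        + x • (a 0 x, a 2 x)))) with hφ
  set ψ : ℝ → ℝ × ℝ := fun x => ((-ω, σ) : ℝ × ℝ) + x • ((k 1, k 5) + x • ((k 3, k 7)
        + x • (a 1 x, a 3 x))) with hψ
  have cφ : ContDiff ℝ ⊤ φ := by fun_prop
  have cψ : ContDiff ℝ ⊤ ψ := by fun_prop
  have φ2 : deriv (deriv φ) 0 = (2 * k 0, 2 * k 4) := by
    have h : iteratedDeriv 2 φ 0 = (2 * k 0, 2 * k 4) := by
      rw [hφ, iteratedDeriv_succ_const_add_smul (by fun_prop),
        iteratedDeriv_succ_const_add_smul (by fun_prop)]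
      simp; norm_num
    simpa [iteratedDeriv_succ] using h
  have φ3 : deriv (deriv (deriv φ)) 0 = (6 * k 2, 6 * k 6) := by
    have h : iteratedDeriv 3 φ 0 = (6 * k 2, 6 * k 6) := by
      rw [hφ, iteratedDeriv_succ_const_add_smul (by fun_prop),
        iteratedDeriv_succ_const_add_smul (by fun_prop),
        iteratedDeriv_succ_const_add_smul (by fun_prop)]
      simp; constructor <;> ring
    simpa [iteratedDeriv_succ] using h
  have ψ1 : deriv ψ 0 = (k 1, k 5) := by
    have h : iteratedDeriv 1 ψ 0 = (k 1, k 5) := by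
      rw [hψ, iteratedDeriv_succ_const_add_smul (by fun_prop)]
      simp
    simpa [iteratedDeriv_succ] using h
  have ψ2 : deriv (deriv ψ) 0 = (2 * k 3, 2 * k 7) := by
    have h : iteratedDeriv 2 ψ 0 = (2 * k 3, 2 * k 7) := by
      rw [hψ, iteratedDeriv_succ_const_add_smul (by fun_prop),
        iteratedDeriv_succ_const_add_smul (by fun_prop)]
      simp; norm_num
    simpa [iteratedDeriv_succ] using h
  have z : ContDiff ℝ ⊤ (fun _ : ℝ => (0 : ℝ × ℝ)) := contDiff_const
  have Di : ∀ {φ ψ : ℝ → ℝ × ℝ}, ContDiff ℝ ⊤ φ → ContDiff ℝ ⊤ ψ →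
      (fun p => fderiv ℝ (sndAffine φ ψ) p (1, 0)) = sndAffine (deriv φ) (deriv ψ) :=
    fun h1 h2 => by rw [fderiv_sndAffine_eq h1 h2]; simp
  have Dj : ∀ {φ ψ : ℝ → ℝ × ℝ}, ContDiff ℝ ⊤ φ → ContDiff ℝ ⊤ ψ →
      (fun p => fderiv ℝ (sndAffine φ ψ) p (0, 1)) = sndAffine ψ (fun _ => 0) :=
    fun h1 h2 => by rw [fderiv_sndAffine_eq h1 h2]; simp
  have cφ' := contDiff_top_deriv cφ
  have cψ' := contDiff_top_deriv cψ
  have hii : d2 (sndAffine φ ψ) (1, 0) (1, 0) = deriv (deriv φ) 0 := by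
    rw [d2, iteratedFDeriv_two_sndAffine cφ cψ, Di cφ cψ, fderiv_sndAffine cφ' cψ']
    simp [sndAffine]
  have hij : d2 (sndAffine φ ψ) (1, 0) (0, 1) = deriv ψ 0 := by
    rw [d2, iteratedFDeriv_two_sndAffine cφ cψ, Dj cφ cψ, fderiv_sndAffine cψ z]
    simp [sndAffine]
  have hjj : d2 (sndAffine φ ψ) (0, 1) (0, 1) = 0 := by
    rw [d2, iteratedFDeriv_two_sndAffine cφ cψ, Dj cφ cψ, fderiv_sndAffine cψ z]
    simp
  have hiii : d3 (sndAffine φ ψ) (1, 0) (1, 0) (1, 0) = deriv (deriv (deriv φ)) 0 := by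
    rw [d3, iteratedFDeriv_three_sndAffine cφ cψ, Di cφ cψ, Di cφ' cψ',
      fderiv_sndAffine (contDiff_top_deriv cφ') (contDiff_top_deriv cψ')]
    simp [sndAffine]
  have hijj : d3 (sndAffine φ ψ) (1, 0) (0, 1) (0, 1) = 0 := by
    rw [d3, iteratedFDeriv_three_sndAffine cφ cψ, Dj cφ cψ, Dj cψ z, fderiv_sndAffine z z]
    simp [sndAffine]
  have hiij : d3 (sndAffine φ ψ) (1, 0) (1, 0) (0, 1) = deriv (deriv ψ) 0 := by
    rw [d3, iteratedFDeriv_three_sndAffine cφ cψ, Dj cφ cψ, Di cψ z, deriv_const',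
      fderiv_sndAffine cψ' z]
    simp [sndAffine]
  have hjjj : d3 (sndAffine φ ψ) (0, 1) (0, 1) (0, 1) = 0 := by
    rw [d3, iteratedFDeriv_three_sndAffine cφ cψ, Dj cφ cψ, Dj cψ z, fderiv_sndAffine z z]
    simp
  simp only [lyapunovCoeff, hii, hij, hjj, hiii, hijj, hiij, hjjj, φ2, φ3, ψ1, ψ2, cubicLyapunov,
    Prod.fst_zero, Prod.snd_zero]
  ring

theorem contDiff_cubicField {σ ω : ℝ} {k : Fin 8 → ℝ} {a : Fin 4 → ℝ → ℝ}
    (ha : ∀ i, ContDiff ℝ ⊤ (a i)) : ContDiff ℝ ⊤ (cubicField σ ω k a) := by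
  have ha0 := ha 0
  have ha1 := ha 1
  have ha2 := ha 2
  have ha3 := ha 3
  unfold cubicField
  fun_prop

theorem fderiv_cubicField {σ ω : ℝ} {k : Fin 8 → ℝ} {a : Fin 4 → ℝ → ℝ}
    (ha : ∀ i, ContDiff ℝ ⊤ (a i)) (v : ℝ × ℝ) :
    fderiv ℝ (cubicField σ ω k a) 0 v = (σ * v.1 - ω * v.2, ω * v.1 + σ * v.2) := by
  have ha0 := ha 0
  have ha1 := ha 1
  have ha2 := ha 2
  have ha3 := ha 3
  rw [cubicField_eq_sndAffine, fderiv_sndAffine (by fun_prop) (by fun_prop)]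
  have h := iteratedDeriv_succ_const_add_smul (b := fun x : ℝ => ((σ, ω) + x • ((k 0, k 4)
    + x • ((k 2, k 6) + x • (a 0 x, a 2 x)))))
    (by fun_prop) 0 0
  simp only [iteratedDeriv_one, zero_add] at h
  simp only [sndAffine, zero_add, h, Prod.fst_zero, Prod.snd_zero]
  simp
  constructor <;> ring

end Derivatives

section LocalForm

/-! ### The blow-up system near an equilibrium -/

/-- The value of `ε` at the pseudo-equilibrium of the nonsmooth system with mixing rate `k`. -/
noncomputable def pseudoEpsilon (k : ℝ) : ℝ := (1 - 3 * k) / (5 * (1 + k) * (1 + 2 * k))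

/-- The value of `ε` at which the blow-up system has its equilibrium at the mixing rate `k`. -/
noncomputable def nullEpsilon (k a : ℝ) : ℝ := pseudoEpsilon k + a * Real.cot (Real.pi * k)

/-- The equilibrium of the blow-up system with mixing rate `k`. -/
noncomputable def equilibrium (k : ℝ) : ℝ × ℝ := (1 / (1 + k), k)

/-- The entry `∂k'/∂x` of the Jacobian at the equilibrium. -/
noncomputable def jacB (k a : ℝ) : ℝ := 2 * Real.sin (Real.pi * k) ^ 2 / (5 * a * Real.pi)

/-- The entry `∂k'/∂k` of the Jacobian at the equilibrium. -/
noncomputable def jacD (k a : ℝ) : ℝ :=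
  -(pseudoEpsilon k * Real.sin (Real.pi * k) ^ 2 / (a * Real.pi)) - (1 / 2 + k)

/-- Half the trace of the Jacobian at the equilibrium. -/
noncomputable def halfTrace (k a : ℝ) : ℝ := (jacD k a - (1 + k)) / 2

/-- The determinant of the Jacobian at the equilibrium. -/
noncomputable def jacDet (k a : ℝ) : ℝ := -(1 + k) * jacD k a + jacB k a / (1 + k)

/-- `sin² · cot = sin · cos`, so the field is smooth on the whole plane, not only on the strip.
Where the sine vanishes, the factor `sin²` makes the value assigned to `cot` irrelevant. -/
theorem blowUp_eq (ε a : ℝ) (p : ℝ × ℝ) :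
    blowUp ε a p = (1 - p.1 - p.2 * p.1,
      1 / (a * Real.pi) * (Real.sin (Real.pi * p.2) ^ 2
        * (-3 / 10 - (1 / 2 + p.2) * ε + 2 / 5 * p.1)
        + a * (1 / 2 + p.2) * (Real.sin (Real.pi * p.2) * Real.cos (Real.pi * p.2)))) := by
  unfold blowUp
  ext
  · rfl
  · simp only [α, β, Real.cot_eq_cos_div_sin]
    by_cases h : Real.sin (Real.pi * p.2) = 0
    · simp [h]
    · field_simp
      ring

theorem contDiff_blowUp (ε a : ℝ) {n : WithTop ℕ∞} : ContDiff ℝ n (blowUp ε a) := by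
  have h : blowUp ε a = _ := funext (blowUp_eq ε a)
  rw [h]
  fun_prop

theorem sin_pi_mul_pos {k : ℝ} (hk : k ∈ Ioo (0 : ℝ) 1) : 0 < Real.sin (Real.pi * k) :=
  Real.sin_pos_of_pos_of_lt_pi (mul_pos Real.pi_pos hk.1)
    (by nlinarith [Real.pi_pos, hk.2])

/-- The condition that the normal velocity on `y = 0` vanish at `x = 1 / (1 + k)`, in a form free of
the denominator `1 + 2k`. -/
theorem pseudoEpsilon_mul {k : ℝ} (hk : 0 < k) :
    (1 / 2 + k) * pseudoEpsilon k = -3 / 10 + 2 / 5 * (1 / (1 + k)) := by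
  rw [pseudoEpsilon]
  field_simp
  ring

/-- The first component determines `x`; the second is then affine in `ε` with slope `-(1/2 + k) ≠
0`, up to a positive factor. -/
theorem blowUp_eq_zero_iff {ε a : ℝ} (ha : 0 < a) {p : ℝ × ℝ} (hp : p.2 ∈ Ioo (0 : ℝ) 1) :
    blowUp ε a p = 0 ↔ p = equilibrium p.2 ∧ nullEpsilon p.2 a = ε := by
  obtain ⟨x, k⟩ := p
  have hs := (sin_pi_mul_pos hp).ne'
  have hk : 0 < k := hp.1
  have hpi := Real.pi_pos
  have hg := pseudoEpsilon_mul hk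
  have h1 : 1 - x - k * x = 0 ↔ x = 1 / (1 + k) := by
    rw [eq_div_iff (by positivity)]
    constructor <;> intro h <;> linarith
  simp only [blowUp, Prod.mk_eq_zero, equilibrium, nullEpsilon, Prod.mk.injEq, and_true]
  rw [h1]
  refine and_congr_right fun hx => ?_
  rw [mul_eq_zero, or_iff_right (by positivity), hx]
  simp only [α, β]
  have h2 : (0 : ℝ) < 1 / 2 + k := by positivity
  constructor
  · intro h
    refine mul_left_cancel₀ h2.ne' ?_
    linear_combination hg + h
  · intro h
    linear_combination (1 / 2 + k) * h - hg

/-- The second component of the blow-up system, centred at the equilibrium. -/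
theorem blowUp_snd_centred {k a : ℝ} (hk : k ∈ Ioo (0 : ℝ) 1) (ha : 0 < a) (ξ κ : ℝ) :
    (blowUp (nullEpsilon k a) a (equilibrium k + (ξ, κ))).2
      = ((1 + Real.cos (2 * Real.pi * κ)) / 2 + Real.cot (Real.pi * k) * Real.sin (2 * Real.pi * κ)
          + Real.cot (Real.pi * k) ^ 2 * (1 - Real.cos (2 * Real.pi * κ)) / 2)
          * ((jacD k a + (1 / 2 + k)) * κ + jacB k a * ξ)
        - (1 / 2 + k + κ) / (2 * Real.pi) * (Real.sin (2 * Real.pi * κ)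
          + Real.cot (Real.pi * k) * (1 - Real.cos (2 * Real.pi * κ))) := by
  have hs := (sin_pi_mul_pos hk).ne'
  have hpi := Real.pi_ne_zero
  have ha' := ha.ne'
  have hg := pseudoEpsilon_mul hk.1
  set S := Real.sin (Real.pi * k) with hS
  set c := Real.cot (Real.pi * k) with hc
  have hC : Real.cos (Real.pi * k) = c * S := by
    rw [hc, Real.cot_eq_cos_div_sin, div_mul_cancel₀ _ hs]
  -- With `cos(πk) = c S` and `S²(1 + c²) = 1`, everything at `k + κ` is expressed through `c` and
  -- the doubled angle `2πκ`; after this the claim is a polynomial identity.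
  have hone : S ^ 2 * (1 + c ^ 2) = 1 := by
    have := Real.sin_sq_add_cos_sq (Real.pi * k)
    rw [hC] at this
    linear_combination this
  have hy : 2 * Real.pi * κ = 2 * (Real.pi * κ) := by ring
  have hcos : Real.cos (2 * Real.pi * κ) = 2 * Real.cos (Real.pi * κ) ^ 2 - 1 := by
    rw [hy, Real.cos_two_mul]
  have hsin : Real.sin (2 * Real.pi * κ) = 2 * Real.sin (Real.pi * κ) * Real.cos (Real.pi * κ) := by
    rw [hy, Real.sin_two_mul]
  have hsq := Real.sin_sq_add_cos_sq (Real.pi * κ)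
  set s₁ := Real.sin (Real.pi * κ)
  set c₁ := Real.cos (Real.pi * κ)
  set cy := Real.cos (2 * Real.pi * κ)
  set sy := Real.sin (2 * Real.pi * κ)
  have e1 : Real.sin (Real.pi * (k + κ)) ^ 2
      = S ^ 2 * ((1 + cy) / 2 + c * sy + c ^ 2 * (1 - cy) / 2) := by
    rw [mul_add, Real.sin_add, hC, hcos, hsin]
    linear_combination (c ^ 2 * S ^ 2) * hsq
  have e2 : Real.sin (Real.pi * (k + κ)) * Real.cos (Real.pi * (k + κ))
      = S ^ 2 * (c * cy + (c ^ 2 - 1) / 2 * sy) := by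
    rw [mul_add, Real.sin_add, Real.cos_add, hC, hcos, hsin]
    linear_combination (-(c * S ^ 2)) * hsq
  rw [blowUp_eq]
  simp only [equilibrium, Prod.fst_add, Prod.snd_add]
  rw [e1, e2, jacD, jacB, nullEpsilon, ← hS, ← hc]
  set Q := (1 + cy) / 2 + c * sy + c ^ 2 * (1 - cy) / 2 with hQ
  have e3 : c * cy + (c ^ 2 - 1) / 2 * sy = c * Q - (1 + c ^ 2) / 2 * (sy + c * (1 - cy)) := by
    rw [hQ]; ring
  rw [e3]
  clear_value Q cy sy c S s₁ c₁
  set x := 1 / (1 + k)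
  set g := pseudoEpsilon k
  clear_value x g
  have e4 : -3 / 10 - (1 / 2 + (k + κ)) * (g + a * c) + 2 / 5 * (x + ξ)
      = -κ * g - (1 / 2 + k + κ) * (a * c) + 2 / 5 * ξ := by linear_combination -hg
  rw [e4]
  field_simp
  linear_combination (-(1 + 2 * k + 2 * κ) * 5 * a * (sy + c * (1 - cy))) * hone

end LocalForm

/-! ### Normal form of the blow-up system and sign of its Lyapunov coefficient -/

section NormalForm

/-- The coefficients of the normal form of the blow-up system, with `c = cot (π k)`, `m = 1/2 + k`
and `q = (d - σ) / ω`. -/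
noncomputable def normalCoeff (c m σ ω q : ℝ) : Fin 8 → ℝ :=
  let k₀ := (m + σ) * (2 * Real.pi * c) - m * Real.pi * c - 1
  let k₁ := -(ω * (2 * Real.pi * c))
  let k₂ := (m + σ) * (Real.pi ^ 2 * (c ^ 2 - 1)) + 2 * Real.pi ^ 2 / 3 * m - Real.pi * c
  let k₃ := -(ω * (Real.pi ^ 2 * (c ^ 2 - 1)))
  ![k₀, k₁, k₂, k₃, -(q * k₀) - q, -(q * k₁) - 1, -(q * k₂), -(q * k₃)]

/-- The remainders of the normal form of the blow-up system, in terms of the remainders `C` and `D`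
of the cosine and of the sine. -/
noncomputable def normalRem (C D : ℝ → ℝ) (c m σ ω q : ℝ) : Fin 4 → ℝ → ℝ :=
  let R : ℝ → ℝ := fun u => 8 * Real.pi ^ 3 * (c * (-1 / 6 + 2 * Real.pi * u * D (2 * Real.pi * u))
    - (c ^ 2 - 1) / 2 * (2 * Real.pi * u * C (2 * Real.pi * u)))
  let T : ℝ → ℝ := fun u => 8 * Real.pi ^ 3 * (D (2 * Real.pi * u) - c * C (2 * Real.pi * u))
  let a₀ : ℝ → ℝ := fun u => (m + σ) * R u - m * T u + 2 * Real.pi ^ 2 / 3 - u * T u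
  let a₁ : ℝ → ℝ := fun u => -(ω * R u)
  ![a₀, a₁, fun u => -(q * a₀ u), fun u => -(q * a₁ u)]

theorem contDiff_normalRem {C D : ℝ → ℝ} {n : WithTop ℕ∞} (hC : ContDiff ℝ n C)
    (hD : ContDiff ℝ n D) (c m σ ω q : ℝ) (i : Fin 4) : ContDiff ℝ n (normalRem C D c m σ ω q i) := by
  fin_cases i <;> simp [normalRem] <;> fun_prop

/-- The coordinates `u = κ`, `v = -q κ - r ξ` at an equilibrium of the blow-up system, in terms of
the deviations `ξ` of `x` and `κ` of `k`. -/
noncomputable def normalCoord (q r : ℝ) (hr : r ≠ 0) : (ℝ × ℝ) ≃L[ℝ] (ℝ × ℝ) :=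
  LinearEquiv.toContinuousLinearEquiv
    { toFun := fun p => (p.2, -q * p.2 - r * p.1)
      invFun := fun u => (-(u.2 + q * u.1) / r, u.1)
      map_add' := fun p p' => by ext <;> simp; ring
      map_smul' := fun s p => by ext <;> simp; ring
      left_inv := fun p => by ext <;> simp; field_simp
      right_inv := fun u => by ext <;> simp; field_simp; ring }

theorem normalCoord_apply {q r : ℝ} (hr : r ≠ 0) (p : ℝ × ℝ) :
    normalCoord q r hr p = (p.2, -q * p.2 - r * p.1) := rfl

theorem normalCoord_symm_apply {q r : ℝ} (hr : r ≠ 0) (u : ℝ × ℝ) :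
    (normalCoord q r hr).symm u = (-(u.2 + q * u.1) / r, u.1) := rfl

theorem jacB_pos {k a : ℝ} (hk : k ∈ Ioo (0 : ℝ) 1) (ha : 0 < a) : 0 < jacB k a := by
  have := sin_pi_mul_pos hk
  have := Real.pi_pos
  unfold jacB
  positivity

/-- As the field is affine in `x` and `v` is affine in the deviation of `x`, nonlinear terms are
affine in `v`. The only nonlinearity of `x'` is the product of the two deviations; it produces the
extra `-q` and `-1` in the coefficients of `u²` and `uv` of the second component. -/
theorem conjField_blowUp {C D : ℝ → ℝ} (hC : ∀ x, Real.cos x = 1 - x ^ 2 / 2 + x ^ 4 * C x)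
    (hD : ∀ x, Real.sin x = x - x ^ 3 / 6 + x ^ 4 * D x) {k a ω : ℝ} (hk : k ∈ Ioo (0 : ℝ) 1)
    (ha : 0 < a) (hω : 0 < ω) (hdet : ω ^ 2 = jacDet k a - halfTrace k a ^ 2)
    (hr : jacB k a / ω ≠ 0) :
    conjField (blowUp (nullEpsilon k a) a) (equilibrium k)
        (normalCoord ((jacD k a - halfTrace k a) / ω) (jacB k a / ω) hr)
      = cubicField (halfTrace k a) ω
        (normalCoeff (Real.cot (Real.pi * k)) (1 / 2 + k) (halfTrace k a) ω
          ((jacD k a - halfTrace k a) / ω))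
        (normalRem C D (Real.cot (Real.pi * k)) (1 / 2 + k) (halfTrace k a) ω
          ((jacD k a - halfTrace k a) / ω)) := by
  funext p
  obtain ⟨u, v⟩ := p
  have hb := (jacB_pos hk ha).ne'
  have hpi := Real.pi_ne_zero
  have hk0 : 1 + k ≠ 0 := by linarith [hk.1]
  have hω' := hω.ne'
  have hsnd := blowUp_snd_centred hk ha (-(v + (jacD k a - halfTrace k a) / ω * u) / (jacB k a / ω)) u
  have htr : 1 + k = jacD k a - 2 * halfTrace k a := by rw [halfTrace]; ring
  rw [jacDet] at hdet
  set d := jacD k a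
  set b := jacB k a
  set σ := halfTrace k a
  set q := (d - σ) / ω with hq
  have hqω : q * ω = d - σ := by rw [hq]; field_simp
  clear_value q
  have hfst : (blowUp (nullEpsilon k a) a (equilibrium k + (-(v + q * u) / (b / ω), u))).1
      = 1 - (1 + k + u) * (1 / (1 + k) + -(v + q * u) / (b / ω)) := by
    simp only [blowUp, equilibrium, Prod.fst_add, Prod.snd_add]
    ring
  rw [hC, hD] at hsnd
  set c := Real.cot (Real.pi * k)
  rw [conjField, normalCoord_symm_apply, normalCoord_apply, hfst]
  set Y := (blowUp (nullEpsilon k a) a (equilibrium k + (-(v + q * u) / (b / ω), u))).2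
  -- Coupling to `x` enters only through this linear form; substituting `v` for `ξ` turns it into
  -- the linear part `σu - ωv` plus the term `(1/2 + k)u`, which the sine term compensates.
  have hlin : (d + (1 / 2 + k)) * u + b * (-(v + q * u) / (b / ω))
      = (1 / 2 + k + σ) * u - ω * v := by
    field_simp
    linear_combination -2 * u * hqω
  rw [hlin] at hsnd
  have hY : Y = (cubicField σ ω (normalCoeff c (1 / 2 + k) σ ω q)
      (normalRem C D c (1 / 2 + k) σ ω q) (u, v)).1 := by
    rw [hsnd]
    simp only [cubicField, normalCoeff, normalRem, Matrix.cons_val]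
    field_simp
    ring
  ext
  · exact hY
  · have hr : b / ω * (1 - (1 + k + u) * (1 / (1 + k) + -(v + q * u) / (b / ω)))
        = (1 + k + u) * (v + q * u) - u * (b / (1 + k)) / ω := by
      field_simp
      ring
    -- By the choice of `ω`, the product of the off-diagonal Jacobian entries is `-(ω² + (d - σ)²)`;
    -- this makes the linear part a rotation plus `σ`.
    have hb' : b / (1 + k) = ω ^ 2 + (d - σ) ^ 2 := by
      rw [hdet, htr]
      ring
    simp only
    rw [hr, hb', hY, htr]
    simp only [cubicField, normalCoeff, normalRem, Matrix.cons_val]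
    have hx : u * (ω ^ 2 + (d - σ) ^ 2) / ω = u * ω + u * q * (d - σ) := by
      rw [hq]; field_simp
    rw [hx]
    linear_combination v * hqω

/-- The first Lyapunov coefficient at an equilibrium with `σ = 0`. -/
theorem cubicLyapunov_normalCoeff (c m ω d : ℝ) (hω : ω ≠ 0) :
    cubicLyapunov ω (normalCoeff c m 0 ω (d / ω))
      = (1 / 8) * (-Real.pi ^ 2 * (m + d) * (1 - c ^ 2) - Real.pi * c
        + d / ω ^ 2 * (Real.pi * c * m * (2 * Real.pi * c * (d + m) - 3))) := by
  simp only [cubicLyapunov, normalCoeff, Matrix.cons_val]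
  field_simp
  ring

/-- The terms `-πc` and `-3` only help. The rest is `π²(m + d)` times at most `d m c² / 2 - (1 -
c²)`, because `ω² ≥ 4`; with `d m ≤ 3/2` and `c² ≤ 49/100` the bracket is negative. -/
theorem cubicLyapunov_normalCoeff_neg {c m ω d : ℝ} (hc : c ∈ Icc (0 : ℝ) (7 / 10))
    (hm : m ∈ Icc (3 / 4 : ℝ) 1) (hd : d ∈ Icc (5 / 4 : ℝ) (3 / 2)) (hω : 4 ≤ ω ^ 2) :
    cubicLyapunov ω (normalCoeff c m 0 ω (d / ω)) < 0 := by
  have hω0 : ω ≠ 0 := by rintro rfl; norm_num at hω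
  rw [cubicLyapunov_normalCoeff c m ω d hω0]
  have hpi := Real.pi_pos
  have h1 : c ^ 2 ≤ 49 / 100 := by nlinarith [hc.1, hc.2]
  have hc0 := hc.1
  have hm0 : 0 ≤ m := by linarith [hm.1]
  have hd0 : 0 ≤ d := by linarith [hd.1]
  have h2 : d / ω ^ 2 * (Real.pi * c * m * (2 * Real.pi * c * (d + m) - 3))
      ≤ d / 4 * (Real.pi * c * m * (2 * Real.pi * c * (d + m))) := by
    have : Real.pi * c * m * (2 * Real.pi * c * (d + m) - 3)
        ≤ Real.pi * c * m * (2 * Real.pi * c * (d + m)) :=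
      mul_le_mul_of_nonneg_left (by linarith) (by positivity)
    refine (mul_le_mul_of_nonneg_left this (by positivity)).trans ?_
    refine mul_le_mul_of_nonneg_right ?_ (by positivity)
    exact div_le_div_of_nonneg_left hd0 (by norm_num) hω
  have h3 : d * m ≤ 3 / 2 := by nlinarith [hm.2, hd.2]
  have h4 : d / 4 * (Real.pi * c * m * (2 * Real.pi * c * (d + m)))
      = Real.pi ^ 2 * (d + m) * (d * m / 2 * c ^ 2) := by ring
  have h5 : d * m / 2 * c ^ 2 ≤ 3 / 4 * (49 / 100) := by
    have : 0 ≤ c ^ 2 := sq_nonneg c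
    nlinarith [mul_nonneg hd0 hm0]
  have h6 : 0 < Real.pi ^ 2 * (d + m) := by
    have : 0 < d + m := by linarith [hd.1]
    positivity
  have h7 : Real.pi ^ 2 * (d + m) * (d * m / 2 * c ^ 2 - (1 - c ^ 2)) < 0 :=
    mul_neg_of_pos_of_neg h6 (by linarith)
  have h8 : 0 ≤ Real.pi * c := by positivity
  rw [h4] at h2
  linarith

/-- Smooth families of functions are locally uniformly bounded and Lipschitz on `[-1, 1]`. -/
theorem exists_uniform_bound_lipschitz {P : Type*} [NormedAddCommGroup P] [NormedSpace ℝ P]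
    [ProperSpace P] {F : P × ℝ → ℝ} (hF : ContDiff ℝ 1 F) (V₀ : P) :
    ∃ M : ℝ, ∀ᶠ V in 𝓝 V₀, (∀ x ∈ Icc (-1 : ℝ) 1, |F (V, x)| ≤ M) ∧
      ∀ x ∈ Icc (-1 : ℝ) 1, ∀ y ∈ Icc (-1 : ℝ) 1, |F (V, x) - F (V, y)| ≤ M * |x - y| := by
  have hcomp : IsCompact (Metric.closedBall V₀ 1 ×ˢ Icc (-1 : ℝ) 1) :=
    (isCompact_closedBall V₀ 1).prod isCompact_Icc
  have hconv : Convex ℝ (Metric.closedBall V₀ 1 ×ˢ Icc (-1 : ℝ) 1) :=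
    (convex_closedBall V₀ 1).prod (convex_Icc _ _)
  obtain ⟨B, hB⟩ := hcomp.exists_bound_of_continuousOn hF.continuous.continuousOn
  obtain ⟨K, hK⟩ := hcomp.exists_bound_of_continuousOn
    (hF.continuous_fderiv one_ne_zero).continuousOn
  refine ⟨max B K, ?_⟩
  filter_upwards [Metric.closedBall_mem_nhds V₀ one_pos] with V hV
  refine ⟨fun x hx => (hB (V, x) ⟨hV, hx⟩).trans (le_max_left _ _), fun x hx y hy => ?_⟩
  have h := hconv.norm_image_sub_le_of_norm_fderiv_le
    (fun p _ => hF.differentiable one_ne_zero p) hK (x := (V, y)) (y := (V, x))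
    ⟨hV, hy⟩ ⟨hV, hx⟩
  have e : ‖((V, x) : P × ℝ) - (V, y)‖ = |x - y| := by simp [Prod.norm_def]
  rw [e] at h
  exact h.trans (mul_le_mul_of_nonneg_right (le_max_right _ _) (abs_nonneg _))

end NormalForm

/-! ### Jacobian at the equilibrium, its eigenvalues and stability -/

section Jacobian

/-- Differentiability is known from smoothness, so the two partial derivatives identify the
differential. -/
theorem hasFDerivAt_of_partials {F : ℝ × ℝ → ℝ} {e : ℝ × ℝ} {A B : ℝ}
    (hF : DifferentiableAt ℝ F e) (hA : HasDerivAt (fun ξ : ℝ => F (e + (ξ, 0))) A 0)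
    (hB : HasDerivAt (fun κ : ℝ => F (e + (0, κ))) B 0) :
    HasFDerivAt F (A • ContinuousLinearMap.fst ℝ ℝ ℝ + B • ContinuousLinearMap.snd ℝ ℝ ℝ) e := by
  have h := hF.hasFDerivAt
  have h0 : HasFDerivAt F (fderiv ℝ F e) (e + ((0 : ℝ), (0 : ℝ))) := by
    rwa [Prod.mk_zero_zero, add_zero]
  have hA' : fderiv ℝ F e (1, 0) = A := by
    refine HasDerivAt.unique ?_ hA
    exact h0.comp_hasDerivAt (0 : ℝ) (((hasDerivAt_id (0 : ℝ)).prodMk (hasDerivAt_const _ _)).const_add e)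
  have hB' : fderiv ℝ F e (0, 1) = B := by
    refine HasDerivAt.unique ?_ hB
    exact h0.comp_hasDerivAt (0 : ℝ) (((hasDerivAt_const _ _).prodMk (hasDerivAt_id (0 : ℝ))).const_add e)
  refine h.congr_fderiv ?_
  ext
  · simp [hA']
  · simp [hB']

theorem hasFDerivAt_blowUp {k a : ℝ} (hk : k ∈ Ioo (0 : ℝ) 1) (ha : 0 < a) :
    HasFDerivAt (blowUp (nullEpsilon k a) a)
      (((-(1 + k)) • ContinuousLinearMap.fst ℝ ℝ ℝ
          + (-(1 / (1 + k))) • ContinuousLinearMap.snd ℝ ℝ ℝ).prod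
        (jacB k a • ContinuousLinearMap.fst ℝ ℝ ℝ + jacD k a • ContinuousLinearMap.snd ℝ ℝ ℝ))
      (equilibrium k) := by
  have hd : DifferentiableAt ℝ (blowUp (nullEpsilon k a) a) (equilibrium k) :=
    ((contDiff_blowUp _ _ (n := 1)).differentiable one_ne_zero) _
  have h1 := hasFDerivAt_of_partials (F := fun p => (blowUp (nullEpsilon k a) a p).1)
    (e := equilibrium k) (A := -(1 + k)) (B := -(1 / (1 + k))) hd.fst
    (by
      simp only [blowUp, equilibrium, Prod.fst_add, Prod.snd_add, add_zero]
      have := ((hasDerivAt_id (0 : ℝ)).const_add (1 / (1 + k)))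
      refine ((this.const_sub 1).sub (this.const_mul k)).congr_deriv ?_
      ring)
    (by
      simp only [blowUp, equilibrium, Prod.fst_add, Prod.snd_add, add_zero]
      have := ((hasDerivAt_id (0 : ℝ)).const_add k)
      refine ((this.mul_const (1 / (1 + k))).const_sub (1 - 1 / (1 + k))).congr_deriv ?_
      ring)
  have h2 := hasFDerivAt_of_partials (F := fun p => (blowUp (nullEpsilon k a) a p).2)
    (e := equilibrium k) (A := jacB k a) (B := jacD k a) hd.snd
    (by
      simp only [blowUp_snd_centred hk ha]
      have := ((hasDerivAt_id (0 : ℝ)).const_mul (jacB k a))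
      simpa using this)
    (by
      simp only [blowUp_snd_centred hk ha]
      have hy : HasDerivAt (fun κ : ℝ => 2 * Real.pi * κ) (2 * Real.pi) 0 := by
        simpa using (hasDerivAt_id (0 : ℝ)).const_mul (2 * Real.pi)
      have hc := hy.cos
      have hs := hy.sin
      have hl := (((hasDerivAt_id (0 : ℝ)).const_mul (jacD k a + (1 / 2 + k))).add_const
        (jacB k a * 0))
      have hm := (((hasDerivAt_id (0 : ℝ)).const_add (1 / 2 + k)).div_const (2 * Real.pi))
      have h := (((((hc.const_add 1).div_const 2).add (hs.const_mul (Real.cot (Real.pi * k)))).add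
        (((hc.const_sub 1).const_mul (Real.cot (Real.pi * k) ^ 2)).div_const 2)).mul hl).sub
        (hm.mul (hs.add ((hc.const_sub 1).const_mul (Real.cot (Real.pi * k)))))
      refine h.congr_deriv ?_
      have := Real.pi_ne_zero
      simp)
  exact h1.prodMk h2

/-- Once simplified, the bracket has numerator `3 + 2k - 3k²`, positive on `(0, 1)`. Hence saddles
never occur and the trace alone decides stability. -/
theorem jacDet_pos {k a : ℝ} (hk : k ∈ Ioo (0 : ℝ) 1) (ha : 0 < a) : 0 < jacDet k a := by
  have hs := sin_pi_mul_pos hk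
  have hpi := Real.pi_pos
  have hk0 := hk.1
  have h : jacDet k a = Real.sin (Real.pi * k) ^ 2 / (a * Real.pi)
      * ((3 + 2 * k - 3 * k ^ 2) / (5 * (1 + 2 * k) * (1 + k))) + (1 + k) * (1 / 2 + k) := by
    rw [jacDet, jacD, jacB, pseudoEpsilon]
    field_simp
    ring
  have h1 : 0 < 3 + 2 * k - 3 * k ^ 2 := by nlinarith [hk.1, hk.2]
  rw [h]
  positivity

theorem blowUp_equilibrium {k a : ℝ} (hk : k ∈ Ioo (0 : ℝ) 1) (ha : 0 < a) :
    blowUp (nullEpsilon k a) a (equilibrium k) = 0 :=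
  (blowUp_eq_zero_iff ha hk).2 ⟨rfl, rfl⟩

theorem asymptoticallyStable_equilibrium {k a : ℝ} (hk : k ∈ Ioo (0 : ℝ) 1) (ha : 0 < a)
    (h : halfTrace k a < 0) : AsymptoticallyStable (blowUp (nullEpsilon k a) a) {equilibrium k} := by
  rw [halfTrace] at h
  have hdet := jacDet_pos hk ha
  have hk0 := hk.1
  refine asymptoticallyStable_of_linearization (contDiff_blowUp _ _) (blowUp_equilibrium hk ha)
    (hasFDerivAt_blowUp hk ha) (by linarith) ?_
  rw [jacDet] at hdet
  refine hdet.trans_eq ?_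
  ring

theorem not_lyapunovStable_equilibrium {k a : ℝ} (hk : k ∈ Ioo (0 : ℝ) 1) (ha : 0 < a)
    (h : 0 < halfTrace k a) : ¬ LyapunovStable (blowUp (nullEpsilon k a) a) {equilibrium k} := by
  rw [halfTrace] at h
  have hdet := jacDet_pos hk ha
  have hk0 := hk.1
  refine not_lyapunovStable_of_linearization (contDiff_blowUp _ _) (blowUp_equilibrium hk ha)
    (hasFDerivAt_blowUp hk ha) (by linarith) ?_
  rw [jacDet] at hdet
  refine hdet.trans_eq ?_
  ring

theorem charpoly_planar (a b c d : ℝ) :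
    LinearMap.charpoly (((a • ContinuousLinearMap.fst ℝ ℝ ℝ + b • ContinuousLinearMap.snd ℝ ℝ ℝ).prod
      (c • ContinuousLinearMap.fst ℝ ℝ ℝ + d • ContinuousLinearMap.snd ℝ ℝ ℝ) :
        ℝ × ℝ →L[ℝ] ℝ × ℝ) : ℝ × ℝ →ₗ[ℝ] ℝ × ℝ)
      = Polynomial.X ^ 2 - Polynomial.C (a + d) * Polynomial.X + Polynomial.C (a * d - b * c) := by
  rw [← LinearMap.charpoly_toMatrix _ (Module.Basis.finTwoProd ℝ), Matrix.charpoly_fin_two,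
    Matrix.trace_fin_two, Matrix.det_fin_two]
  simp [LinearMap.toMatrix_apply]

theorem aroots_quadratic {t δ σ ω : ℝ} (ht : t = 2 * σ) (hδ : δ = σ ^ 2 + ω ^ 2) :
    (Polynomial.X ^ 2 - Polynomial.C t * Polynomial.X + Polynomial.C δ : Polynomial ℝ).aroots ℂ
      = {(⟨σ, ω⟩ : ℂ), (⟨σ, -ω⟩ : ℂ)} := by
  have h : (Polynomial.X ^ 2 - Polynomial.C t * Polynomial.X + Polynomial.C δ : Polynomial ℝ).map
      (algebraMap ℝ ℂ) = ((({(⟨σ, ω⟩ : ℂ), (⟨σ, -ω⟩ : ℂ)} : Multiset ℂ).map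
        fun z => Polynomial.X - Polynomial.C z)).prod := by
    have h1 : (t : ℂ) = (⟨σ, ω⟩ : ℂ) + ⟨σ, -ω⟩ := by
      apply Complex.ext <;> simp [ht]; ring
    have h2 : (δ : ℂ) = (⟨σ, ω⟩ : ℂ) * ⟨σ, -ω⟩ := by
      apply Complex.ext
      · rw [Complex.ofReal_re, Complex.mul_re, hδ]; ring
      · rw [Complex.ofReal_im, Complex.mul_im]; ring
    simp only [Polynomial.map_add, Polynomial.map_sub, Polynomial.map_mul, Polynomial.map_pow,
      Polynomial.map_X, Polynomial.map_C, Complex.coe_algebraMap, h1, h2, Multiset.insert_eq_cons,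
      Multiset.map_cons, Multiset.map_singleton, Multiset.prod_cons, Multiset.prod_singleton,
      Polynomial.C_add, Polynomial.C_mul]
    ring
  rw [Polynomial.aroots, h, Polynomial.roots_multiset_prod_X_sub_C]

/-- The eigenvalues of the Jacobian at the equilibrium. -/
theorem aroots_charpoly_blowUp {k a ω : ℝ} (hk : k ∈ Ioo (0 : ℝ) 1) (ha : 0 < a)
    (hω : ω ^ 2 = jacDet k a - halfTrace k a ^ 2) :
    (LinearMap.charpoly ((fderiv ℝ (blowUp (nullEpsilon k a) a) (equilibrium k) :
        ℝ × ℝ →L[ℝ] ℝ × ℝ) : ℝ × ℝ →ₗ[ℝ] ℝ × ℝ)).aroots ℂ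
      = {(⟨halfTrace k a, ω⟩ : ℂ), (⟨halfTrace k a, -ω⟩ : ℂ)} := by
  rw [(hasFDerivAt_blowUp hk ha).fderiv, charpoly_planar]
  refine aroots_quadratic ?_ ?_
  · rw [halfTrace]; ring
  · rw [hω, jacDet]; ring

end Jacobian

/-! ### Continuity of the local data in the mixing rate -/

section Continuity

theorem continuousAt_cot_pi {k : ℝ} (hk : k ∈ Ioo (0 : ℝ) 1) :
    ContinuousAt (fun k => Real.cot (Real.pi * k)) k := by
  have := (sin_pi_mul_pos hk).ne'
  simp only [Real.cot_eq_cos_div_sin]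
  fun_prop (disch := assumption)

theorem continuousAt_pseudoEpsilon {k : ℝ} (hk : k ∈ Ioo (0 : ℝ) 1) :
    ContinuousAt pseudoEpsilon k := by
  have hk0 := hk.1
  have : 5 * (1 + k) * (1 + 2 * k) ≠ 0 := by positivity
  unfold pseudoEpsilon
  fun_prop (disch := assumption)

theorem continuousAt_jacB {k a : ℝ} : ContinuousAt (fun k => jacB k a) k := by
  unfold jacB
  fun_prop

theorem continuousAt_jacD {k a : ℝ} (hk : k ∈ Ioo (0 : ℝ) 1) :
    ContinuousAt (fun k => jacD k a) k := by
  have := continuousAt_pseudoEpsilon hk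
  unfold jacD
  fun_prop

theorem continuousAt_halfTrace {k a : ℝ} (hk : k ∈ Ioo (0 : ℝ) 1) :
    ContinuousAt (fun k => halfTrace k a) k := by
  have := continuousAt_jacD (a := a) hk
  unfold halfTrace
  fun_prop

theorem continuousAt_jacDet {k a : ℝ} (hk : k ∈ Ioo (0 : ℝ) 1) :
    ContinuousAt (fun k => jacDet k a) k := by
  have h1 := continuousAt_jacD (a := a) hk
  have h2 := continuousAt_jacB (k := k) (a := a)
  have hk0 := hk.1
  have h3 : 1 + k ≠ 0 := by positivity
  unfold jacDet
  fun_prop (disch := assumption)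

theorem continuousAt_equilibrium {k : ℝ} (hk : k ∈ Ioo (0 : ℝ) 1) : ContinuousAt equilibrium k := by
  have hk0 := hk.1
  have h3 : 1 + k ≠ 0 := by positivity
  unfold equilibrium
  fun_prop (disch := assumption)

end Continuity

/-! ### Stable cycles of the blow-up system, parametrized by the mixing rate -/

section Cycle

/-- The frequency at the equilibrium. -/
noncomputable def freq (k a : ℝ) : ℝ := √(jacDet k a - halfTrace k a ^ 2)

theorem exists_bound_eventually_of_continuousAt {f : ℝ → ℝ} {x : ℝ} (hf : ContinuousAt f x) :
    ∃ M, ∀ᶠ y in 𝓝 x, |f y| ≤ M :=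
  ⟨|f x| + 1, (hf.abs.eventually (gt_mem_nhds (lt_add_one _))).mono fun _ h => h.le⟩

/-- The stable periodic orbits that are born at an equilibrium with a pair of imaginary eigenvalues
and a negative first Lyapunov coefficient. -/
theorem exists_stable_orbit_blowUp {k₀ a : ℝ} (hk₀ : k₀ ∈ Ioo (0 : ℝ) 1) (ha : 0 < a)
    (hσ : halfTrace k₀ a = 0)
    (hℓ : cubicLyapunov (freq k₀ a) (normalCoeff (Real.cot (Real.pi * k₀)) (1 / 2 + k₀) 0
      (freq k₀ a) (jacD k₀ a / freq k₀ a)) < 0) :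
    ∃ Γ : ℝ → Set (ℝ × ℝ),
      (∀ᶠ k in 𝓝 k₀, 0 < halfTrace k a → IsPeriodicOrbit (blowUp (nullEpsilon k a) a) (Γ k) ∧
        AsymptoticallyStable (blowUp (nullEpsilon k a) a) (Γ k)) ∧
      ∀ U ∈ 𝓝 (equilibrium k₀), ∀ᶠ k in 𝓝 k₀, 0 < halfTrace k a → Γ k ⊆ U := by
  classical
  obtain ⟨C, hCs, hC⟩ := exists_cos_taylor
  obtain ⟨D, hDs, hD⟩ := exists_sin_taylor
  have cσ := continuousAt_halfTrace (a := a) hk₀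
  have cdet := continuousAt_jacDet (a := a) hk₀
  have cd := continuousAt_jacD (a := a) hk₀
  have cb := continuousAt_jacB (k := k₀) (a := a)
  have cc := continuousAt_cot_pi hk₀
  have ce := continuousAt_equilibrium hk₀
  have hpos : 0 < jacDet k₀ a - halfTrace k₀ a ^ 2 := by
    rw [hσ]; simpa using jacDet_pos hk₀ ha
  have hω₀ : 0 < freq k₀ a := Real.sqrt_pos.2 hpos
  have cω : ContinuousAt (fun k => freq k a) k₀ := by unfold freq; fun_prop
  have hω₀' := hω₀.ne'
  set q : ℝ → ℝ := fun k => (jacD k a - halfTrace k a) / freq k a with hq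
  set r : ℝ → ℝ := fun k => jacB k a / freq k a with hr
  have cq : ContinuousAt q k₀ := by fun_prop (disch := assumption)
  have cr : ContinuousAt r k₀ := by fun_prop (disch := assumption)
  have hr₀ : r k₀ ≠ 0 := (div_pos (jacB_pos hk₀ ha) hω₀).ne'
  -- The remainders depend on `k` through these five numbers only, and smoothly, so continuity of
  -- `V` gives uniform bounds near `k₀`.
  set V : ℝ → ℝ × ℝ × ℝ × ℝ × ℝ := fun k =>
    (Real.cot (Real.pi * k), 1 / 2 + k, halfTrace k a, freq k a, q k) with hV
  have cV : ContinuousAt V k₀ := by fun_prop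
  set N : ℝ → Fin 8 → ℝ := fun k => normalCoeff (Real.cot (Real.pi * k)) (1 / 2 + k) (halfTrace k a)
    (freq k a) (q k) with hN
  have cN : ∀ i, ContinuousAt (fun k => N k i) k₀ := by
    intro i
    fin_cases i <;> simp only [hN, normalCoeff] <;> simp <;> fun_prop
  have cℓ : ContinuousAt (fun k => cubicLyapunov (freq k a) (N k)) k₀ := by
    have c0 := cN 0
    have c1 := cN 1
    have c2 := cN 2
    have c4 := cN 4
    have c5 := cN 5
    have c7 := cN 7
    unfold cubicLyapunov
    fun_prop (disch := assumption)
  have hrem : ∀ i, ∃ M : ℝ, ∀ᶠ k in 𝓝 k₀,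
      (∀ x ∈ Icc (-1 : ℝ) 1, |normalRem C D (Real.cot (Real.pi * k)) (1 / 2 + k) (halfTrace k a)
        (freq k a) (q k) i x| ≤ M) ∧
      ∀ x ∈ Icc (-1 : ℝ) 1, ∀ y ∈ Icc (-1 : ℝ) 1,
        |normalRem C D (Real.cot (Real.pi * k)) (1 / 2 + k) (halfTrace k a) (freq k a) (q k) i x
          - normalRem C D (Real.cot (Real.pi * k)) (1 / 2 + k) (halfTrace k a) (freq k a) (q k) i y|
          ≤ M * |x - y| := by
    intro i
    have hC1 : ContDiff ℝ 1 C := hCs.of_le le_top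
    have hD1 : ContDiff ℝ 1 D := hDs.of_le le_top
    have hF : ContDiff ℝ 1 fun p : (ℝ × ℝ × ℝ × ℝ × ℝ) × ℝ =>
        normalRem C D p.1.1 p.1.2.1 p.1.2.2.1 p.1.2.2.2.1 p.1.2.2.2.2 i p.2 := by
      fin_cases i <;> simp [normalRem] <;> fun_prop
    obtain ⟨M, hM⟩ := exists_uniform_bound_lipschitz hF (V k₀)
    exact ⟨M, cV.eventually hM⟩
  choose M₁ hM₁ using hrem
  choose M₂ hM₂ using fun i => exists_bound_eventually_of_continuousAt (cN i)
  obtain ⟨M, hM1, hM2, hM3, hM4⟩ : ∃ M : ℝ, 0 < M ∧ (∀ i, M₁ i ≤ M) ∧ (∀ i, M₂ i ≤ M) ∧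
      freq k₀ a + 1 ≤ M := by
    refine ⟨freq k₀ a + 1 + ∑ i, |M₁ i| + ∑ i, |M₂ i|, by positivity, fun i => ?_, fun i => ?_, ?_⟩
    · have := Finset.single_le_sum (f := fun i => |M₁ i|) (fun _ _ => abs_nonneg _)
        (Finset.mem_univ i)
      have h2 : 0 ≤ ∑ i, |M₂ i| := Finset.sum_nonneg fun _ _ => abs_nonneg _
      have := le_abs_self (M₁ i)
      linarith
    · have := Finset.single_le_sum (f := fun i => |M₂ i|) (fun _ _ => abs_nonneg _)
        (Finset.mem_univ i)
      have h2 : 0 ≤ ∑ i, |M₁ i| := Finset.sum_nonneg fun _ _ => abs_nonneg _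
      have := le_abs_self (M₂ i)
      linarith
    · have h1 : 0 ≤ ∑ i, |M₁ i| := Finset.sum_nonneg fun _ _ => abs_nonneg _
      have h2 : 0 ≤ ∑ i, |M₂ i| := Finset.sum_nonneg fun _ _ => abs_nonneg _
      linarith
  set ℓ := cubicLyapunov (freq k₀ a) (N k₀) with hℓd
  have hℓ' : ℓ < 0 := by
    simp only [hℓd, hN, hq, hσ, sub_zero]
    exact hℓ
  -- Halving the frequency and the Lyapunov coefficient at `k₀` leaves bounds that persist in a
  -- neighbourhood of `k₀`.
  obtain ⟨δ₀, hδ₀, X, hX, horb⟩ := exists_stable_orbit_cubicField (M := M) (ω₀ := freq k₀ a / 2)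
    (ℓ₀ := -(ℓ / 2)) hM1 (by positivity) (by linarith)
  set Ψ : ℝ → ℝ × ℝ → ℝ × ℝ := fun k u => equilibrium k + (-(u.2 + q k * u.1) / r k, u.1) with hΨ
  set Good : ℝ → Set (ℝ × ℝ) → Prop := fun k Γ =>
    (IsPeriodicOrbit (blowUp (nullEpsilon k a) a) Γ ∧
      AsymptoticallyStable (blowUp (nullEpsilon k a) a) Γ) ∧
      Γ ⊆ Ψ k '' Metric.closedBall 0 (X * √(halfTrace k a)) with hGood
  have hsqrt : Tendsto (fun k => √(halfTrace k a)) (𝓝 k₀) (𝓝 0) := by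
    have := cσ.sqrt.tendsto
    rwa [hσ, Real.sqrt_zero] at this
  have key : ∀ᶠ k in 𝓝 k₀, 0 < halfTrace k a → ∃ Γ, Good k Γ := by
    have hk : ∀ᶠ k in 𝓝 k₀, k ∈ Ioo (0 : ℝ) 1 := isOpen_Ioo.mem_nhds hk₀
    have hdet : ∀ᶠ k in 𝓝 k₀, 0 < jacDet k a - halfTrace k a ^ 2 :=
      (cdet.sub (cσ.pow 2)).eventually (lt_mem_nhds hpos)
    have hω1 : ∀ᶠ k in 𝓝 k₀, freq k₀ a / 2 < freq k a :=
      cω.eventually (lt_mem_nhds (by linarith))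
    have hω2 : ∀ᶠ k in 𝓝 k₀, freq k a < freq k₀ a + 1 :=
      cω.eventually (gt_mem_nhds (by linarith))
    have hδ : ∀ᶠ k in 𝓝 k₀, √(halfTrace k a) < δ₀ := hsqrt.eventually (gt_mem_nhds hδ₀)
    have hℓe : ∀ᶠ k in 𝓝 k₀, cubicLyapunov (freq k a) (N k) < ℓ / 2 :=
      cℓ.eventually (gt_mem_nhds (by linarith))
    filter_upwards [hk, hdet, hω1, hω2, hδ, hℓe, eventually_all.2 hM₁, eventually_all.2 hM₂]
      with k hk hdet hω1 hω2 hδ hℓe h₁ h₂ hσk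
    have hωk : 0 < freq k a := by linarith
    have hrk : jacB k a / freq k a ≠ 0 := (div_pos (jacB_pos hk ha) hωk).ne'
    have hconj := conjField_blowUp hC hD hk ha hωk (Real.sq_sqrt hdet.le) hrk
    have hsq : √(halfTrace k a) ^ 2 = halfTrace k a := Real.sq_sqrt hσk.le
    have hrs := fun i => contDiff_normalRem hCs hDs (Real.cot (Real.pi * k)) (1 / 2 + k)
      (halfTrace k a) (freq k a) (q k) i
    obtain ⟨Γ, hΓ, hper, hst⟩ := horb (√(halfTrace k a)) ⟨Real.sqrt_pos.2 hσk, hδ⟩ (freq k a)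
      ⟨hω1.le, by linarith⟩ (N k)
      (normalRem C D (Real.cot (Real.pi * k)) (1 / 2 + k) (halfTrace k a) (freq k a) (q k))
      (fun i => (h₂ i).trans (hM3 i)) (fun i x hx => ((h₁ i).1 x hx).trans (hM2 i))
      (fun i x hx y hy => ((h₁ i).2 x hx y hy).trans
        (mul_le_mul_of_nonneg_right (hM2 i) (abs_nonneg _))) (by linarith)
      ((contDiff_cubicField hrs).of_le le_top)
    rw [hsq] at hper hst
    rw [← hconj] at hper hst
    refine ⟨_, ⟨isPeriodicOrbit_of_conjField hper, asymptoticallyStable_of_conjField hst⟩, ?_⟩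
    exact image_mono hΓ
  -- A choice for each `k`; the value `∅` is never used where `key` supplies an orbit. The inclusion
  -- recorded in `Good` makes the chosen orbits shrink.
  refine ⟨fun k => if h : ∃ Γ, Good k Γ then h.choose else ∅, ?_, fun U hU => ?_⟩
  · filter_upwards [key] with k hk hσk
    rw [dif_pos (hk hσk)]
    exact (hk hσk).choose_spec.1
  · have cΨ : ContinuousAt (fun p : ℝ × (ℝ × ℝ) => Ψ p.1 p.2) (k₀, 0) := by
      have ce' : ContinuousAt (fun p : ℝ × (ℝ × ℝ) => equilibrium p.1) (k₀, 0) :=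
        ContinuousAt.comp (f := Prod.fst) (g := equilibrium) ce continuousAt_fst
      have cq' : ContinuousAt (fun p : ℝ × (ℝ × ℝ) => q p.1) (k₀, 0) :=
        ContinuousAt.comp (f := Prod.fst) (g := q) cq continuousAt_fst
      have cr' : ContinuousAt (fun p : ℝ × (ℝ × ℝ) => r p.1) (k₀, 0) :=
        ContinuousAt.comp (f := Prod.fst) (g := r) cr continuousAt_fst
      simp only [hΨ]
      fun_prop (disch := assumption)
    have hU' : ∀ᶠ p : ℝ × (ℝ × ℝ) in 𝓝 k₀ ×ˢ 𝓝 0, Ψ p.1 p.2 ∈ U := by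
      rw [← nhds_prod_eq]
      refine cΨ.eventually_mem ?_
      simpa only [hΨ, Prod.fst_zero, Prod.snd_zero, mul_zero, add_zero, neg_zero, zero_div,
        Prod.mk_zero_zero] using hU
    obtain ⟨P, hP, Q, hQ, hPQ⟩ := eventually_prod_iff.1 hU'
    obtain ⟨ρ, hρ, hball⟩ := Metric.eventually_nhds_iff_ball.1 hQ
    have hXs : ∀ᶠ k in 𝓝 k₀, X * √(halfTrace k a) < ρ := by
      have := hsqrt.const_mul X
      rw [mul_zero] at this
      exact this.eventually (gt_mem_nhds hρ)
    filter_upwards [key, hP, hXs] with k hk hPk hXk hσk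
    rw [dif_pos (hk hσk)]
    refine (hk hσk).choose_spec.2.trans ?_
    rintro _ ⟨u, hu, rfl⟩
    exact hPQ hPk (hball u (Metric.closedBall_subset_ball hXk hu))

end Cycle

section Branch

/-! ### The branch of equilibria -/

/-- Both summands decrease: `cot(πk)` does, and the numerator of `g'` is `30k² - 20k - 30`, negative
on `(0, 1)`. -/
theorem exists_hasDerivAt_nullEpsilon {k a : ℝ} (hk : k ∈ Ioo (0 : ℝ) 1) (ha : 0 < a) :
    ∃ s < 0, HasDerivAt (fun k => nullEpsilon k a) s k := by
  have hk0 := hk.1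
  have hs := sin_pi_mul_pos hk
  have hpi := Real.pi_pos
  have h1 : HasDerivAt (fun k : ℝ => 1 - 3 * k) (-3) k := by
    simpa using ((hasDerivAt_id k).const_mul 3).const_sub 1
  have h2 : HasDerivAt (fun k : ℝ => 5 * (1 + k) * (1 + 2 * k)) (5 * (3 + 4 * k)) k := by
    have := (((hasDerivAt_id k).const_add 1).const_mul 5).mul
      (((hasDerivAt_id k).const_mul 2).const_add 1)
    refine this.congr_deriv ?_
    simp only [id]
    ring
  have h3 := h1.div h2 (by positivity)
  have hy : HasDerivAt (fun k : ℝ => Real.pi * k) Real.pi k := by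
    simpa using (hasDerivAt_id k).const_mul Real.pi
  have h4 := (hy.cos.div hy.sin hs.ne').const_mul a
  have h5 := h3.add h4
  have h6 : (fun k => nullEpsilon k a) = fun k => (1 - 3 * k) / (5 * (1 + k) * (1 + 2 * k))
      + a * (Real.cos (Real.pi * k) / Real.sin (Real.pi * k)) := by
    funext k
    rw [nullEpsilon, pseudoEpsilon, Real.cot_eq_cos_div_sin]
  refine ⟨_, ?_, by rw [h6]; exact h5⟩
  have e1 : (-3 * (5 * (1 + k) * (1 + 2 * k)) - (1 - 3 * k) * (5 * (3 + 4 * k))) < 0 := by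
    nlinarith [hk.1, hk.2]
  have e2 : -Real.sin (Real.pi * k) * Real.pi * Real.sin (Real.pi * k)
      - Real.cos (Real.pi * k) * (Real.cos (Real.pi * k) * Real.pi) = -Real.pi := by
    linear_combination (-Real.pi) * Real.sin_sq_add_cos_sq (Real.pi * k)
  rw [e2]
  exact add_neg (div_neg_of_neg_of_pos e1 (by positivity))
    (mul_neg_of_pos_of_neg ha (div_neg_of_neg_of_pos (by linarith) (by positivity)))

theorem strictAntiOn_nullEpsilon {a : ℝ} (ha : 0 < a) :
    StrictAntiOn (fun k => nullEpsilon k a) (Ioo 0 1) := by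
  refine strictAntiOn_of_deriv_neg (convex_Ioo 0 1) (fun k hk => ?_) fun k hk => ?_
  · obtain ⟨s, -, h⟩ := exists_hasDerivAt_nullEpsilon hk ha
    exact h.continuousAt.continuousWithinAt
  · rw [interior_Ioo] at hk
    obtain ⟨s, hs, h⟩ := exists_hasDerivAt_nullEpsilon hk ha
    rwa [h.deriv]

theorem abs_pseudoEpsilon_le {k : ℝ} (hk : k ∈ Ioo (0 : ℝ) 1) : |pseudoEpsilon k| ≤ 1 := by
  have hk0 := hk.1
  have hk1 := hk.2
  have : 0 < 5 * (1 + k) * (1 + 2 * k) := by positivity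
  rw [pseudoEpsilon, abs_div, abs_of_pos this, div_le_one this, abs_le]
  constructor <;> nlinarith

theorem exists_cot_pi_mul_eq (y : ℝ) : ∃ k ∈ Ioo (0 : ℝ) 1, Real.cot (Real.pi * k) = y := by
  have hpi := Real.pi_pos
  have h1 := Real.arctan_lt_pi_div_two y
  have h2 := Real.neg_pi_div_two_lt_arctan y
  have e : Real.pi * ((Real.pi / 2 - Real.arctan y) / Real.pi) = Real.pi / 2 - Real.arctan y := by
    field_simp
  refine ⟨(Real.pi / 2 - Real.arctan y) / Real.pi, ⟨by apply div_pos <;> linarith, ?_⟩, ?_⟩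
  · rw [div_lt_one hpi]; linarith
  · rw [e, Real.cot_eq_cos_div_sin, Real.cos_pi_div_two_sub, Real.sin_pi_div_two_sub,
      ← Real.tan_eq_sin_div_cos, Real.tan_arctan]

/-- `|g| ≤ 1` on `(0, 1)`, so points where `a cot(πk)` equals `ε + 1` and `ε - 1` enclose the value
`ε`; the intermediate value theorem does the rest. -/
theorem exists_nullEpsilon_eq {a : ℝ} (ha : 0 < a) (ε : ℝ) :
    ∃ k ∈ Ioo (0 : ℝ) 1, nullEpsilon k a = ε := by
  obtain ⟨k₁, hk₁, h₁⟩ := exists_cot_pi_mul_eq ((ε + 1) / a)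
  obtain ⟨k₂, hk₂, h₂⟩ := exists_cot_pi_mul_eq ((ε - 1) / a)
  have hsub : uIcc k₁ k₂ ⊆ Ioo 0 1 := (convex_Ioo (0 : ℝ) 1).ordConnected.uIcc_subset hk₁ hk₂
  have hc : ContinuousOn (fun k => nullEpsilon k a) (uIcc k₁ k₂) := fun k hk => by
    obtain ⟨s, -, h⟩ := exists_hasDerivAt_nullEpsilon (hsub hk) ha
    exact h.continuousAt.continuousWithinAt
  have e₁ : nullEpsilon k₁ a = pseudoEpsilon k₁ + (ε + 1) := by
    rw [nullEpsilon, h₁, mul_div_cancel₀ _ ha.ne']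
  have e₂ : nullEpsilon k₂ a = pseudoEpsilon k₂ + (ε - 1) := by
    rw [nullEpsilon, h₂, mul_div_cancel₀ _ ha.ne']
  have b₁ := abs_le.1 (abs_pseudoEpsilon_le hk₁)
  have b₂ := abs_le.1 (abs_pseudoEpsilon_le hk₂)
  have hmem : ε ∈ uIcc (nullEpsilon k₁ a) (nullEpsilon k₂ a) := by
    rw [mem_uIcc, e₁, e₂]
    right
    constructor <;> linarith [b₁.1, b₁.2, b₂.1, b₂.2]
  obtain ⟨k, hk, h⟩ := intermediate_value_uIcc hc hmem
  exact ⟨k, hsub hk, h⟩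

open Classical in
/-- The mixing rate at the equilibrium of the blow-up system. -/
noncomputable def mixingRate (ε a : ℝ) : ℝ :=
  if h : ∃ k ∈ Ioo (0 : ℝ) 1, nullEpsilon k a = ε then h.choose else 0

theorem mixingRate_spec {a : ℝ} (ha : 0 < a) (ε : ℝ) :
    mixingRate ε a ∈ Ioo (0 : ℝ) 1 ∧ nullEpsilon (mixingRate ε a) a = ε := by
  rw [mixingRate, dif_pos (exists_nullEpsilon_eq ha ε)]
  exact (exists_nullEpsilon_eq ha ε).choose_spec

theorem mixingRate_nullEpsilon {k a : ℝ} (hk : k ∈ Ioo (0 : ℝ) 1) (ha : 0 < a) :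
    mixingRate (nullEpsilon k a) a = k :=
  (strictAntiOn_nullEpsilon ha).injOn (mixingRate_spec ha _).1 hk (mixingRate_spec ha _).2

/-- Comparisons of mixing rates become explicit inequalities for `ε`, with reversed order;
continuity, limits and signs of the trace are all obtained this way. -/
theorem lt_mixingRate_iff {k a ε : ℝ} (hk : k ∈ Ioo (0 : ℝ) 1) (ha : 0 < a) :
    k < mixingRate ε a ↔ ε < nullEpsilon k a := by
  have h := (strictAntiOn_nullEpsilon ha).lt_iff_gt (mixingRate_spec ha ε).1 hk
  simp only [(mixingRate_spec ha ε).2] at h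
  exact h.symm

theorem mixingRate_lt_iff {k a ε : ℝ} (hk : k ∈ Ioo (0 : ℝ) 1) (ha : 0 < a) :
    mixingRate ε a < k ↔ nullEpsilon k a < ε := by
  have h := (strictAntiOn_nullEpsilon ha).lt_iff_gt hk (mixingRate_spec ha ε).1
  simp only [(mixingRate_spec ha ε).2] at h
  exact h.symm

theorem blowUp_eq_zero_iff_eq {ε a : ℝ} (ha : 0 < a) {p : ℝ × ℝ} (hp : p.2 ∈ Ioo (0 : ℝ) 1) :
    blowUp ε a p = 0 ↔ p = equilibrium (mixingRate ε a) := by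
  rw [blowUp_eq_zero_iff ha hp]
  constructor
  · rintro ⟨h1, rfl⟩
    rwa [mixingRate_nullEpsilon hp ha]
  · rintro rfl
    exact ⟨rfl, (mixingRate_spec ha ε).2⟩

theorem continuous_mixingRate {a : ℝ} (ha : 0 < a) : Continuous fun ε => mixingRate ε a := by
  rw [continuous_iff_continuousAt]
  intro ε
  have hK := (mixingRate_spec ha ε).1
  refine tendsto_order.2 ⟨fun k hk => ?_, fun k hk => ?_⟩
  · obtain ⟨l, hl, hl'⟩ := exists_between (max_lt hk hK.1)
    have hl01 : l ∈ Ioo (0 : ℝ) 1 := ⟨(le_max_right _ _).trans_lt hl, hl'.trans hK.2⟩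
    filter_upwards [gt_mem_nhds ((lt_mixingRate_iff hl01 ha).1 hl')] with ε' hε'
    exact ((le_max_left _ _).trans_lt hl).trans ((lt_mixingRate_iff hl01 ha).2 hε')
  · obtain ⟨l, hl, hl'⟩ := exists_between (lt_min hk hK.2)
    have hl01 : l ∈ Ioo (0 : ℝ) 1 := ⟨hK.1.trans hl, hl'.trans_le (min_le_right _ _)⟩
    filter_upwards [lt_mem_nhds ((mixingRate_lt_iff hl01 ha).1 hl)] with ε' hε'
    exact ((mixingRate_lt_iff hl01 ha).2 hε').trans (hl'.trans_le (min_le_left _ _))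

theorem exists_hasDerivAt_mixingRate {a : ℝ} (ha : 0 < a) (ε : ℝ) :
    ∃ s < 0, HasDerivAt (fun ε => mixingRate ε a) s ε := by
  obtain ⟨s, hs, h⟩ := exists_hasDerivAt_nullEpsilon (mixingRate_spec ha ε).1 ha
  exact ⟨s⁻¹, inv_lt_zero.2 hs, HasDerivAt.of_local_left_inverse
    (continuous_mixingRate ha).continuousAt h hs.ne
    (Eventually.of_forall fun ε => (mixingRate_spec ha ε).2)⟩

theorem pseudoEpsilon_third : pseudoEpsilon (1 / 3) = 0 := by norm_num [pseudoEpsilon]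

/-- For fixed `k`, `nullEpsilon k a - ε` tends to `g(k)`, which is positive to the left of `1/3` and
negative to the right. By monotonicity this encloses the mixing rate. -/
theorem tendsto_mixingRate : Tendsto (fun q : ℝ × ℝ => mixingRate q.1 q.2)
    (𝓝[{q | 0 < q.2}] (0, 0)) (𝓝 (1 / 3)) := by
  have hlim : ∀ k, Tendsto (fun q : ℝ × ℝ => nullEpsilon k q.2 - q.1)
      (𝓝[{q | 0 < q.2}] (0, 0)) (𝓝 (pseudoEpsilon k)) := fun k => by
    have hc : Continuous fun q : ℝ × ℝ => nullEpsilon k q.2 - q.1 := by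
      unfold nullEpsilon; fun_prop
    have := hc.tendsto (0, 0)
    simp only [nullEpsilon, zero_mul, add_zero, sub_zero] at this
    exact this.mono_left nhdsWithin_le_nhds
  refine tendsto_order.2 ⟨fun k hk => ?_, fun k hk => ?_⟩
  · obtain ⟨l, hl, hl'⟩ := exists_between (max_lt hk (show (0 : ℝ) < 1 / 3 by norm_num))
    have hl0 : 0 < l := (le_max_right _ _).trans_lt hl
    have hl01 : l ∈ Ioo (0 : ℝ) 1 := ⟨hl0, by linarith⟩
    have hp : 0 < pseudoEpsilon l := by
      unfold pseudoEpsilon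
      have : 0 < 1 - 3 * l := by linarith
      positivity
    filter_upwards [(hlim l).eventually (lt_mem_nhds hp), self_mem_nhdsWithin] with q hq hq2
    exact ((le_max_left _ _).trans_lt hl).trans ((lt_mixingRate_iff hl01 hq2).2 (by linarith))
  · obtain ⟨l, hl, hl'⟩ := exists_between (lt_min hk (show (1 / 3 : ℝ) < 1 by norm_num))
    have hl0 : 0 < l := by linarith
    have hl01 : l ∈ Ioo (0 : ℝ) 1 := ⟨hl0, hl'.trans_le (min_le_right _ _)⟩
    have hp : pseudoEpsilon l < 0 := by
      unfold pseudoEpsilon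
      exact div_neg_of_neg_of_pos (by linarith) (by positivity)
    filter_upwards [(hlim l).eventually (gt_mem_nhds hp), self_mem_nhdsWithin] with q hq hq2
    exact ((mixingRate_lt_iff hl01 hq2).2 (by linarith)).trans (hl'.trans_le (min_le_left _ _))

theorem equilibrium_third : equilibrium (1 / 3) = (3 / 4, 1 / 3) := by
  norm_num [equilibrium]

theorem tendsto_equilibrium_mixingRate :
    Tendsto (fun q : ℝ × ℝ => equilibrium (mixingRate q.1 q.2))
      (𝓝[{q | 0 < q.2}] (0, 0)) (𝓝 (3 / 4, 1 / 3)) := by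
  have h := (continuousAt_equilibrium (k := 1 / 3) (by norm_num)).tendsto.comp tendsto_mixingRate
  rwa [equilibrium_third] at h

end Branch

/-! ### The curve of zero trace and its slope at the origin -/

section HopfCurve

/-- The value of `a` at which the equilibrium with mixing rate `k` has zero trace. -/
noncomputable def hopfParam (k : ℝ) : ℝ :=
  -pseudoEpsilon k * Real.sin (Real.pi * k) ^ 2 / (Real.pi * (3 / 2 + 2 * k))

/-- The trace depends on `a` only through `1 / a`; factored like this, its sign is that of
`hopfParam k - a`. -/
theorem halfTrace_eq {k a : ℝ} (hk : 0 < k) (ha : 0 < a) :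
    halfTrace k a = (3 / 2 + 2 * k) / 2 * (hopfParam k / a - 1) := by
  have hpi := Real.pi_pos
  rw [halfTrace, jacD, hopfParam]
  field_simp
  ring

theorem contDiffAt_hopfParam {k : ℝ} (hk : k ∈ Ioo (0 : ℝ) 1) : ContDiffAt ℝ 1 hopfParam k := by
  have hk0 := hk.1
  have hpi := Real.pi_pos
  have h1 : 5 * (1 + k) * (1 + 2 * k) ≠ 0 := by positivity
  have h2 : Real.pi * (3 / 2 + 2 * k) ≠ 0 := by positivity
  unfold hopfParam pseudoEpsilon
  fun_prop (disch := assumption)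

theorem hopfParam_third : hopfParam (1 / 3) = 0 := by
  rw [hopfParam, pseudoEpsilon_third]; simp

theorem cot_pi_third : Real.cot (Real.pi * (1 / 3)) = √3 / 3 := by
  have h3 : √3 * √3 = 3 := Real.mul_self_sqrt (by norm_num)
  have h0 : √3 ≠ 0 := by positivity
  rw [mul_one_div, Real.cot_eq_cos_div_sin, Real.cos_pi_div_three, Real.sin_pi_div_three]
  field_simp
  linear_combination -h3

theorem sin_sq_pi_third : Real.sin (Real.pi * (1 / 3)) ^ 2 = 3 / 4 := by
  rw [mul_one_div, Real.sq_sin_pi_div_three]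

/-- `hopfParam` is `(3k - 1) W(k)` with `W > 0`, so at the zero `k = 1/3` the product rule leaves `3
W(1/3)`. -/
theorem deriv_hopfParam_third_pos : 0 < deriv hopfParam (1 / 3) := by
  set W : ℝ → ℝ := fun k => Real.sin (Real.pi * k) ^ 2
    / (5 * (1 + k) * (1 + 2 * k) * (Real.pi * (3 / 2 + 2 * k))) with hW
  have hpi := Real.pi_pos
  have h1 : 5 * (1 + (1 / 3 : ℝ)) * (1 + 2 * (1 / 3)) * (Real.pi * (3 / 2 + 2 * (1 / 3))) ≠ 0 := by
    positivity
  have hd : DifferentiableAt ℝ W (1 / 3) := by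
    fun_prop (disch := assumption)
  have h2 : HasDerivAt (fun k : ℝ => 3 * k - 1) 3 (1 / 3) := by
    simpa using ((hasDerivAt_id (1 / 3 : ℝ)).const_mul 3).sub_const 1
  have h3 := h2.mul hd.hasDerivAt
  have e : hopfParam = fun k => (3 * k - 1) * W k := by
    funext k
    simp only [hopfParam, pseudoEpsilon, hW]
    rw [← neg_div, div_mul_eq_mul_div, div_div, mul_div_assoc']
    congr 1; ring
  have h4 : HasDerivAt hopfParam (3 * W (1 / 3) + (3 * (1 / 3) - 1) * deriv W (1 / 3)) (1 / 3) := by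
    rw [e]; exact h3
  rw [h4.deriv]
  have : 0 < W (1 / 3) := by
    simp only [hW, sin_sq_pi_third]
    positivity
  linarith

/-- A neighbourhood of `1 / 3` on which the trace changes sign transversally. -/
theorem exists_hopf_interval : ∃ η ∈ Ioo (0 : ℝ) (1 / 12),
    ∀ k ∈ Ioo (1 / 3 - η) (1 / 3 + η), 0 < deriv hopfParam k ∧
      Real.cot (Real.pi * k) ∈ Icc (0 : ℝ) (7 / 10) := by
  have h01 : (1 / 3 : ℝ) ∈ Ioo (0 : ℝ) 1 := by norm_num
  have h1 : ∀ᶠ k in 𝓝 (1 / 3 : ℝ), 0 < deriv hopfParam k := by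
    have h := ((contDiffAt_hopfParam h01).continuousAt_fderiv one_ne_zero).clm_apply
      (continuousAt_const (y := (1 : ℝ)))
    simp only [fderiv_apply_one_eq_deriv] at h
    exact h.eventually (lt_mem_nhds deriv_hopfParam_third_pos)
  have h2 : ∀ᶠ k in 𝓝 (1 / 3 : ℝ), Real.cot (Real.pi * k) ∈ Ioo (0 : ℝ) (7 / 10) := by
    refine (continuousAt_cot_pi h01).eventually_mem (isOpen_Ioo.mem_nhds ?_)
    rw [cot_pi_third]
    have : √3 < 2.1 := by rw [Real.sqrt_lt' (by norm_num)]; norm_num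
    constructor
    · positivity
    · linarith
  obtain ⟨η, hη, h⟩ := Metric.eventually_nhds_iff_ball.1 (h1.and h2)
  -- Below `1/12` the interval stays within `(1/4, 5/12)`, where the numerical estimates for the
  -- determinant and for `ℓ` are made.
  have hm : 0 < min η (1 / 13) := lt_min hη (by norm_num)
  refine ⟨min η (1 / 13), ⟨hm, (min_le_right _ _).trans_lt (by norm_num)⟩, fun k hk => ?_⟩
  have := h k (by
    rw [Real.ball_eq_Ioo]
    have := min_le_left η (1 / 13 : ℝ)
    exact ⟨by linarith [hk.1], by linarith [hk.2]⟩)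
  exact ⟨this.1, Ioo_subset_Icc_self this.2⟩

/-- Strict monotonicity makes the inverse continuous: to place `K i` relative to a point `m` it
suffices to compare the values of `A`. -/
theorem tendsto_of_tendsto_strictMonoOn {ι : Type*} {l : Filter ι} {A : ℝ → ℝ} {K : ι → ℝ}
    {u v z : ℝ} (hA : StrictMonoOn A (Ioo u v)) (hz : z ∈ Ioo u v) (hK : ∀ᶠ i in l, K i ∈ Ioo u v)
    (h : Tendsto (fun i => A (K i)) l (𝓝 (A z))) : Tendsto K l (𝓝 z) := by
  refine tendsto_order.2 ⟨fun k hk => ?_, fun k hk => ?_⟩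
  · obtain ⟨m, hm, hm'⟩ := exists_between (max_lt hk hz.1)
    have hmI : m ∈ Ioo u v := ⟨(le_max_right _ _).trans_lt hm, hm'.trans hz.2⟩
    filter_upwards [h.eventually (lt_mem_nhds (hA hmI hz hm')), hK] with i hi hiI
    exact ((le_max_left _ _).trans_lt hm).trans ((hA.lt_iff_lt hmI hiI).1 hi)
  · obtain ⟨m, hm, hm'⟩ := exists_between (lt_min hk hz.2)
    have hmI : m ∈ Ioo u v := ⟨hz.1.trans hm, hm'.trans_le (min_le_right _ _)⟩
    filter_upwards [h.eventually (gt_mem_nhds (hA hz hmI hm)), hK] with i hi hiI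
    exact ((hA.lt_iff_lt hiI hmI).1 hi).trans (hm'.trans_le (min_le_left _ _))

/-- The mixing rate at the Hopf bifurcation, as a function of `a`. -/
theorem exists_hopfRate : ∃ η ∈ Ioo (0 : ℝ) (1 / 12), ∃ a₁ > 0, ∃ K : ℝ → ℝ,
    (∀ k ∈ Ioo (1 / 3 - η) (1 / 3 + η), 0 < deriv hopfParam k ∧
      Real.cot (Real.pi * k) ∈ Icc (0 : ℝ) (7 / 10)) ∧
    StrictMonoOn hopfParam (Ioo (1 / 3 - η) (1 / 3 + η)) ∧
    (∀ a ∈ Ioo 0 a₁, K a ∈ Ioo (1 / 3) (1 / 3 + η) ∧ hopfParam (K a) = a) ∧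
    ContinuousOn K (Ioo 0 a₁) ∧ Tendsto K (𝓝[>] 0) (𝓝 (1 / 3)) := by
  obtain ⟨η, hη, h⟩ := exists_hopf_interval
  have hη0 := hη.1
  have hη1 := hη.2
  have h01 : ∀ k ∈ Ioo (1 / 3 - η) (1 / 3 + η), k ∈ Ioo (0 : ℝ) 1 := fun k hk =>
    ⟨by linarith [hk.1], by linarith [hk.2]⟩
  have hc : ContinuousOn hopfParam (Ioo (1 / 3 - η) (1 / 3 + η)) := fun k hk =>
    (contDiffAt_hopfParam (h01 k hk)).continuousAt.continuousWithinAt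
  have hmono : StrictMonoOn hopfParam (Ioo (1 / 3 - η) (1 / 3 + η)) :=
    strictMonoOn_of_deriv_pos (convex_Ioo _ _) hc fun k hk => (h k (interior_subset hk)).1
  have m1 : (1 / 3 : ℝ) ∈ Ioo (1 / 3 - η) (1 / 3 + η) := ⟨by linarith, by linarith⟩
  have m2 : 1 / 3 + η / 2 ∈ Ioo (1 / 3 - η) (1 / 3 + η) := ⟨by linarith, by linarith⟩
  have ha₁ : 0 < hopfParam (1 / 3 + η / 2) := by
    rw [← hopfParam_third]
    exact hmono m1 m2 (by linarith)
  have hex : ∀ a ∈ Ioo 0 (hopfParam (1 / 3 + η / 2)), ∃ k ∈ Ioo (1 / 3) (1 / 3 + η),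
      hopfParam k = a := by
    intro a ha
    have hsub : Icc (1 / 3) (1 / 3 + η / 2) ⊆ Ioo (1 / 3 - η) (1 / 3 + η) := fun k hk =>
      ⟨by linarith [hk.1], by linarith [hk.2]⟩
    obtain ⟨k, hk, hka⟩ := intermediate_value_Ioo (by linarith) (hc.mono hsub)
      (by rwa [hopfParam_third] : a ∈ Ioo (hopfParam (1 / 3)) (hopfParam (1 / 3 + η / 2)))
    exact ⟨k, ⟨hk.1, by linarith [hk.2]⟩, hka⟩
  choose! K hK hKa using hex
  have hKI : ∀ a ∈ Ioo 0 (hopfParam (1 / 3 + η / 2)), K a ∈ Ioo (1 / 3 - η) (1 / 3 + η) :=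
    fun a ha => ⟨by linarith [(hK a ha).1], (hK a ha).2⟩
  refine ⟨η, hη, _, ha₁, K, h, hmono, fun a ha => ⟨hK a ha, hKa a ha⟩, fun a ha => ?_, ?_⟩
  · refine ContinuousAt.continuousWithinAt ?_
    have hev : ∀ᶠ b in 𝓝 a, b ∈ Ioo 0 (hopfParam (1 / 3 + η / 2)) := isOpen_Ioo.mem_nhds ha
    refine tendsto_of_tendsto_strictMonoOn hmono (hKI a ha) (hev.mono hKI) ?_
    rw [hKa a ha]
    exact tendsto_id.congr' (hev.mono fun b hb => (hKa b hb).symm)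
  · have hev : ∀ᶠ b in 𝓝[>] (0 : ℝ), b ∈ Ioo 0 (hopfParam (1 / 3 + η / 2)) :=
      Ioo_mem_nhdsGT ha₁
    refine tendsto_of_tendsto_strictMonoOn hmono m1 (hev.mono hKI) ?_
    rw [hopfParam_third]
    exact (tendsto_id.mono_left nhdsWithin_le_nhds).congr' (hev.mono fun b hb => (hKa b hb).symm)

/-- The slope at `a = 0` of the bifurcation curve. -/
theorem tendsto_nullEpsilon_div {K : ℝ → ℝ} {a₁ : ℝ} (ha₁ : 0 < a₁)
    (hK : ∀ a ∈ Ioo 0 a₁, K a ∈ Ioo (1 / 3) 1 ∧ hopfParam (K a) = a)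
    (hlim : Tendsto K (𝓝[>] 0) (𝓝 (1 / 3))) :
    Tendsto (fun a => nullEpsilon (K a) a / a) (𝓝[>] 0) (𝓝 (√3 / 3 - 26 * Real.pi / 9)) := by
  have hpi := Real.pi_pos
  have hc : ContinuousAt (fun k => Real.cot (Real.pi * k)
      - Real.pi * (3 / 2 + 2 * k) / Real.sin (Real.pi * k) ^ 2) (1 / 3) := by
    have h1 := continuousAt_cot_pi (k := 1 / 3) (by norm_num)
    have h2 : Real.sin (Real.pi * (1 / 3)) ^ 2 ≠ 0 := by rw [sin_sq_pi_third]; norm_num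
    fun_prop (disch := assumption)
  have h := hc.tendsto.comp hlim
  rw [cot_pi_third, sin_sq_pi_third] at h
  have e : √3 / 3 - Real.pi * (3 / 2 + 2 * (1 / 3)) / (3 / 4) = √3 / 3 - 26 * Real.pi / 9 := by ring
  rw [e] at h
  refine h.congr' ?_
  filter_upwards [Ioo_mem_nhdsGT ha₁] with a ha
  obtain ⟨hKm, hKa⟩ := hK a ha
  have hK0 : 0 < K a := by linarith [hKm.1]
  have hs := sin_pi_mul_pos ⟨hK0, hKm.2⟩
  have ha0 := ha.1
  -- The equation `hopfParam (K a) = a` solved for `g`. After division by `a` the curve is a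
  -- continuous function of `K a` alone, evaluated in the limit at `1/3`.
  have hg : pseudoEpsilon (K a) = -(a * (Real.pi * (3 / 2 + 2 * K a)
      / Real.sin (Real.pi * K a) ^ 2)) := by
    nth_rewrite 2 [← hKa]
    rw [hopfParam]
    field_simp
  simp only [Function.comp, nullEpsilon]
  rw [hg]
  field_simp
  ring

end HopfCurve

/-! ### The supercritical Hopf bifurcation on the curve -/

section Hopf

theorem halfTrace_neg_iff {k a : ℝ} (hk : 0 < k) (ha : 0 < a) :
    halfTrace k a < 0 ↔ hopfParam k < a := by
  have h : 0 < (3 / 2 + 2 * k) / 2 := by positivity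
  rw [halfTrace_eq hk ha, ← not_le, mul_nonneg_iff_of_pos_left h, sub_nonneg, one_le_div ha, not_le]

theorem halfTrace_pos_iff {k a : ℝ} (hk : 0 < k) (ha : 0 < a) :
    0 < halfTrace k a ↔ a < hopfParam k := by
  have h : 0 < (3 / 2 + 2 * k) / 2 := by positivity
  rw [halfTrace_eq hk ha, mul_pos_iff_of_pos_left h, sub_pos, one_lt_div ha]

/-- Zero trace forces `d = 1 + k`, so the determinant is `jacB / (1 + k) - (1 + k)²`. From `cot² ≤
49/100` one gets `sin² ≥ 67/100`, and `aπ ≤ 1/50` then makes `jacB` at least `13.4`. -/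
theorem four_le_jacDet {k a : ℝ} (hk : k ∈ Ioo (1 / 4 : ℝ) (5 / 12)) (ha : a ∈ Ioo (0 : ℝ) (1 / 200))
    (hc : Real.cot (Real.pi * k) ∈ Icc (0 : ℝ) (7 / 10)) (hσ : halfTrace k a = 0) :
    4 ≤ jacDet k a := by
  have hk01 : k ∈ Ioo (0 : ℝ) 1 := ⟨by linarith [hk.1], by linarith [hk.2]⟩
  have hs := sin_pi_mul_pos hk01
  have hpi := Real.pi_pos
  have ha0 := ha.1
  have hd : jacD k a = 1 + k := by rw [halfTrace] at hσ; linarith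
  have hone : Real.sin (Real.pi * k) ^ 2 * (1 + Real.cot (Real.pi * k) ^ 2) = 1 := by
    rw [Real.cot_eq_cos_div_sin]
    field_simp
    exact Real.sin_sq_add_cos_sq _
  have h1 : Real.cot (Real.pi * k) ^ 2 ≤ 49 / 100 := by nlinarith [hc.1, hc.2]
  have h2 : 67 / 100 ≤ Real.sin (Real.pi * k) ^ 2 := by nlinarith [sq_nonneg (Real.sin (Real.pi * k))]
  have h3 : a * Real.pi ≤ 1 / 50 := by
    nlinarith [Real.pi_le_four, ha.2]
  have h4 : 134 / 10 ≤ jacB k a := by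
    rw [jacB, le_div_iff₀ (by positivity)]
    nlinarith
  have h5 : 9 ≤ jacB k a / (1 + k) := by
    rw [le_div_iff₀ (by linarith [hk01.1])]
    nlinarith [hk.2]
  rw [jacDet, hd]
  nlinarith [hk.1, hk.2]

/-- At `k₀` the factor `hopfParam k / a - 1` vanishes, so the `k`-derivative of the trace is a
positive multiple of `deriv hopfParam k₀`. The mixing rate decreases in `ε`, which reverses the
sign. -/
theorem exists_hasDerivAt_halfTrace_mixingRate {k₀ a : ℝ} (hk₀ : k₀ ∈ Ioo (0 : ℝ) 1) (ha : 0 < a)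
    (hA : hopfParam k₀ = a) (hA' : 0 < deriv hopfParam k₀) :
    ∃ s < 0, HasDerivAt (fun ε => halfTrace (mixingRate ε a) a) s (nullEpsilon k₀ a) := by
  obtain ⟨s, hs, hK⟩ := exists_hasDerivAt_mixingRate ha (nullEpsilon k₀ a)
  have hk0 := hk₀.1
  have h1 := ((contDiffAt_hopfParam hk₀).differentiableAt one_ne_zero).hasDerivAt
  have h2 := ((((hasDerivAt_id k₀).const_mul 2).const_add (3 / 2)).div_const 2).mul
    ((h1.div_const a).sub_const 1)
  rw [hA, div_self ha.ne', sub_self, mul_zero, zero_add] at h2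
  have h3 : HasDerivAt (fun k => halfTrace k a)
      ((3 / 2 + 2 * id k₀) / 2 * (deriv hopfParam k₀ / a)) k₀ := by
    refine h2.congr_of_eventuallyEq ?_
    filter_upwards [lt_mem_nhds hk0] with k hk
    exact halfTrace_eq hk ha
  rw [← mixingRate_nullEpsilon hk₀ ha] at h3
  have h4 : HasDerivAt (fun ε => halfTrace (mixingRate ε a) a) _ (nullEpsilon k₀ a) :=
    HasDerivAt.comp (h₂ := fun k => halfTrace k a) (nullEpsilon k₀ a) h3 hK
  refine ⟨_, ?_, h4⟩
  rw [mixingRate_nullEpsilon hk₀ ha]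
  refine mul_neg_of_pos_of_neg ?_ hs
  simp only [id]
  positivity

/-- Every property is known in terms of `k` and is pulled back along the decreasing map `ε ↦
mixingRate ε a`. The bounds on `u`, `v` and `a` enter only through the negativity of `ℓ` and the
lower bound of the determinant. -/
theorem isSupercriticalHopf_blowUp {u v k₀ a : ℝ} (hu : 1 / 4 ≤ u) (hv : v ≤ 5 / 12)
    (hmono : StrictMonoOn hopfParam (Ioo u v)) (hk₀ : k₀ ∈ Ioo u v) (ha : a ∈ Ioo (0 : ℝ) (1 / 200))
    (hA : hopfParam k₀ = a) (hA' : 0 < deriv hopfParam k₀)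
    (hc : Real.cot (Real.pi * k₀) ∈ Icc (0 : ℝ) (7 / 10)) :
    IsSupercriticalHopf (fun ε => blowUp ε a) (fun ε => equilibrium (mixingRate ε a))
      (nullEpsilon k₀ a) := by
  have ha0 := ha.1
  have hk1 : k₀ ∈ Ioo (1 / 4 : ℝ) (5 / 12) := ⟨hu.trans_lt hk₀.1, hk₀.2.trans_le hv⟩
  have hk01 : k₀ ∈ Ioo (0 : ℝ) 1 := ⟨by linarith [hk1.1], by linarith [hk1.2]⟩
  have hK₀ := mixingRate_nullEpsilon hk01 ha0
  have hσ : halfTrace k₀ a = 0 := by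
    rw [halfTrace_eq hk01.1 ha0, hA, div_self ha0.ne', sub_self, mul_zero]
  have hcont := continuous_mixingRate ha0
  have hKt : Tendsto (fun ε => mixingRate ε a) (𝓝 (nullEpsilon k₀ a)) (𝓝 k₀) := by
    have := hcont.tendsto (nullEpsilon k₀ a)
    rwa [hK₀] at this
  have hKI : ∀ᶠ ε in 𝓝 (nullEpsilon k₀ a), mixingRate ε a ∈ Ioo u v :=
    hKt.eventually_mem (isOpen_Ioo.mem_nhds hk₀)
  have hdet := four_le_jacDet hk1 ha hc hσ
  have hfreq : freq k₀ a ^ 2 = jacDet k₀ a := by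
    rw [freq, hσ, Real.sq_sqrt] <;> simp only [ne_eq, OfNat.ofNat_ne_zero, not_false_eq_true,
      zero_pow, sub_zero]
    linarith
  have hω : 0 < freq k₀ a := by
    rw [freq, hσ]
    refine Real.sqrt_pos.2 ?_
    linarith
  have hd : jacD k₀ a = 1 + k₀ := by rw [halfTrace] at hσ; linarith
  have hℓ : cubicLyapunov (freq k₀ a) (normalCoeff (Real.cot (Real.pi * k₀)) (1 / 2 + k₀) 0
      (freq k₀ a) (jacD k₀ a / freq k₀ a)) < 0 := by
    refine cubicLyapunov_normalCoeff_neg hc ⟨?_, ?_⟩ ⟨?_, ?_⟩ (hdet.trans_eq hfreq.symm) <;>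
      linarith [hk1.1, hk1.2]
  have hneg : ∀ᶠ ε in 𝓝 (nullEpsilon k₀ a), nullEpsilon k₀ a < ε →
      halfTrace (mixingRate ε a) a < 0 := by
    filter_upwards [hKI] with ε hε h
    rw [halfTrace_neg_iff (mixingRate_spec ha0 ε).1.1 ha0]
    nth_rewrite 2 [← hA]
    exact hmono hε hk₀ ((mixingRate_lt_iff hk01 ha0).2 h)
  have hpos : ∀ᶠ ε in 𝓝 (nullEpsilon k₀ a), ε < nullEpsilon k₀ a →
      0 < halfTrace (mixingRate ε a) a := by
    filter_upwards [hKI] with ε hε h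
    rw [halfTrace_pos_iff (mixingRate_spec ha0 ε).1.1 ha0]
    nth_rewrite 1 [← hA]
    exact hmono hk₀ hε ((lt_mixingRate_iff hk01 ha0).2 h)
  have hnull := fun ε => (mixingRate_spec ha0 ε).2
  have hK01 := fun ε => (mixingRate_spec ha0 ε).1
  refine ⟨?_, ?_, ?_, ?_, ?_, ?_, ?_⟩
  · exact ContinuousAt.comp (g := equilibrium) (f := fun ε => mixingRate ε a)
      (continuousAt_equilibrium (hK01 _)) hcont.continuousAt
  · have h : ∀ᶠ q : ℝ × (ℝ × ℝ) in 𝓝 (nullEpsilon k₀ a,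
        equilibrium (mixingRate (nullEpsilon k₀ a) a)), q.2.2 ∈ Ioo (0 : ℝ) 1 :=
      (by fun_prop : Continuous fun q : ℝ × (ℝ × ℝ) => q.2.2).continuousAt.eventually_mem
        (isOpen_Ioo.mem_nhds (hK01 _))
    exact h.mono fun q hq => blowUp_eq_zero_iff_eq ha0 hq
  · refine ⟨fun ε => halfTrace (mixingRate ε a) a, fun ε => freq (mixingRate ε a) a, ?_, ?_, ?_⟩
    · have hc : ContinuousAt (fun k => jacDet k a - halfTrace k a ^ 2) k₀ :=
        (continuousAt_jacDet hk01).sub ((continuousAt_halfTrace hk01).pow 2)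
      have hp : 0 < jacDet k₀ a - halfTrace k₀ a ^ 2 := by rw [hσ]; linarith
      filter_upwards [(hc.tendsto.comp hKt).eventually (lt_mem_nhds hp)] with ε hε
      refine ⟨Real.sqrt_pos.2 hε, ?_⟩
      have := aroots_charpoly_blowUp (hK01 ε) ha0 (Real.sq_sqrt hε.le)
      rwa [hnull ε] at this
    · simp only [hK₀, hσ]
    · exact exists_hasDerivAt_halfTrace_mixingRate hk01 ha0 hA hA'
  · obtain ⟨C, hCs, hC⟩ := exists_cos_taylor
    obtain ⟨D, hDs, hD⟩ := exists_sin_taylor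
    have hr : jacB k₀ a / freq k₀ a ≠ 0 := (div_pos (jacB_pos hk01 ha0) hω).ne'
    have hconj := conjField_blowUp hC hD hk01 ha0 hω (by rw [hfreq, hσ]; ring) hr
    have hrs := fun i => contDiff_normalRem hCs hDs (Real.cot (Real.pi * k₀)) (1 / 2 + k₀)
      (halfTrace k₀ a) (freq k₀ a) ((jacD k₀ a - halfTrace k₀ a) / freq k₀ a) i
    refine ⟨freq k₀ a, normalCoord ((jacD k₀ a - halfTrace k₀ a) / freq k₀ a)
      (jacB k₀ a / freq k₀ a) hr, hω, fun w => ?_, ?_⟩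
    · simp only [hK₀]
      change fderiv ℝ (conjField _ _ _) 0 w = _
      rw [hconj, fderiv_cubicField hrs, hσ]
      ext <;> simp
    · simp only [hK₀]
      change lyapunovCoeff _ (conjField _ _ _) < 0
      rw [hconj, lyapunovCoeff_cubicField hrs, hσ, sub_zero]
      exact hℓ
  · filter_upwards [nhdsWithin_le_nhds hneg, self_mem_nhdsWithin] with ε hε h
    have := asymptoticallyStable_equilibrium (hK01 ε) ha0 (hε h)
    rwa [hnull ε] at this
  · filter_upwards [nhdsWithin_le_nhds hpos, self_mem_nhdsWithin] with ε hε h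
    have := not_lyapunovStable_equilibrium (hK01 ε) ha0 (hε h)
    rwa [hnull ε] at this
  · obtain ⟨Γ, hΓ, hsub⟩ := exists_stable_orbit_blowUp hk01 ha0 hσ hℓ
    refine ⟨fun ε => Γ (mixingRate ε a), ?_, fun U hU => ?_⟩
    · filter_upwards [nhdsWithin_le_nhds hpos, self_mem_nhdsWithin,
        nhdsWithin_le_nhds (hKt.eventually hΓ)] with ε hε h hΓε
      have := hΓε (hε h)
      rwa [hnull ε] at this
    · simp only [hK₀] at hU
      filter_upwards [nhdsWithin_le_nhds hpos, self_mem_nhdsWithin,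
        nhdsWithin_le_nhds (hKt.eventually (hsub U hU))] with ε hε h hΓε
      exact hΓε (hε h)

end Hopf

/-! ### The Filippov system: fused focus and sliding -/

section Nonsmooth

theorem field_snd (k ε : ℝ) (p : ℝ × ℝ) : (field k ε p).2
    = -3 / 10 - (1 / 2 + k) * ε - (1 / 2 + k) * p.2 + 2 / 5 * p.1 := by
  simp only [field, α, β]
  ring

theorem isFusedFocus_field : IsFusedFocus (field 1 0) (field 0 0) (3 / 4, 0) := by
  have h : ∀ k : ℝ, ∀ v : ℝ × ℝ, fderiv ℝ (fun q => (field k 0 q).2) (3 / 4, 0) v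
      = -((1 / 2 + k) * v.2) + 2 / 5 * v.1 := fun k v => by
    have h1 : HasFDerivAt (fun q : ℝ × ℝ => q.2) (ContinuousLinearMap.snd ℝ ℝ ℝ) (3 / 4, 0) :=
      hasFDerivAt_snd
    have h2 : HasFDerivAt (fun q : ℝ × ℝ => q.1) (ContinuousLinearMap.fst ℝ ℝ ℝ) (3 / 4, 0) :=
      hasFDerivAt_fst
    simp only [field_snd]
    have h3 := ((h1.const_mul (1 / 2 + k)).const_sub (-3 / 10 - (1 / 2 + k) * 0)).add
      (h2.const_mul (2 / 5))
    have h4 : HasFDerivAt (fun q : ℝ × ℝ => -3 / 10 - (1 / 2 + k) * 0 - (1 / 2 + k) * q.2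
      + 2 / 5 * q.1) _ (3 / 4, 0) := h3
    rw [h4.fderiv]
    simp
  refine ⟨rfl, ?_, ?_, ?_, ?_, ?_⟩
  · norm_num [field_snd]
  · norm_num [field_snd]
  · rw [h]; norm_num [field, α, β]
  · rw [h]; norm_num [field, α, β]
  · norm_num [field]

/-- The normal velocity vanishes at `x = 3/4 + (5/2)(1/2 + k) ε`, affine in `k`, so the region is
the segment between the values at `k = 0` and `k = 1`. For `ε < 0` the end points change order,
hence `uIcc`. -/
theorem slidingRegion_eq (ε : ℝ) :
    slidingRegion ε = uIcc (3 / 4 + 5 / 4 * ε) (3 / 4 + 15 / 4 * ε) := by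
  rw [← segment_eq_uIcc, segment_eq_image]
  ext x
  simp only [slidingRegion, mem_image, field_snd, smul_eq_mul]
  refine exists_congr fun k => and_congr_right fun _ => ?_
  constructor <;> intro h <;> linarith

theorem slidingRate_eq (ε x k : ℝ) : slidingRate ε x k = -ε := by
  have h : HasDerivAt (fun l => (field l ε (x, 0)).2) (-ε) k := by
    simp only [field_snd]
    have h1 := (hasDerivAt_id k).const_add (1 / 2)
    refine ((((h1.mul_const ε).const_sub (-3 / 10)).sub (h1.mul_const 0)).add_const
      (2 / 5 * x)).congr_deriv ?_
    ring
  exact h.deriv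

end Nonsmooth

end Welander

/-! ### Assembly of the main theorem -/

theorem mainTheorem1 :
    -- the nonsmooth system: fused focus bifurcation at `(x, y) = (3/4, 0)`, `ε = 0`
    (Welander.IsFusedFocus (Welander.field 1 0) (Welander.field 0 0) (3 / 4, 0) ∧
      Welander.field (1 / 3) 0 (3 / 4, 0) = 0 ∧
      (∀ ε : ℝ, Welander.slidingRegion ε
        = Set.uIcc (3 / 4 + 5 / 4 * ε) (3 / 4 + 15 / 4 * ε)) ∧
      (∀ ε x k : ℝ, 0 < ε → Welander.slidingRate ε x k < 0) ∧
      (∀ ε x k : ℝ, ε < 0 → 0 < Welander.slidingRate ε x k)) ∧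
    -- the blown-up smooth system
    ∃ (a₀ ε₀ : ℝ) (E : ℝ × ℝ → ℝ × ℝ) (h : ℝ → ℝ), 0 < a₀ ∧ 0 < ε₀ ∧
      -- the equilibrium, and its limit as `(ε, a) → (0, 0)`, `a > 0`
      (∀ ε ∈ Set.Ioo (-ε₀) ε₀, ∀ a ∈ Set.Ioo 0 a₀, (E (ε, a)).2 ∈ Set.Ioo (0 : ℝ) 1 ∧
        ∀ p : ℝ × ℝ, p.2 ∈ Set.Ioo (0 : ℝ) 1 →
          (Welander.blowUp ε a p = 0 ↔ p = E (ε, a))) ∧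
      Filter.Tendsto E (nhdsWithin (0, 0) {q : ℝ × ℝ | 0 < q.2}) (nhds (3 / 4, 1 / 3)) ∧
      -- the bifurcation curve `ε = h a` and its limit as `a → 0`
      ContinuousOn h (Set.Ioo 0 a₀) ∧ (∀ a ∈ Set.Ioo 0 a₀, h a ∈ Set.Ioo (-ε₀) ε₀) ∧
      Filter.Tendsto (fun a => (h a, a)) (nhdsWithin 0 (Set.Ioi 0)) (nhds ((0 : ℝ), (0 : ℝ))) ∧
      Filter.Tendsto (fun a => h a / a) (nhdsWithin 0 (Set.Ioi 0))
        (nhds (Real.sqrt 3 / 3 - 26 * Real.pi / 9)) ∧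
      -- the supercritical Hopf bifurcation on the curve
      (∀ a ∈ Set.Ioo 0 a₀, Welander.IsSupercriticalHopf
        (fun ε => Welander.blowUp ε a) (fun ε => E (ε, a)) (h a)) ∧
      -- stability of the equilibrium on the two sides of the curve
      (∀ ε ∈ Set.Ioo (-ε₀) ε₀, ∀ a ∈ Set.Ioo 0 a₀,
        (h a < ε → Welander.AsymptoticallyStable (Welander.blowUp ε a) {E (ε, a)}) ∧
        (ε < h a → ¬ Welander.LyapunovStable (Welander.blowUp ε a) {E (ε, a)})) ∧
      -- the Hopf point converges to the fused focus, in the coordinates `(x, k)` and `(x, y)`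
      Filter.Tendsto (fun a => E (h a, a)) (nhdsWithin 0 (Set.Ioi 0)) (nhds (3 / 4, 1 / 3)) ∧
      Filter.Tendsto
        (fun a => ((E (h a, a)).1, -(a * Real.cot (Real.pi * (E (h a, a)).2))))
        (nhdsWithin 0 (Set.Ioi 0)) (nhds (3 / 4, 0)) := by
  open Set Filter Topology Welander in
  obtain ⟨η, hη, a₁, ha₁, K, hI, hmono, hK, hKc, hKlim⟩ := exists_hopfRate
  have hη0 := hη.1
  have hη1 := hη.2
  -- The stability statement concerns the whole box of parameters, so the box must keep the mixing
  -- rate inside the interval where `hopfParam` is monotone.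
  have hbox : ∀ᶠ q : ℝ × ℝ in 𝓝[{q | 0 < q.2}] (0, 0),
      mixingRate q.1 q.2 ∈ Ioo (1 / 3 - η) (1 / 3 + η) :=
    tendsto_mixingRate.eventually_mem (Ioo_mem_nhds (by linarith) (by linarith))
  obtain ⟨r, hr, hball⟩ := Metric.eventually_nhds_iff_ball.1 (eventually_nhdsWithin_iff.1 hbox)
  have hdiv : Tendsto (fun a => nullEpsilon (K a) a / a) (𝓝[>] 0)
      (𝓝 (√3 / 3 - 26 * Real.pi / 9)) :=
    tendsto_nullEpsilon_div ha₁ (fun a ha => ⟨⟨(hK a ha).1.1, by linarith [(hK a ha).1.2]⟩,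
      (hK a ha).2⟩) hKlim
  have hid : Tendsto (fun a : ℝ => a) (𝓝[>] 0) (𝓝 0) := tendsto_id.mono_left nhdsWithin_le_nhds
  have hlim : Tendsto (fun a => nullEpsilon (K a) a) (𝓝[>] 0) (𝓝 0) := by
    have h := hdiv.mul hid
    rw [mul_zero] at h
    refine h.congr' ?_
    filter_upwards [self_mem_nhdsWithin] with a ha
    exact div_mul_cancel₀ _ (ne_of_gt ha)
  -- `r` serves as `ε₀`; `a₂` makes `|h(a)| < r`.
  obtain ⟨a₂, ha₂, hsmall⟩ := (mem_nhdsGT_iff_exists_Ioo_subset).1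
    (hlim.eventually_mem (Ioo_mem_nhds (neg_lt_zero.2 hr) hr))
  -- `a₁` is the range of the Hopf curve, `a₂` bounds `h`, `r` keeps `(ε, a)` in the box, and
  -- `1/200` is needed for the lower bound of the determinant.
  have ha₀ : 0 < min (min a₁ a₂) (min r (1 / 200)) :=
    lt_min (lt_min ha₁ ha₂) (lt_min hr (by norm_num))
  have hlt : ∀ a ∈ Ioo 0 (min (min a₁ a₂) (min r (1 / 200))),
      a ∈ Ioo 0 a₁ ∧ a ∈ Ioo 0 a₂ ∧ a ∈ Ioo 0 r ∧ a ∈ Ioo 0 (1 / 200) := fun a ha => by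
    obtain ⟨h0, h⟩ := ha
    simp only [lt_min_iff] at h
    exact ⟨⟨h0, h.1.1⟩, ⟨h0, h.1.2⟩, ⟨h0, h.2.1⟩, ⟨h0, h.2.2⟩⟩
  have hKI : ∀ a ∈ Ioo 0 a₁, K a ∈ Ioo (1 / 3 - η) (1 / 3 + η) := fun a ha =>
    ⟨by linarith [(hK a ha).1.1], (hK a ha).1.2⟩
  have hK01 : ∀ a ∈ Ioo 0 a₁, K a ∈ Ioo (0 : ℝ) 1 := fun a ha =>
    ⟨by linarith [(hKI a ha).1], by linarith [(hKI a ha).2]⟩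
  have hmix : ∀ᶠ a in 𝓝[>] (0 : ℝ), mixingRate (nullEpsilon (K a) a) a = K a := by
    filter_upwards [Ioo_mem_nhdsGT ha₁] with a ha
    exact mixingRate_nullEpsilon (hK01 a ha) ha.1
  refine ⟨⟨isFusedFocus_field, ?_, slidingRegion_eq, fun ε x k h => ?_, fun ε x k h => ?_⟩,
    min (min a₁ a₂) (min r (1 / 200)), r, fun q => equilibrium (mixingRate q.1 q.2),
    fun a => nullEpsilon (K a) a, ha₀, hr, fun ε _ a ha => ⟨(mixingRate_spec ha.1 ε).1, fun p hp =>
      blowUp_eq_zero_iff_eq ha.1 hp⟩, tendsto_equilibrium_mixingRate, ?_, ?_, ?_, hdiv, ?_, ?_, ?_, ?_⟩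
  · norm_num [field, α, β]
  · rw [slidingRate_eq]; linarith
  · rw [slidingRate_eq]; linarith
  · intro a ha
    have h1 := hKc.mono (fun b hb => (hlt b hb).1) a ha
    have h2 := (continuousAt_pseudoEpsilon (hK01 a (hlt a ha).1)).comp_continuousWithinAt h1
    have h3 := (continuousAt_cot_pi (hK01 a (hlt a ha).1)).comp_continuousWithinAt h1
    exact h2.add (continuousWithinAt_id.mul h3)
  · exact fun a ha => hsmall (hlt a ha).2.1
  · exact hlim.prodMk_nhds hid
  · intro a ha
    have h := (hlt a ha).1
    exact isSupercriticalHopf_blowUp (by linarith) (by linarith) hmono (hKI a h)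
      (hlt a ha).2.2.2 (hK a h).2 (hI _ (hKI a h)).1 (hI _ (hKI a h)).2
  · intro ε hε a ha
    have h := (hlt a ha).1
    have ha0 := ha.1
    have hm : mixingRate ε a ∈ Ioo (1 / 3 - η) (1 / 3 + η) := by
      refine hball (ε, a) ?_ ha0
      rw [mem_ball_iff_norm, Prod.mk_zero_zero, sub_zero, Prod.norm_def, max_lt_iff]
      exact ⟨abs_lt.2 hε, by simpa [abs_of_pos ha0] using (hlt a ha).2.2.1.2⟩
    obtain ⟨hs1, hs2⟩ := mixingRate_spec ha0 ε
    refine ⟨fun hlt' => ?_, fun hlt' => ?_⟩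
    · have := asymptoticallyStable_equilibrium hs1 ha0 ((halfTrace_neg_iff hs1.1 ha0).2 (by
        nth_rewrite 2 [← (hK a h).2]
        exact hmono hm (hKI a h) ((mixingRate_lt_iff (hK01 a h) ha0).2 hlt')))
      rwa [hs2] at this
    · have := not_lyapunovStable_equilibrium hs1 ha0 ((halfTrace_pos_iff hs1.1 ha0).2 (by
        nth_rewrite 1 [← (hK a h).2]
        exact hmono (hKI a h) hm ((lt_mixingRate_iff (hK01 a h) ha0).2 hlt')))
      rwa [hs2] at this
  · have h := (continuousAt_equilibrium (k := 1 / 3) (by norm_num)).tendsto.comp hKlim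
    rw [equilibrium_third] at h
    exact h.congr' (hmix.mono fun a ha => by simp only [Function.comp, ha])
  · have h1 := (continuousAt_equilibrium (k := 1 / 3) (by norm_num)).fst.tendsto.comp hKlim
    have h2 := (hid.mul ((continuousAt_cot_pi (k := 1 / 3) (by norm_num)).tendsto.comp hKlim)).neg
    simp only [equilibrium_third, zero_mul, neg_zero] at h1 h2
    refine (h1.prodMk_nhds h2).congr' (hmix.mono fun a ha => ?_)
    simp only [Function.comp, ha, equilibrium]
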